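/- A weight is a measurable function $w:(0,\infty)\to[0,\infty]$ with $0<\int_0^x w(t)\,dt<\infty$ for all $x>0$. Conventions: $0\cdot\infty=0$, $0/0=\infty/\infty=0$; $p'=p/(p-1)$, $q'=q/(q-1)$, and $1/r=1/q-1/p$ when $q<p$. Let $1<p,q<\infty$. There is a constant $C\in(0,\infty)$ depending only on $p$ and $q$ such that the following holds for all weights $a,v,w$ and every weight $u$ that is finite-valued and continuous on $(0,\infty)$, provided that $$0<\int_0^x v(t)^{1-p'}\,dt<\infty\qquad\text{for all }x>0 .$$ Put $A(y)=\int_0^y a(s)\,ds$, $k(x,y)=\int_x^y\Big(\sup_{\tau\ge s}u(\tau)\Big)a(s)\,ds$ for $0<x\le y$, and $$N=\sup_{h\ge0}\frac{\Big(\int_0^\infty\Big(\int_0^x\Big(\sup_{\tau\ge t}u(\tau)\int_0^\tau h(y)\,dy\Big)a(t)\,dt\Big)^q w(x)\,dx\Big)^{1/q}}{\Big(\int_0^\infty h(s)^pv(s)\,ds\Big)^{1/p}}\in[0,\infty],$$ the supremum being over all measurable $h\ge 0$ on $(0,\infty)$. Let $$\varphi(t)=\sup_{\tau\ge t}u(\tau)^{p'}\int_0^\tau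 v(s)^{1-p'}\,ds,$$ which is non-increasing and either finite and continuous on $(0,\infty)$ or identically $\infty$; let $d(-\varphi)$ be the Lebesgue–Stieltjes measure on $(0,\infty)$ with $d(-\varphi)\big((x,y]\big)=\varphi(x)-\varphi(y)$ (taken to be $0$ if $\varphi\equiv\infty$), and let $$L=\Big(\int_0^\infty A(y)^qw(y)\,dy\Big)^{1/q}\lim_{t\to\infty}\Big(\sup_{\tau\ge t}u(\tau)\Big(\int_0^\tau v(s)^{1-p'}\,ds\Big)^{1/p'}\Big).$$ (i) If $p\le q$, then $C^{-1}M\le N\le C M$, where $$\begin{aligned}M={}&\sup_{t>0}\Big(\int_0^t v(x)^{1-p'}k(x,t)^{p'}dx\Big)^{1/p'}\Big(\int_t^\infty w\Big)^{1/q} +\sup_{t>0}\Big(\int_0^t v(x)^{1-p'}dx\Big)^{1/p'}\Big(\int_t^\infty k(t,y)^qw(y)\,dy\Big)^{1/q}\\ &+\sup_{x>0}\Big(\int_{[x,\infty)}d(-\varphi)\Big)^{1/p'}\Big(\int_0^xA(y)^qw(y)\,dy\Big)^{1/q} +\sup_{x>0}\Big(\int_{(0,x]}A(t)^{p'}\,d(-\varphi(t))\Big)^{1/p'}\Big(\int_x^\infty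 w\Big)^{1/q}+L.\end{aligned}$$ (ii) If $q<p$, then $C^{-1}M\le N\le C M$, where $$\begin{aligned}M={}&\Big(\int_0^\infty\Big(\int_0^tv(x)^{1-p'}dx\Big)^{r/q'}v(t)^{1-p'}\Big(\int_t^\infty k(t,z)^qw(z)\,dz\Big)^{r/q}dt\Big)^{1/r}\\ &+\Big(\int_0^\infty\Big(\int_0^tv(x)^{1-p'}k(x,t)^{p'}dx\Big)^{r/p'}\Big(\int_t^\infty w(s)\,ds\Big)^{r/p}w(t)\,dt\Big)^{1/r}\\ &+\Big(\int_0^\infty\Big(\int_{[x,\infty)}d(-\varphi)\Big)^{r/p'}\Big(\int_0^xA(y)^qw(y)\,dy\Big)^{r/p}A(x)^qw(x)\,dx\Big)^{1/r}\\ &+\Big(\int_0^\infty\Big(\int_{(0,x]}A(t)^{p'}\,d(-\varphi(t))\Big)^{r/p'}\Big(\int_x^\infty w(y)\,dy\Big)^{r/p}w(x)\,dx\Big)^{1/r}+L.\end{aligned}$$ -/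

import Mathlib

open Set Filter Topology MeasureTheory
open scoped ENNReal NNReal

noncomputable section

namespace SupHardy

/-- A weight on `(0,∞)`: a (Lebesgue) measurable function with values in `[0,∞]` such that
`0 < ∫_0^x w < ∞` for every `x > 0`. Only the values on `(0,∞)` matter. -/
structure IsWeight (w : ℝ → ℝ≥0∞) : Prop where
  aemeasurable : AEMeasurable w (volume.restrict (Ioi 0))
  pos : ∀ x : ℝ, 0 < x → 0 < ∫⁻ t in Ioo 0 x, w t
  lt_top : ∀ x : ℝ, 0 < x → ∫⁻ t in Ioo 0 x, w t < ∞

/-- The primitive `x ↦ ∫_0^x f`. -/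
def prim (f : ℝ → ℝ≥0∞) (x : ℝ) : ℝ≥0∞ := ∫⁻ t in Ioo 0 x, f t

/-- `supFrom f t = sup_{t ≤ τ} f(τ)`. -/
def supFrom (f : ℝ → ℝ≥0∞) (t : ℝ) : ℝ≥0∞ := ⨆ (τ : ℝ) (_ : t ≤ τ), f τ

/-- The conjugate exponent, `1/p + 1/p' = 1`. -/
def conj (p : ℝ) : ℝ := Real.conjExponent p

/-- The exponent `r` given by `1/r = 1/q - 1/p`. -/
def rExp (p q : ℝ) : ℝ := (1 / q - 1 / p)⁻¹

/-- `v^{1-p'}`; it is `∞` where `v = 0`. -/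
def dualWeight (p : ℝ) (v : ℝ → ℝ≥0∞) (t : ℝ) : ℝ≥0∞ := v t ^ (1 - conj p)

/-- The weighted norm `(∫_0^∞ f^p w)^{1/p}` of a non-negative function. -/
def wNorm (p : ℝ) (w f : ℝ → ℝ≥0∞) : ℝ≥0∞ := (∫⁻ x in Ioi 0, f x ^ p * w x) ^ (1 / p)

/-- The operator `(T_u h)(t) = sup_{t ≤ τ} u(τ) ∫_0^τ h`. -/
def supHardy (u : ℝ → ℝ≥0) (h : ℝ → ℝ≥0∞) (t : ℝ) : ℝ≥0∞ :=
  supFrom (fun τ => u τ * prim h τ) t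

/-- The operator norm: the supremum, over all measurable `h ≥ 0` on `(0,∞)`, of
`(∫_0^∞ (∫_0^x (T_u h)(t) a(t) dt)^q w(x) dx)^{1/q} / (∫_0^∞ h^p v)^{1/p}`,
where `0/0 = ∞/∞ = 0`. -/
def opNorm (p q : ℝ) (u : ℝ → ℝ≥0) (a v w : ℝ → ℝ≥0∞) : ℝ≥0∞ :=
  ⨆ (h : ℝ → ℝ≥0∞) (_ : AEMeasurable h (volume.restrict (Ioi 0))),
    wNorm q w (prim fun t => supHardy u h t * a t) / wNorm p v h

open Classical in
/-- The Lebesgue–Stieltjes measure `d(-φ)` on `(0,∞)`, seen as a measure on `ℝ` that is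
carried by `(0,∞)`, of a real-valued non-increasing function `φ` on `(0,∞)`: the Stieltjes
measure of `s ↦ -φ(e^s)` on `ℝ`, transported to `(0,∞)` by `s ↦ e^s`. For continuous `φ` it gives
mass `φ(x) - φ(y)` to `(x,y]`, `0 < x ≤ y`. (If `φ` is identically `∞` on `(0,∞)`, the measure
defined here is zero.) -/
def decrMeasure (φ : ℝ → ℝ≥0∞) : Measure ℝ :=
  if hφ : Monotone (fun s : ℝ => -(φ (Real.exp s)).toReal) then
    hφ.stieltjesFunction.measure.map Real.exp
  else 0

/-- `φ(t) = sup_{t ≤ τ} u(τ)^{p'} ∫_0^τ v^{1-p'}`. -/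
def phi (p : ℝ) (u : ℝ → ℝ≥0) (v : ℝ → ℝ≥0∞) (t : ℝ) : ℝ≥0∞ :=
  supFrom (fun τ => (u τ : ℝ≥0∞) ^ conj p * prim (dualWeight p v) τ) t

/-- The kernel `∫_x^y (sup_{s ≤ τ} u(τ)) a(s) ds`. -/
def kern (u : ℝ → ℝ≥0) (a : ℝ → ℝ≥0∞) (x y : ℝ) : ℝ≥0∞ :=
  ∫⁻ s in Ioo x y, supFrom (fun τ => (u τ : ℝ≥0∞)) s * a s

/-- `sup_{t>0} (∫_0^t v(x)^{1-p'} (∫_x^t (sup_{s≤τ} u(τ)) a(s) ds)^{p'} dx)^{1/p'}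
(∫_t^∞ w)^{1/q}`. -/
def termA1 (p q : ℝ) (u : ℝ → ℝ≥0) (a v w : ℝ → ℝ≥0∞) : ℝ≥0∞ :=
  ⨆ (t : ℝ) (_ : 0 < t),
    (∫⁻ x in Ioo 0 t, dualWeight p v x * kern u a x t ^ conj p) ^ (1 / conj p)
      * (∫⁻ y in Ioi t, w y) ^ (1 / q)

/-- `sup_{t>0} (∫_0^t v^{1-p'})^{1/p'}
(∫_t^∞ (∫_t^y (sup_{s≤τ} u(τ)) a(s) ds)^q w(y) dy)^{1/q}`. -/
def termA2 (p q : ℝ) (u : ℝ → ℝ≥0) (a v w : ℝ → ℝ≥0∞) : ℝ≥0∞ :=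
  ⨆ (t : ℝ) (_ : 0 < t),
    prim (dualWeight p v) t ^ (1 / conj p)
      * (∫⁻ y in Ioi t, kern u a t y ^ q * w y) ^ (1 / q)

/-- `sup_{x>0} (∫_{[x,∞)} d(-φ))^{1/p'} (∫_0^x A^q w)^{1/q}`, `A(y) = ∫_0^y a`. -/
def termA3 (p q : ℝ) (u : ℝ → ℝ≥0) (a v w : ℝ → ℝ≥0∞) : ℝ≥0∞ :=
  ⨆ (x : ℝ) (_ : 0 < x),
    (∫⁻ _ in Ici x, 1 ∂(decrMeasure (phi p u v))) ^ (1 / conj p)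
      * (∫⁻ y in Ioo 0 x, prim a y ^ q * w y) ^ (1 / q)

/-- `sup_{x>0} (∫_{(0,x]} A^{p'} d(-φ))^{1/p'} (∫_x^∞ w)^{1/q}`. -/
def termA4 (p q : ℝ) (u : ℝ → ℝ≥0) (a v w : ℝ → ℝ≥0∞) : ℝ≥0∞ :=
  ⨆ (x : ℝ) (_ : 0 < x),
    (∫⁻ t in Ioc 0 x, prim a t ^ conj p ∂(decrMeasure (phi p u v))) ^ (1 / conj p)
      * (∫⁻ y in Ioi x, w y) ^ (1 / q)

/-- `(∫_0^∞ A^q w)^{1/q} lim_{t→∞} sup_{t≤τ} u(τ) (∫_0^τ v^{1-p'})^{1/p'}`. The function under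
the limit sign is non-increasing, so that the limit exists in `[0,∞]`. -/
def termLim (p q : ℝ) (u : ℝ → ℝ≥0) (a v w : ℝ → ℝ≥0∞) : ℝ≥0∞ :=
  (∫⁻ y in Ioi 0, prim a y ^ q * w y) ^ (1 / q)
    * limUnder atTop
        (supFrom fun τ => (u τ : ℝ≥0∞) * prim (dualWeight p v) τ ^ (1 / conj p))

/-- `(∫_0^∞ (∫_0^t v^{1-p'})^{r/q'} v(t)^{1-p'}
(∫_t^∞ (∫_t^z (sup_{s≤y} u(y)) a(s) ds)^q w(z) dz)^{r/q} dt)^{1/r}`. -/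
def termB1 (p q : ℝ) (u : ℝ → ℝ≥0) (a v w : ℝ → ℝ≥0∞) : ℝ≥0∞ :=
  (∫⁻ t in Ioi 0,
    prim (dualWeight p v) t ^ (rExp p q / conj q) * dualWeight p v t
      * (∫⁻ z in Ioi t, kern u a t z ^ q * w z) ^ (rExp p q / q)) ^ (1 / rExp p q)

/-- `(∫_0^∞ (∫_0^t v(x)^{1-p'} (∫_x^t (sup_{s≤y} u(y)) a(s) ds)^{p'} dx)^{r/p'}
(∫_t^∞ w)^{r/p} w(t) dt)^{1/r}`. -/
def termB2 (p q : ℝ) (u : ℝ → ℝ≥0) (a v w : ℝ → ℝ≥0∞) : ℝ≥0∞ :=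
  (∫⁻ t in Ioi 0,
    (∫⁻ x in Ioo 0 t, dualWeight p v x * kern u a x t ^ conj p) ^ (rExp p q / conj p)
      * (∫⁻ s in Ioi t, w s) ^ (rExp p q / p) * w t) ^ (1 / rExp p q)

/-- `(∫_0^∞ (∫_{[x,∞)} d(-φ))^{r/p'} (∫_0^x A^q w)^{r/p} A(x)^q w(x) dx)^{1/r}`. -/
def termB3 (p q : ℝ) (u : ℝ → ℝ≥0) (a v w : ℝ → ℝ≥0∞) : ℝ≥0∞ :=
  (∫⁻ x in Ioi 0,
    (∫⁻ _ in Ici x, 1 ∂(decrMeasure (phi p u v))) ^ (rExp p q / conj p)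
      * (∫⁻ y in Ioo 0 x, prim a y ^ q * w y) ^ (rExp p q / p)
      * (prim a x ^ q * w x)) ^ (1 / rExp p q)

/-- `(∫_0^∞ (∫_{(0,x]} A^{p'} d(-φ))^{r/p'} (∫_x^∞ w)^{r/p} w(x) dx)^{1/r}`. -/
def termB4 (p q : ℝ) (u : ℝ → ℝ≥0) (a v w : ℝ → ℝ≥0∞) : ℝ≥0∞ :=
  (∫⁻ x in Ioi 0,
    (∫⁻ t in Ioc 0 x, prim a t ^ conj p ∂(decrMeasure (phi p u v))) ^ (rExp p q / conj p)
      * (∫⁻ y in Ioi x, w y) ^ (rExp p q / p) * w x) ^ (1 / rExp p q)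

end SupHardy

end

/-!
Write `S h(x) = ∫_0^x (T_u h) a` for the iterated operator (`iterHardy`), `U(t) = sup_{t ≤ τ} u(τ)`
and `A(x) = ∫_0^x a`. The five expressions that characterize the inequality `‖S h‖ ≤ N ‖h‖` have the
same shape for `p ≤ q` and for `q < p`, with a supremum in the first case and an integral with
exponent `r` in the second (`condTail`, `condHead`, `condKern`). Both come from one discrete
functional, the norm `seqNorm` of `ℓ^∞` or `ℓ^{r/q}`, which is the best constant in `∑ c_k I_k^{q/p}
≤ B (∑ I_k)^{q/p}` (`tsum_mul_rpow_le_seqNorm`).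

*Upper bound.* In `T_u h(t)` the part of `h` on `(0,t)` contributes at most `U(t) ∫_0^t h`, which
leads to the kernel `k`; the rest is `supHardyTail h t = sup_{t ≤ τ} U(τ) ∫_t^τ h`. By Hölder's
inequality this tail operator is governed by `φ`, and discretization along its own level sets bounds
it in weighted spaces (`exists_setLIntegral_supHardyTail_le`). For integrable `h` carried by a
compact subset of `(0,∞)` the function `S h` is finite, continuous and non-decreasing, and its level
sets `{2^k ≤ S h < 2^{k+1}}` are intervals that begin at points `x_k` with `S h(x_k) = 2^k`. On the
level set of order `k` one has `S h ≤ 4 ∫_{x_{k-1}}^{x_k} (T_u h) a`, and this increment splits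
according to the position of `h` (`setLIntegral_supHardy_mul_le_of_le`). The part of `h` to the left
of `x_{k-1}` is summed by Hardy's inequality for a discrete measure whose tails are dominated by
those of the kernel (`tsum_prim_rpow_mul_le`). In the other parts the difficulty is that a condition
at `x_k` itself does not match the mass of `w` on the level set; all coefficients are therefore
moved to the median of `w`, which leaves half of this mass to its right for the conditions with
`∫_t^∞ w`, and half to its left for those with `∫_0^x A^q w`. A coefficient `A(x_k)^{p'} φ(x_k)`
moves to the median `m` by `φ(x_k) = φ(m) + ∫_{(x_k,m]} d(-φ)`. The coefficients so obtained are
sequences whose `seqNorm` is bounded by the corresponding expressions (`seqNorm_le_condTail`,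
`seqNorm_phi_le`), and the energies of `h` on consecutive level sets have a bounded sum. This gives
`setLIntegral_iterHardy_le_of_support`, and `opNorm_rpow_le` by monotone convergence.

*Lower bound.* Each expression is tested. Normalized functions `h_k`, each tested on its own set
`J_k` of a disjoint family, can be superposed as `sup_k c_k h_k`, so that the `seqNorm` of the
values `∫_{J_k} (S h_k)^q w` is at most `N^q` (`seqNorm_le_opNorm`). With `J_k` the level sets of a
tail of `w` or of the primitive of `A^q w`, the problem is reduced to one test function for each
point (`condTail_le`, `condHead_le`): a multiple of `v^{1-p'}` on an interval for `φ`
(`exists_phi_test`), the extremal function of Hölder's inequality for `∫_0^t v^{1-p'} k(·,t)^{p'}`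
(`exists_kernPow_test`), and a supremum of functions of the first kind, along the dyadic values of
`A`, for `∫_{(0,x]} A^{p'} d(-φ)` (`exists_primPow_test`). The expression with the tails of the
kernel has an explicit extremal function (`condKern_le`), and the limit term is the limit of the
tests for `φ` (`termLim_le`).

If `φ` is identically infinite, or `w` is not integrable at infinity, then both sides are infinite
(`condSum_eq_top`, `phi_ne_top_of_opNorm`, `setLIntegral_Ioi_ne_top_of_opNorm`).
-/

noncomputable section

namespace SupHardy

/-! ### Exponents and sequences -/

lemma rExp_pos {p q : ℝ} (hq : 0 < q) (hqp : q < p) : 0 < rExp p q :=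
  inv_pos.2 (sub_pos.2 (one_div_lt_one_div_of_lt hq hqp))

lemma rExp_div_q {p q : ℝ} (hq : 0 < q) (hqp : q < p) :
    rExp p q / q = rExp p q / p + 1 := by
  have hp : 0 < p := hq.trans hqp
  have h : rExp p q * (1 / q - 1 / p) = 1 :=
    inv_mul_cancel₀ (sub_pos.2 (one_div_lt_one_div_of_lt hq hqp)).ne'
  have : rExp p q / q - rExp p q / p = rExp p q * (1 / q - 1 / p) := by ring
  linarith

lemma holderConjugate_conj {p : ℝ} (hp : 1 < p) : p.HolderConjugate (conj p) :=
  Real.HolderConjugate.conjExponent hp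

lemma conj_pos {p : ℝ} (hp : 1 < p) : 0 < conj p := (holderConjugate_conj hp).symm.pos

lemma one_lt_conj {p : ℝ} (hp : 1 < p) : 1 < conj p := (holderConjugate_conj hp).symm.lt

lemma one_div_conj {p : ℝ} (hp : 1 < p) : 1 / conj p = 1 - 1 / p := by
  have := (holderConjugate_conj hp).inv_add_inv_eq_one
  simp only [one_div]; linarith

lemma rExp_div_conj {p q : ℝ} (hq : 1 < q) (hqp : q < p) :
    rExp p q / conj p = rExp p q / conj q + 1 := by
  have h1 := one_div_conj hq
  have h2 := one_div_conj (hq.trans hqp)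
  have h3 := rExp_div_q (zero_lt_one.trans hq) hqp
  have e1 : rExp p q / conj p = rExp p q * (1 / conj p) := by ring
  have e2 : rExp p q / conj q = rExp p q * (1 / conj q) := by ring
  rw [e1, e2, h1, h2]
  have : rExp p q * (1 - 1 / p) = rExp p q - rExp p q / p := by ring
  have : rExp p q * (1 - 1 / q) = rExp p q - rExp p q / q := by ring
  linarith

lemma q_div_p_add_q_div_rExp {p q : ℝ} (hq : 0 < q) :
    q / p + q / rExp p q = 1 := by
  have : q / rExp p q = q * (1 / q - 1 / p) := by
    rw [rExp, div_eq_mul_inv, inv_inv]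
  rw [this]; field_simp; ring

lemma rpow_iSup {ι : Sort*} {s : ℝ} (hs : 0 < s) (f : ι → ℝ≥0∞) :
    (⨆ i, f i) ^ s = ⨆ i, f i ^ s :=
  (ENNReal.orderIsoRpow s hs).map_iSup f

lemma rpow_biSup {ι : Type*} {P : ι → Prop} {s : ℝ} (hs : 0 < s) (f : ι → ℝ≥0∞) :
    (⨆ (i) (_ : P i), f i) ^ s = ⨆ (i) (_ : P i), f i ^ s := by
  rw [rpow_iSup hs]; congr 1; ext i; rw [rpow_iSup hs]

lemma tsum_rpow_le_rpow_tsum {ι : Type*} (c : ι → ℝ≥0∞) {s : ℝ} (hs : 1 ≤ s) :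
    ∑' i, c i ^ s ≤ (∑' i, c i) ^ s := by
  classical
  rw [ENNReal.tsum_eq_iSup_sum]
  refine iSup_le fun t => ?_
  refine le_trans ?_ (ENNReal.rpow_le_rpow (ENNReal.sum_le_tsum t) (zero_le_one.trans hs))
  induction t using Finset.induction_on with
  | empty => simp
  | insert a t ha ih =>
    rw [Finset.sum_insert ha, Finset.sum_insert ha]
    exact (add_le_add le_rfl ih).trans (ENNReal.add_rpow_le_rpow_add _ _ hs)

/-- The `ℓ^{r/q}` norm, with `1/r = 1/q - 1/p`; for `p ≤ q` it is the `ℓ^∞` norm. In both cases it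
is the best constant `B` in `∑ c_i I_i^{q/p} ≤ B (∑ I_i)^{q/p}`, so that `p ≤ q` and `q < p` can be
treated by the same discrete estimates. -/
def seqNorm (p q : ℝ) {ι : Type*} (c : ι → ℝ≥0∞) : ℝ≥0∞ :=
  if p ≤ q then ⨆ i, c i else (∑' i, c i ^ (rExp p q / q)) ^ (q / rExp p q)

lemma seqNorm_of_le {p q : ℝ} (h : p ≤ q) {ι : Type*} (c : ι → ℝ≥0∞) :
    seqNorm p q c = ⨆ i, c i := if_pos h

lemma seqNorm_of_lt {p q : ℝ} (h : q < p) {ι : Type*} (c : ι → ℝ≥0∞) :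
    seqNorm p q c = (∑' i, c i ^ (rExp p q / q)) ^ (q / rExp p q) := if_neg (not_le.2 h)

/-- For `q < p`, a bound on the `r`-th power sum is a bound on `seqNorm`. -/
lemma seqNorm_le_of_lt {p q : ℝ} (hq : 0 < q) (h : q < p) {ι : Type*} {c : ι → ℝ≥0∞}
    {B : ℝ≥0∞} (hB : ∑' i, c i ^ (rExp p q / q) ≤ B ^ (rExp p q / q)) : seqNorm p q c ≤ B := by
  have hr := rExp_pos hq h
  rw [seqNorm_of_lt h]
  refine (ENNReal.rpow_le_rpow hB (by positivity)).trans_eq ?_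
  rw [← ENNReal.rpow_mul, div_mul_div_cancel₀ hq.ne', div_self hr.ne', ENNReal.rpow_one]

lemma tsum_le_of_seqNorm_le {p q : ℝ} (hq : 0 < q) (h : q < p) {ι : Type*} {c : ι → ℝ≥0∞}
    {B : ℝ≥0∞} (hB : seqNorm p q c ≤ B) : ∑' i, c i ^ (rExp p q / q) ≤ B ^ (rExp p q / q) := by
  have hr := rExp_pos hq h
  rw [seqNorm_of_lt h] at hB
  refine le_trans (le_of_eq ?_) (ENNReal.rpow_le_rpow hB (div_pos hr hq).le)
  rw [← ENNReal.rpow_mul, div_mul_div_cancel₀ hr.ne', div_self hq.ne', ENNReal.rpow_one]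

lemma seqNorm_mono {p q : ℝ} (hq : 0 < q) {ι : Type*} {c d : ι → ℝ≥0∞}
    (h : ∀ i, c i ≤ d i) : seqNorm p q c ≤ seqNorm p q d := by
  rcases le_or_gt p q with hpq | hpq
  · rw [seqNorm_of_le hpq, seqNorm_of_le hpq]; exact iSup_mono h
  · have hr := rExp_pos hq hpq
    rw [seqNorm_of_lt hpq, seqNorm_of_lt hpq]
    gcongr with i; exact h i

/-- For `p ≤ q` this is the embedding of `ℓ^1` in `ℓ^{q/p}`; for `q < p` it is Hölder's inequality
with the exponents `r/q` and `p/q`. In the applications `I_i` is the part of the energy of a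
function that is carried by the `i`-th of a family of disjoint sets. -/
lemma tsum_mul_rpow_le_seqNorm {p q : ℝ} (hp : 0 < p) (hq : 0 < q) {ι : Type*} [Countable ι]
    (c I : ι → ℝ≥0∞) :
    ∑' i, c i * I i ^ (q / p) ≤ seqNorm p q c * (∑' i, I i) ^ (q / p) := by
  rcases le_or_gt p q with hpq | hpq
  · rw [seqNorm_of_le hpq]
    calc ∑' i, c i * I i ^ (q / p) ≤ ∑' i, (⨆ j, c j) * I i ^ (q / p) := by
          gcongr with i; exact le_iSup c i
      _ = (⨆ j, c j) * ∑' i, I i ^ (q / p) := ENNReal.tsum_mul_left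
      _ ≤ _ := by gcongr; exact tsum_rpow_le_rpow_tsum I ((one_le_div hp).2 hpq)
  · have hr := rExp_pos hq hpq
    have hconj : (rExp p q / q).HolderConjugate (p / q) := by
      rw [Real.holderConjugate_iff]
      have h1 := rExp_div_q hq hpq
      have h2 := q_div_p_add_q_div_rExp (p := p) hq
      have h3 : 0 < rExp p q / p := by positivity
      refine ⟨by linarith, ?_⟩
      rw [inv_div, inv_div]; linarith
    rw [seqNorm_of_lt hpq]
    rw [ENNReal.tsum_eq_iSup_sum]
    refine iSup_le fun s => ?_
    refine (ENNReal.inner_le_Lp_mul_Lq s c (fun i => I i ^ (q / p)) hconj).trans ?_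
    have e : ∀ i, (I i ^ (q / p)) ^ (p / q) = I i := fun i => by
      rw [← ENNReal.rpow_mul, div_mul_div_cancel₀ hp.ne', div_self hq.ne', ENNReal.rpow_one]
    simp only [e, one_div_div]
    gcongr <;> exact ENNReal.sum_le_tsum s

lemma sum_two_rpow {s : ℝ} (hs : 0 ≤ s) (x y : ℝ≥0∞) :
    (x + y) ^ s ≤ 2 ^ s * (x ^ s + y ^ s) :=
  ENNReal.add_rpow_le_two_rpow_mul_rpow_add_rpow x y hs

/-- Cancellation in a self-improving inequality `E ≤ D E^s` with `s < 1`. It fails for `E = ∞`,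
which is why test functions are truncated before it is used. -/
lemma rpow_le_of_le_mul_rpow {E D : ℝ≥0∞} {s t : ℝ} (ht : 0 < t) (hst : s + t = 1)
    (hE : E ≠ ∞) (h : E ≤ D * E ^ s) : E ^ t ≤ D := by
  rcases eq_or_ne E 0 with rfl | h0
  · rw [ENNReal.zero_rpow_of_pos ht]; exact zero_le
  have e : E = E ^ t * E ^ s := by
    rw [← ENNReal.rpow_add _ _ h0 hE, add_comm, hst, ENNReal.rpow_one]
  have h1 : E ^ s ≠ 0 := (ENNReal.rpow_pos (pos_iff_ne_zero.2 h0) hE).ne'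
  have h2 : E ^ s ≠ ∞ := ENNReal.rpow_ne_top_of_ne_zero h0 hE
  refine (ENNReal.mul_le_mul_iff_left h1 h2).1 ?_
  rw [← e]; exact h

lemma seqNorm_le_tsum {p q : ℝ} (hq : 0 < q) {ι : Type*} (c : ι → ℝ≥0∞) :
    seqNorm p q c ≤ ∑' i, c i := by
  rcases le_or_gt p q with hpq | hpq
  · rw [seqNorm_of_le hpq]; exact iSup_le fun i => ENNReal.le_tsum i
  · have hp : 0 < p := hq.trans hpq
    have hr := rExp_pos hq hpq
    refine seqNorm_le_of_lt hq hpq (tsum_rpow_le_rpow_tsum c ?_)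
    rw [rExp_div_q hq hpq]
    have : 0 < rExp p q / p := by positivity
    linarith

lemma seqNorm_const_mul {p q : ℝ} (hq : 0 < q) {ι : Type*} (K : ℝ≥0∞) (c : ι → ℝ≥0∞) :
    seqNorm p q (fun i => K * c i) = K * seqNorm p q c := by
  rcases le_or_gt p q with hpq | hpq
  · rw [seqNorm_of_le hpq, seqNorm_of_le hpq, ENNReal.mul_iSup]
  · have hr := rExp_pos hq hpq
    rw [seqNorm_of_lt hpq, seqNorm_of_lt hpq]
    simp_rw [ENNReal.mul_rpow_of_nonneg _ _ (div_pos hr hq).le]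
    rw [ENNReal.tsum_mul_left, ENNReal.mul_rpow_of_nonneg _ _ (div_pos hq hr).le,
      ← ENNReal.rpow_mul, div_mul_div_cancel₀ hq.ne', div_self hr.ne', ENNReal.rpow_one]

lemma seqNorm_add_le {p q : ℝ} (hq : 0 < q) {ι : Type*} (c d : ι → ℝ≥0∞) :
    seqNorm p q (fun i => c i + d i) ≤ 2 * (seqNorm p q c + seqNorm p q d) := by
  rcases le_or_gt p q with hpq | hpq
  · rw [seqNorm_of_le hpq, seqNorm_of_le hpq, seqNorm_of_le hpq]
    refine iSup_le fun i => (add_le_add (le_iSup c i) (le_iSup d i)).trans ?_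
    rw [two_mul]; exact le_self_add
  · have hr := rExp_pos hq hpq
    have hp : 0 < p := hq.trans hpq
    have hs : 0 < rExp p q / q := div_pos hr hq
    have hs1 : q / rExp p q ≤ 1 := by
      have h1 := q_div_p_add_q_div_rExp (p := p) hq
      have : 0 < q / p := by positivity
      linarith
    rw [seqNorm_of_lt hpq, seqNorm_of_lt hpq, seqNorm_of_lt hpq]
    calc (∑' i, (c i + d i) ^ (rExp p q / q)) ^ (q / rExp p q)
        ≤ (∑' i, 2 ^ (rExp p q / q) * (c i ^ (rExp p q / q) + d i ^ (rExp p q / q)))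
            ^ (q / rExp p q) := by
          gcongr with i; exact sum_two_rpow hs.le _ _
      _ = 2 * (∑' i, c i ^ (rExp p q / q) + ∑' i, d i ^ (rExp p q / q)) ^ (q / rExp p q) := by
          rw [ENNReal.tsum_mul_left, ENNReal.tsum_add,
            ENNReal.mul_rpow_of_nonneg _ _ (div_pos hq hr).le, ← ENNReal.rpow_mul,
            div_mul_div_cancel₀ hq.ne', div_self hr.ne', ENNReal.rpow_one]
      _ ≤ _ := by
          gcongr; exact ENNReal.rpow_add_le_add_rpow _ _ (div_pos hq hr).le hs1

/-! ### Primitives on the half-line -/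

/-- Continuity by absolute continuity of the integral: a function whose increments are dominated
by the integrals of a locally integrable function is continuous. -/
lemma continuousAt_of_le_add {f g : ℝ → ℝ≥0∞} {l r x₀ : ℝ} (hx : x₀ ∈ Ioo l r)
    (hg : ∫⁻ t in Ioo l r, g t ≠ ∞)
    (hf : ∀ s t, l < s → s ≤ t → t < r →
      f s ≤ f t + ∫⁻ z in Ioo s t, g z ∧ f t ≤ f s + ∫⁻ z in Ioo s t, g z) :
    ContinuousAt f x₀ := by
  set e : ℝ → ℝ≥0∞ := fun y => ∫⁻ z in Ioo (min x₀ y) (max x₀ y), g z ∂(volume.restrict (Ioo l r))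
    with he
  have hlim : Tendsto e (𝓝 x₀) (𝓝 0) := by
    refine tendsto_setLIntegral_zero hg ?_
    have h0 : Tendsto (fun y : ℝ => ENNReal.ofReal (max x₀ y - min x₀ y)) (𝓝 x₀) (𝓝 0) := by
      have : Continuous fun y : ℝ => ENNReal.ofReal (max x₀ y - min x₀ y) :=
        ENNReal.continuous_ofReal.comp (by fun_prop)
      simpa using this.tendsto x₀
    refine tendsto_of_tendsto_of_tendsto_of_le_of_le tendsto_const_nhds h0
      (fun _ => zero_le) fun y => ?_
    refine (Measure.restrict_apply_le _ _).trans ?_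
    rw [Real.volume_Ioo]
  have hbd : ∀ᶠ y in 𝓝 x₀, f x₀ ≤ f y + e y ∧ f y ≤ f x₀ + e y := by
    filter_upwards [Ioo_mem_nhds hx.1 hx.2] with y hy
    have hmin : ∀ s t, l < s → t < r →
        ∫⁻ z in Ioo s t, g z ∂(volume.restrict (Ioo l r)) = ∫⁻ z in Ioo s t, g z := by
      intro s t hs ht
      rw [Measure.restrict_restrict measurableSet_Ioo,
        inter_eq_left.2 (Ioo_subset_Ioo hs.le ht.le)]
    rcases le_total x₀ y with h | h
    · simp only [he, min_eq_left h, max_eq_right h, hmin _ _ hx.1 hy.2]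
      exact hf _ _ hx.1 h hy.2
    · simp only [he, min_eq_right h, max_eq_left h, hmin _ _ hy.1 hx.2]
      exact (hf _ _ hy.1 h hx.2).symm
  rw [ContinuousAt]
  refine tendsto_of_tendsto_of_tendsto_of_le_of_le' (g := fun y => f x₀ - e y)
    (h := fun y => f x₀ + e y) ?_ ?_ ?_ ?_
  · have := ENNReal.Tendsto.sub (tendsto_const_nhds (x := f x₀)) hlim (Or.inr ENNReal.zero_ne_top)
    simpa using this
  · simpa using tendsto_const_nhds.add hlim
  · filter_upwards [hbd] with y hy using tsub_le_iff_right.2 hy.1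
  · filter_upwards [hbd] with y hy using hy.2

lemma prim_mono (f : ℝ → ℝ≥0∞) : Monotone (prim f) := fun _ _ h =>
  lintegral_mono_set (Ioo_subset_Ioo_right h)

lemma measurable_prim (f : ℝ → ℝ≥0∞) : Measurable (prim f) := (prim_mono f).measurable

lemma setLIntegral_Ioo_add_Ioo {f : ℝ → ℝ≥0∞} {x y z : ℝ} (hxy : x ≤ y) (hyz : y ≤ z) :
    ∫⁻ t in Ioo x z, f t = (∫⁻ t in Ioo x y, f t) + ∫⁻ t in Ioo y z, f t := by
  rw [setLIntegral_congr (Ioo_ae_eq_Ioc (a := x) (b := z)),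
    setLIntegral_congr (Ioo_ae_eq_Ioc (a := x) (b := y)),
    setLIntegral_congr (Ioo_ae_eq_Ioc (a := y) (b := z)), ← Ioc_union_Ioc_eq_Ioc hxy hyz,
    lintegral_union measurableSet_Ioc (Ioc_disjoint_Ioc_of_le le_rfl)]

lemma prim_eq_add {f : ℝ → ℝ≥0∞} {x y : ℝ} (hx : 0 ≤ x) (hxy : x ≤ y) :
    prim f y = prim f x + ∫⁻ t in Ioo x y, f t := setLIntegral_Ioo_add_Ioo hx hxy

lemma setLIntegral_Ioi_eq_add {f : ℝ → ℝ≥0∞} {x y : ℝ} (hxy : x ≤ y) :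
    ∫⁻ t in Ioi x, f t = (∫⁻ t in Ioo x y, f t) + ∫⁻ t in Ioi y, f t := by
  rw [setLIntegral_congr (Ioo_ae_eq_Ioc (a := x) (b := y)), ← Ioc_union_Ioi_eq_Ioi hxy,
    lintegral_union measurableSet_Ioi (Ioc_disjoint_Ioi le_rfl)]

lemma continuousOn_prim {f : ℝ → ℝ≥0∞} (hf : ∀ x, 0 < x → prim f x ≠ ∞) :
    ContinuousOn (prim f) (Ioi 0) := by
  intro x hx
  refine (continuousAt_of_le_add (l := 0) (r := x + 1) (g := f)
    ⟨hx, lt_add_one x⟩ (hf _ (lt_trans hx (lt_add_one x))) ?_).continuousWithinAt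
  intro s t hs hst _
  exact ⟨(prim_mono f hst).trans le_self_add, (prim_eq_add hs.le hst).le⟩

lemma tendsto_prim_zero {f : ℝ → ℝ≥0∞} (hf : prim f 1 ≠ ∞) :
    Tendsto (prim f) (𝓝[>] 0) (𝓝 0) := by
  have h : Tendsto (fun x : ℝ => ∫⁻ t in Ioo 0 x, f t ∂(volume.restrict (Ioo 0 1)))
      (𝓝[>] 0) (𝓝 0) := by
    refine tendsto_setLIntegral_zero hf ?_
    have h0 : Tendsto (fun y : ℝ => ENNReal.ofReal (y - 0)) (𝓝[>] 0) (𝓝 0) := by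
      have : Continuous fun y : ℝ => ENNReal.ofReal (y - 0) :=
        ENNReal.continuous_ofReal.comp (by fun_prop)
      simpa using (this.tendsto 0).mono_left nhdsWithin_le_nhds
    refine tendsto_of_tendsto_of_tendsto_of_le_of_le tendsto_const_nhds h0
      (fun _ => zero_le) fun y => ?_
    refine (Measure.restrict_apply_le _ _).trans ?_
    rw [Real.volume_Ioo]
  refine h.congr' ?_
  filter_upwards [Ioo_mem_nhdsGT (zero_lt_one' ℝ)] with x hx
  rw [Measure.restrict_restrict measurableSet_Ioo,
    inter_eq_left.2 (Ioo_subset_Ioo le_rfl hx.2.le), prim]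

lemma iSup_setLIntegral_Ioo_nat (f : ℝ → ℝ≥0∞) :
    ∫⁻ t in Ioi 0, f t = ⨆ n : ℕ, ∫⁻ t in Ioo 0 (n : ℝ), f t := by
  have : Ioi (0 : ℝ) = ⋃ n : ℕ, Ioo 0 (n : ℝ) := by
    ext x; simp only [mem_Ioi, mem_iUnion, mem_Ioo]
    exact ⟨fun h => let ⟨n, hn⟩ := exists_nat_gt x; ⟨n, h, hn⟩, fun ⟨_, h, _⟩ => h⟩
  rw [this, setLIntegral_iUnion_of_directed]
  refine Monotone.directed_le fun m n h => Ioo_subset_Ioo_right (by exact_mod_cast h)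

/-- A set of finite mass can be cut by a point into two halves of equal mass. -/
lemma exists_median {μ : Measure ℝ} [NullSingletonClass μ] [IsFiniteMeasure μ] (hμ : μ univ ≠ 0) :
    ∃ m : ℝ, μ univ ≤ 2 * μ (Iio m) ∧ μ univ ≤ 2 * μ (Ioi m) := by
  set P : Set ℝ := {x | μ univ ≤ 2 * μ (Iio x)} with hP
  have hhalf : μ univ / 2 < μ univ := ENNReal.half_lt_self hμ (measure_ne_top _ _)
  have hne : P.Nonempty := by
    have h1 : Tendsto (fun n : ℕ => μ (Iio (n : ℝ))) atTop (𝓝 (μ (⋃ n : ℕ, Iio (n : ℝ)))) :=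
      tendsto_measure_iUnion_atTop fun i j h => Iio_subset_Iio (by exact_mod_cast h)
    have h2 : (⋃ n : ℕ, Iio (n : ℝ)) = univ :=
      eq_univ_of_forall fun x => mem_iUnion.2 (exists_nat_gt x)
    rw [h2] at h1
    obtain ⟨n, hn⟩ := (h1.eventually (lt_mem_nhds hhalf)).exists
    exact ⟨n, ENNReal.div_le_iff_le_mul (by simp) (by simp) |>.1 hn.le |>.trans_eq (mul_comm _ _)⟩
  have hbdd : BddBelow P := by
    have h1 : Tendsto (fun n : ℕ => μ (Iio (-(n : ℝ)))) atTop (𝓝 (μ (⋂ n : ℕ, Iio (-(n : ℝ))))) := by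
      refine tendsto_measure_iInter_atTop (fun _ => measurableSet_Iio.nullMeasurableSet) ?_
        ⟨0, measure_ne_top _ _⟩
      exact fun i j h => Iio_subset_Iio (by simpa using h)
    have h2 : (⋂ n : ℕ, Iio (-(n : ℝ))) = ∅ := by
      refine eq_empty_of_forall_notMem fun x hx => ?_
      obtain ⟨n, hn⟩ := exists_nat_gt (-x)
      have := mem_iInter.1 hx n
      simp only [mem_Iio] at this; linarith
    rw [h2, measure_empty] at h1
    obtain ⟨n, hn⟩ := (h1.eventually (gt_mem_nhds (ENNReal.half_pos hμ))).exists
    refine ⟨-n, fun x hx => le_of_not_gt fun hlt => ?_⟩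
    have h3 : μ univ ≤ 2 * μ (Iio (-(n : ℝ))) := le_trans hx (by gcongr)
    have h4 := (ENNReal.lt_div_iff_mul_lt (Or.inl (by simp)) (Or.inl (by simp))).1 hn
    rw [mul_comm] at h4
    exact absurd h3 (not_le.2 h4)
  set m := sInf P with hm
  have hmem : ∀ x, m < x → x ∈ P := fun x hx => by
    obtain ⟨y, hy, hyx⟩ := exists_lt_of_csInf_lt hne hx
    exact le_trans (show μ univ ≤ 2 * μ (Iio y) from hy) (by gcongr)
  refine ⟨m, ?_, ?_⟩
  · rw [measure_congr (Iio_ae_eq_Iic (a := m) (μ := μ))]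
    have h1 : Tendsto (fun n : ℕ => 2 * μ (Iio (m + 1 / ((n : ℝ) + 1)))) atTop
        (𝓝 (2 * μ (⋂ n : ℕ, Iio (m + 1 / ((n : ℝ) + 1))))) := by
      refine ENNReal.Tendsto.const_mul ?_ (Or.inr (by simp))
      refine tendsto_measure_iInter_atTop (fun _ => measurableSet_Iio.nullMeasurableSet) ?_
        ⟨0, measure_ne_top _ _⟩
      exact fun i j h => Iio_subset_Iio (by gcongr)
    have h2 : (⋂ n : ℕ, Iio (m + 1 / ((n : ℝ) + 1))) = Iic m := by
      ext x; simp only [mem_iInter, mem_Iio, mem_Iic]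
      constructor
      · intro h
        refine le_of_forall_pos_lt_add fun ε hε => ?_
        obtain ⟨n, hn⟩ := exists_nat_one_div_lt hε
        exact (h n).trans (by linarith)
      · intro h n
        have : 0 < 1 / ((n : ℝ) + 1) := by positivity
        linarith
    rw [h2] at h1
    exact ge_of_tendsto' h1 fun n => hmem _ (by have : 0 < 1 / ((n : ℝ) + 1) := by positivity
                                                linarith)
  · rw [measure_congr (Ioi_ae_eq_Ici (a := m) (μ := μ))]
    have h1 : Tendsto (fun n : ℕ => 2 * μ (Iio (m - 1 / ((n : ℝ) + 1)))) atTop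
        (𝓝 (2 * μ (⋃ n : ℕ, Iio (m - 1 / ((n : ℝ) + 1))))) := by
      refine ENNReal.Tendsto.const_mul ?_ (Or.inr (by simp))
      exact tendsto_measure_iUnion_atTop fun i j h => Iio_subset_Iio (by gcongr)
    have h2 : (⋃ n : ℕ, Iio (m - 1 / ((n : ℝ) + 1))) = Iio m := by
      ext x; simp only [mem_iUnion, mem_Iio]
      constructor
      · rintro ⟨n, h⟩
        have : 0 < 1 / ((n : ℝ) + 1) := by positivity
        linarith
      · intro h
        obtain ⟨n, hn⟩ := exists_nat_one_div_lt (sub_pos.2 h)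
        exact ⟨n, by linarith⟩
    rw [h2] at h1
    have h3 : 2 * μ (Iio m) ≤ μ univ := by
      refine le_of_tendsto' h1 fun n => le_of_lt (not_le.1 fun hn => ?_)
      have h4 : m ≤ m - 1 / ((n : ℝ) + 1) := csInf_le hbdd hn
      have : 0 < 1 / ((n : ℝ) + 1) := by positivity
      linarith
    have h4 : μ univ = μ (Iio m) + μ (Ici m) := by
      rw [← measure_union (by simp [disjoint_left]) measurableSet_Ici, Iio_union_Ici]
    have h5 : μ (Iio m) ≤ μ (Ici m) := by
      rw [two_mul, h4] at h3
      exact (ENNReal.add_le_add_iff_left (measure_ne_top _ _)).1 h3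
    rw [h4, two_mul]; gcongr

/-- The median of an absolutely continuous measure on a set. -/
lemma exists_setLIntegral_median {f : ℝ → ℝ≥0∞} {J : Set ℝ}
    (h0 : ∫⁻ t in J, f t ≠ 0) (hfin : ∫⁻ t in J, f t ≠ ∞) :
    ∃ m : ℝ, ∫⁻ t in J, f t ≤ 2 * ∫⁻ t in J ∩ Iio m, f t ∧
      ∫⁻ t in J, f t ≤ 2 * ∫⁻ t in J ∩ Ioi m, f t := by
  set μ : Measure ℝ := (volume.restrict J).withDensity f with hμ
  have hap : ∀ s, MeasurableSet s → μ s = ∫⁻ t in J ∩ s, f t := fun s hs => by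
    rw [hμ, withDensity_apply _ hs, Measure.restrict_restrict hs, inter_comm]
  have hu : μ univ = ∫⁻ t in J, f t := by rw [hap _ MeasurableSet.univ, inter_univ]
  have : IsFiniteMeasure μ := ⟨by rw [hu]; exact hfin.lt_top⟩
  have : NullSingletonClass μ := ⟨fun x => by
    rw [hap _ (measurableSet_singleton x)]
    exact setLIntegral_measure_zero _ _ (measure_mono_null inter_subset_right (by simp))⟩
  obtain ⟨m, h1, h2⟩ := exists_median (μ := μ) (by rwa [hu])
  rw [hu, hap _ measurableSet_Iio] at h1
  rw [hu, hap _ measurableSet_Ioi] at h2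
  exact ⟨m, h1, h2⟩

/-- A one-sided form of the power rule `∫_J G^s f ≥ c (∫_J f)^{s+1}`, where `G` dominates the
primitive of `f` on `J`. -/
lemma rpow_setLIntegral_le_of_left {f G : ℝ → ℝ≥0∞} {J : Set ℝ} {s : ℝ} (hs : 0 ≤ s)
    (hJ : MeasurableSet J) (hfin : ∫⁻ t in J, f t ≠ ∞)
    (hG : ∀ x ∈ J, ∫⁻ t in J ∩ Iio x, f t ≤ G x) :
    (∫⁻ t in J, f t) ^ (s + 1) ≤ 2 ^ (s + 1) * ∫⁻ x in J, G x ^ s * f x := by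
  rcases eq_or_ne (∫⁻ t in J, f t) 0 with h0 | h0
  · rw [h0, ENNReal.zero_rpow_of_pos (by linarith)]; exact zero_le
  obtain ⟨m, h1, h2⟩ := exists_setLIntegral_median h0 hfin
  set I := ∫⁻ t in J, f t
  calc I ^ (s + 1) = I ^ s * I := by
        rw [ENNReal.rpow_add_of_nonneg _ _ hs zero_le_one, ENNReal.rpow_one]
    _ ≤ (2 * ∫⁻ t in J ∩ Iio m, f t) ^ s * (2 * ∫⁻ t in J ∩ Ioi m, f t) := by gcongr
    _ = 2 ^ (s + 1) * ((∫⁻ t in J ∩ Iio m, f t) ^ s * ∫⁻ t in J ∩ Ioi m, f t) := by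
        rw [ENNReal.mul_rpow_of_nonneg _ _ hs, ENNReal.rpow_add_of_nonneg _ _ hs zero_le_one,
          ENNReal.rpow_one]; ring
    _ ≤ 2 ^ (s + 1) * ∫⁻ x in J ∩ Ioi m, G x ^ s * f x := by
        gcongr
        rw [← lintegral_const_mul' _ _ (ENNReal.rpow_ne_top_of_nonneg hs
          (ne_top_of_le_ne_top hfin (lintegral_mono_set inter_subset_left)))]
        refine setLIntegral_mono' (hJ.inter measurableSet_Ioi) fun x hx => ?_
        gcongr
        refine le_trans (lintegral_mono_set ?_) (hG x hx.1)
        exact inter_subset_inter_right _ (Iio_subset_Iio (le_of_lt hx.2))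
    _ ≤ _ := by gcongr; exact inter_subset_left

/-- The mirror image of `rpow_setLIntegral_le_of_left`. -/
lemma rpow_setLIntegral_le_of_right {f G : ℝ → ℝ≥0∞} {J : Set ℝ} {s : ℝ} (hs : 0 ≤ s)
    (hJ : MeasurableSet J) (hfin : ∫⁻ t in J, f t ≠ ∞)
    (hG : ∀ x ∈ J, ∫⁻ t in J ∩ Ioi x, f t ≤ G x) :
    (∫⁻ t in J, f t) ^ (s + 1) ≤ 2 ^ (s + 1) * ∫⁻ x in J, G x ^ s * f x := by
  rcases eq_or_ne (∫⁻ t in J, f t) 0 with h0 | h0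
  · rw [h0, ENNReal.zero_rpow_of_pos (by linarith)]; exact zero_le
  obtain ⟨m, h1, h2⟩ := exists_setLIntegral_median h0 hfin
  set I := ∫⁻ t in J, f t
  calc I ^ (s + 1) = I ^ s * I := by
        rw [ENNReal.rpow_add_of_nonneg _ _ hs zero_le_one, ENNReal.rpow_one]
    _ ≤ (2 * ∫⁻ t in J ∩ Ioi m, f t) ^ s * (2 * ∫⁻ t in J ∩ Iio m, f t) := by gcongr
    _ = 2 ^ (s + 1) * ((∫⁻ t in J ∩ Ioi m, f t) ^ s * ∫⁻ t in J ∩ Iio m, f t) := by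
        rw [ENNReal.mul_rpow_of_nonneg _ _ hs, ENNReal.rpow_add_of_nonneg _ _ hs zero_le_one,
          ENNReal.rpow_one]; ring
    _ ≤ 2 ^ (s + 1) * ∫⁻ x in J ∩ Iio m, G x ^ s * f x := by
        gcongr
        rw [← lintegral_const_mul' _ _ (ENNReal.rpow_ne_top_of_nonneg hs
          (ne_top_of_le_ne_top hfin (lintegral_mono_set inter_subset_left)))]
        refine setLIntegral_mono' (hJ.inter measurableSet_Iio) fun x hx => ?_
        gcongr
        refine le_trans (lintegral_mono_set ?_) (hG x hx.1)
        exact inter_subset_inter_right _ (Ioi_subset_Ioi (le_of_lt hx.2))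
    _ ≤ _ := by gcongr; exact inter_subset_left

/-- Tonelli's theorem on a triangle. -/
lemma setLIntegral_Ioo_swap {f h : ℝ → ℝ≥0∞} {x y : ℝ}
    (hf : AEMeasurable f (volume.restrict (Ioo x y)))
    (hh : AEMeasurable h (volume.restrict (Ioo x y))) :
    ∫⁻ t in Ioo x y, f t * ∫⁻ s in Ioo x t, h s
      = ∫⁻ s in Ioo x y, h s * ∫⁻ t in Ioo s y, f t := by
  set μ := volume.restrict (Ioo x y) with hμ
  have e1 : ∀ t ∈ Ioo x y, f t * ∫⁻ s in Ioo x t, h s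
      = ∫⁻ s, (Iio t).indicator (fun s => f t * h s) s ∂μ := fun t ht => by
    have : ∀ s, (Iio t).indicator (fun s => f t * h s) s = f t * (Iio t).indicator h s := fun s => by
      by_cases hs : s ∈ Iio t <;> simp [hs]
    simp_rw [this]
    rw [lintegral_const_mul'' _ (hh.indicator measurableSet_Iio),
      lintegral_indicator measurableSet_Iio, hμ, Measure.restrict_restrict measurableSet_Iio]
    congr 3
    ext z; simp only [mem_inter_iff, mem_Iio, mem_Ioo]
    exact ⟨fun h => ⟨h.2, h.1, h.2.trans ht.2⟩, fun h => ⟨h.2.1, h.1⟩⟩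
  have e2 : ∀ s ∈ Ioo x y, h s * ∫⁻ t in Ioo s y, f t
      = ∫⁻ t, (Iio t).indicator (fun s => f t * h s) s ∂μ := fun s hs => by
    have : ∀ t, (Iio t).indicator (fun s => f t * h s) s = h s * (Ioi s).indicator f t := fun t => by
      by_cases hst : s < t
      · rw [indicator_of_mem (by exact hst), indicator_of_mem (by exact hst), mul_comm]
      · rw [indicator_of_notMem (by exact hst), indicator_of_notMem (by exact hst), mul_zero]
    simp_rw [this]
    rw [lintegral_const_mul'' _ (hf.indicator measurableSet_Ioi),
      lintegral_indicator measurableSet_Ioi, hμ, Measure.restrict_restrict measurableSet_Ioi]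
    congr 3
    ext z; simp only [mem_inter_iff, mem_Ioi, mem_Ioo]
    exact ⟨fun h => ⟨h.1, hs.1.trans h.1, h.2⟩, fun h => ⟨h.1, h.2.2⟩⟩
  rw [setLIntegral_congr_fun measurableSet_Ioo e1, setLIntegral_congr_fun measurableSet_Ioo e2]
  refine lintegral_lintegral_swap ?_
  have h1 : AEMeasurable (fun z : ℝ × ℝ => f z.1 * h z.2) (μ.prod μ) :=
    (hf.comp_fst).mul (hh.comp_snd)
  have : Function.uncurry (fun t s => (Iio t).indicator (fun s => f t * h s) s)
      = {z : ℝ × ℝ | z.2 < z.1}.indicator fun z => f z.1 * h z.2 := by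
    ext ⟨t, s⟩; simp [indicator, Function.uncurry]
  rw [this]
  exact h1.indicator (measurableSet_lt measurable_snd measurable_fst)

/-! ### Dyadic level sets of monotone functions -/

/-- The dyadic level set `{t > 0 | 2^k ≤ f t < 2^{k+1}}`. -/
def lev (f : ℝ → ℝ≥0∞) (k : ℤ) : Set ℝ := {t | 0 < t ∧ 2 ^ k ≤ f t ∧ f t < 2 ^ (k + 1)}

lemma two_zpow_pos (k : ℤ) : (0 : ℝ≥0∞) < 2 ^ k := ENNReal.zpow_pos (by simp) (by simp) k

lemma two_zpow_ne_top (k : ℤ) : (2 : ℝ≥0∞) ^ k ≠ ∞ := ENNReal.zpow_ne_top (by simp) (by simp) k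

lemma two_zpow_add_one (k : ℤ) : (2 : ℝ≥0∞) ^ (k + 1) = 2 ^ k * 2 := by
  rw [ENNReal.zpow_add (by simp) (by simp), zpow_one]

lemma two_zpow_eq_sub_one (k : ℤ) : (2 : ℝ≥0∞) ^ k = 2 ^ (k - 1) * 2 := by
  rw [← two_zpow_add_one, sub_add_cancel]

lemma two_zpow_lt (k : ℤ) : (2 : ℝ≥0∞) ^ (k - 1) < 2 ^ k := by
  rw [two_zpow_eq_sub_one k, mul_two]
  exact ENNReal.lt_add_right (two_zpow_ne_top _) (two_zpow_pos _).ne'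

lemma lev_subset_Ioi (f : ℝ → ℝ≥0∞) (k : ℤ) : lev f k ⊆ Ioi 0 := fun _ h => h.1

lemma measurableSet_lev {f : ℝ → ℝ≥0∞} (hf : Measurable f) (k : ℤ) : MeasurableSet (lev f k) :=
  (measurableSet_Ioi (a := (0 : ℝ))).inter
    ((measurableSet_le measurable_const hf).inter (measurableSet_lt hf measurable_const))

lemma pairwise_disjoint_lev (f : ℝ → ℝ≥0∞) : Pairwise (Function.onFun Disjoint (lev f)) := by
  have key : ∀ i j : ℤ, i < j → Disjoint (lev f i) (lev f j) := fun i j h =>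
    disjoint_left.2 fun t h1 h2 => by
      have : (2 : ℝ≥0∞) ^ (i + 1) ≤ 2 ^ j := ENNReal.zpow_le_of_le (by norm_num) (by omega)
      exact absurd (this.trans h2.2.1) (not_le.2 h1.2.2)
  intro i j hij
  rcases lt_or_gt_of_ne hij with h | h
  · exact key i j h
  · exact (key j i h).symm

lemma exists_mem_lev {f : ℝ → ℝ≥0∞} {t : ℝ} (ht : 0 < t) (h0 : f t ≠ 0) (h1 : f t ≠ ∞) :
    ∃ k, t ∈ lev f k := by
  obtain ⟨n, hn⟩ := ENNReal.exists_mem_Ico_zpow h0 h1 (y := 2) (by norm_num) (by simp)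
  exact ⟨n, ht, hn.1, hn.2⟩

/-- The points where `f` vanishes lie in no level set; they do not contribute since `q > 0`. -/
lemma setLIntegral_rpow_mul_le_tsum_lev {f g : ℝ → ℝ≥0∞} (hf : Measurable f)
    (hfin : ∀ t, 0 < t → f t ≠ ∞) {q : ℝ} (hq : 0 < q) (ν : Measure ℝ) :
    ∫⁻ t in Ioi 0, f t ^ q * g t ∂ν
      ≤ ∑' k : ℤ, ((2 : ℝ≥0∞) ^ (k + 1)) ^ q * ∫⁻ t in lev f k, g t ∂ν := by
  have hsub : ∫⁻ t in Ioi 0, f t ^ q * g t ∂ν ≤ ∫⁻ t in ⋃ k, lev f k, f t ^ q * g t ∂ν := by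
    have hm : MeasurableSet (⋃ k, lev f k) := MeasurableSet.iUnion fun k => measurableSet_lev hf k
    rw [← lintegral_indicator measurableSet_Ioi, ← lintegral_indicator hm]
    refine lintegral_mono fun t => ?_
    by_cases ht : t ∈ Ioi (0 : ℝ)
    · rw [indicator_of_mem ht]
      rcases eq_or_ne (f t) 0 with h0 | h0
      · simp [h0, ENNReal.zero_rpow_of_pos hq]
      · have : t ∈ ⋃ k, lev f k := mem_iUnion.2 (exists_mem_lev ht h0 (hfin t ht))
        rw [indicator_of_mem this]
    · rw [indicator_of_notMem ht]; exact zero_le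
  refine hsub.trans ?_
  rw [lintegral_iUnion (fun k => measurableSet_lev hf k) (pairwise_disjoint_lev f)]
  refine ENNReal.tsum_le_tsum fun k => ?_
  rw [← lintegral_const_mul' _ _ (ENNReal.rpow_ne_top_of_nonneg hq.le (two_zpow_ne_top _))]
  refine setLIntegral_mono' (measurableSet_lev hf k) fun t ht => ?_
  gcongr
  exact ht.2.2.le

lemma tsum_setLIntegral_le {J : ℤ → Set ℝ} (hJ : ∀ k, MeasurableSet (J k))
    (hd : Pairwise (Function.onFun Disjoint J)) (s : Set ℝ) (hs : ∀ k, J k ⊆ s)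
    (f : ℝ → ℝ≥0∞) (ν : Measure ℝ) :
    ∑' k, ∫⁻ t in J k, f t ∂ν ≤ ∫⁻ t in s, f t ∂ν := by
  rw [← lintegral_iUnion hJ hd]
  exact lintegral_mono_set (iUnion_subset hs)

/-- For a continuous non-decreasing `f` that vanishes at `0`, each non-empty level set begins at a
point `x k` with `f (x k) = 2^k`, and `[x (k-1), x k)` is contained in the preceding level set. -/
lemma exists_lev_left {f : ℝ → ℝ≥0∞} (hm : MonotoneOn f (Ioi 0)) (hc : ContinuousOn f (Ioi 0))
    (h0 : Tendsto f (𝓝[>] 0) (𝓝 0)) :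
    ∃ x : ℤ → ℝ, ∀ k, (lev f k).Nonempty → 0 < x k ∧ f (x k) = 2 ^ k ∧
      (∀ t ∈ lev f k, x k ≤ t) ∧ 0 < x (k - 1) ∧ x (k - 1) < x k ∧
      f (x (k - 1)) = 2 ^ (k - 1) ∧ Ico (x (k - 1)) (x k) ⊆ lev f (k - 1) := by
  set P : ℤ → Set ℝ := fun k => {t | 0 < t ∧ 2 ^ k ≤ f t} with hP
  have key : ∀ k, (P k).Nonempty →
      0 < sInf (P k) ∧ f (sInf (P k)) = 2 ^ k ∧ ∀ t ∈ P k, sInf (P k) ≤ t := by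
    intro k hne
    have hb : BddBelow (P k) := ⟨0, fun t ht => ht.1.le⟩
    have hle : ∀ t ∈ P k, sInf (P k) ≤ t := fun t ht => csInf_le hb ht
    obtain ⟨δ, hδ, hδ'⟩ := mem_nhdsGT_iff_exists_Ioo_subset.1
      (h0.eventually (gt_mem_nhds (two_zpow_pos k)))
    have hδ0 : (0 : ℝ) < δ := hδ
    have hge : δ ≤ sInf (P k) := le_csInf hne fun t ht => by
      by_contra hlt
      exact absurd ht.2 (not_le.2 (hδ' ⟨ht.1, not_le.1 hlt⟩))
    have hpos : 0 < sInf (P k) := hδ0.trans_le hge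
    have hclosed : IsClosed (Ici δ ∩ f ⁻¹' Ici (2 ^ k)) :=
      (hc.mono (Ici_subset_Ioi.2 hδ0)).preimage_isClosed_of_isClosed isClosed_Ici isClosed_Ici
    have hPeq : P k = Ici δ ∩ f ⁻¹' Ici (2 ^ k) := by
      ext t; constructor
      · exact fun ht => ⟨hge.trans (hle t ht), ht.2⟩
      · exact fun ht => ⟨hδ0.trans_le ht.1, ht.2⟩
    have hmem : sInf (P k) ∈ P k := by
      have := (hPeq ▸ hclosed).csInf_mem hne hb
      exact this
    refine ⟨hpos, le_antisymm ?_ hmem.2, hle⟩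
    have hct : ContinuousAt f (sInf (P k)) := hc.continuousAt (Ioi_mem_nhds hpos)
    refine le_of_tendsto (hct.tendsto.mono_left (nhdsWithin_le_nhds (s := Iio (sInf (P k))))) ?_
    filter_upwards [Ioo_mem_nhdsLT hpos] with s hs
    by_contra hlt
    exact absurd (hle s ⟨hs.1, (not_le.1 hlt).le⟩) (not_le.2 hs.2)
  refine ⟨fun k => sInf (P k), fun k ⟨t, ht⟩ => ?_⟩
  have hne : (P k).Nonempty := ⟨t, ht.1, ht.2.1⟩
  have hne' : (P (k - 1)).Nonempty := ⟨t, ht.1, (two_zpow_lt k).le.trans ht.2.1⟩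
  obtain ⟨h1, h2, h3⟩ := key k hne
  obtain ⟨h4, h5, h6⟩ := key (k - 1) hne'
  have hlt : sInf (P (k - 1)) < sInf (P k) := by
    refine lt_of_le_of_ne (h6 _ ⟨h1, ?_⟩) fun he => ?_
    · rw [h2]; exact (two_zpow_lt k).le
    · rw [he, h2] at h5
      exact (two_zpow_lt k).ne h5.symm
  refine ⟨h1, h2, fun t ht => h3 t ⟨ht.1, ht.2.1⟩, h4, hlt, h5, fun s hs => ?_⟩
  have hs0 : 0 < s := h4.trans_le hs.1
  refine ⟨hs0, h5.symm.trans_le (hm h4 hs0 hs.1), ?_⟩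
  rw [sub_add_cancel]
  by_contra hlt'
  exact absurd (h3 s ⟨hs0, not_lt.1 hlt'⟩) (not_le.2 hs.2)

/-- The mirror image of `exists_lev_left`, for a non-increasing function that vanishes at `∞`. -/
lemma exists_lev_right {f : ℝ → ℝ≥0∞} (hm : AntitoneOn f (Ioi 0)) (hc : ContinuousOn f (Ioi 0))
    (h0 : Tendsto f atTop (𝓝 0)) :
    ∃ b : ℤ → ℝ, ∀ k, (lev f k).Nonempty → 0 < b k ∧ f (b k) = 2 ^ k ∧
      (∀ t ∈ lev f k, t ≤ b k) ∧ 0 < b (k - 1) ∧ b k < b (k - 1) ∧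
      f (b (k - 1)) = 2 ^ (k - 1) ∧ Ioc (b k) (b (k - 1)) ⊆ lev f (k - 1) := by
  have hinv : ∀ {s t : ℝ}, s ∈ Ioi (0 : ℝ) → t ∈ Ioi (0 : ℝ) → s ≤ t → t⁻¹ ≤ s⁻¹ :=
    fun hs _ h => inv_anti₀ hs h
  have hmap : MapsTo (fun t : ℝ => t⁻¹) (Ioi 0) (Ioi 0) := fun t ht => mem_Ioi.2 (inv_pos.2 ht)
  obtain ⟨x, hx⟩ := exists_lev_left (f := fun t => f t⁻¹)
    (fun s hs t ht h => hm (hmap ht) (hmap hs) (hinv hs ht h))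
    (hc.comp (continuousOn_inv₀.mono fun t ht => ne_of_gt ht) hmap)
    (h0.comp tendsto_inv_nhdsGT_zero)
  have hlev : ∀ k t, t ∈ lev (fun t => f t⁻¹) k ↔ t⁻¹ ∈ lev f k := fun k t => by
    simp only [lev, mem_ofPred_eq, inv_pos]
  refine ⟨fun k => (x k)⁻¹, fun k ⟨t, ht⟩ => ?_⟩
  obtain ⟨h1, h2, h3, h4, h5, h6, h7⟩ := hx k ⟨t⁻¹, (hlev k _).2 (by rwa [inv_inv])⟩
  refine ⟨inv_pos.2 h1, h2, fun s hs => ?_, inv_pos.2 h4, (inv_lt_inv₀ h1 h4).2 h5, h6,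
    fun s hs => ?_⟩
  · have := h3 s⁻¹ ((hlev k _).2 (by rwa [inv_inv]))
    exact (le_inv_comm₀ h1 hs.1).1 this
  · have hs0 : 0 < s := (inv_pos.2 h1).trans hs.1
    have := h7 (show s⁻¹ ∈ Ico (x (k - 1)) (x k) from
      ⟨(le_inv_comm₀ hs0 h4).1 hs.2, (inv_lt_comm₀ h1 hs0).1 hs.1⟩)
    rw [hlev, inv_inv] at this
    exact this

/-! ### The setting -/

/-- The standing hypotheses on the exponents and the weights. The field `dual` says
that the primitive of `v^{1-p'}` is positive and finite. -/
structure Admissible (p q : ℝ) (u : ℝ → ℝ≥0) (a v w : ℝ → ℝ≥0∞) : Prop where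
  one_lt_p : 1 < p
  one_lt_q : 1 < q
  cont_u : ContinuousOn u (Ioi 0)
  weight_u : IsWeight fun t => (u t : ℝ≥0∞)
  weight_a : IsWeight a
  weight_v : IsWeight v
  weight_w : IsWeight w
  dual : ∀ x : ℝ, 0 < x → 0 < prim (dualWeight p v) x ∧ prim (dualWeight p v) x < ∞

/-- The `p`-th power of the norm of the source space, `∫_0^∞ h^p v`. -/
def energy (p : ℝ) (v h : ℝ → ℝ≥0∞) : ℝ≥0∞ := ∫⁻ x in Ioi 0, h x ^ p * v x

/-- The operator under study, `x ↦ ∫_0^x (T_u h) a`. -/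
def iterHardy (u : ℝ → ℝ≥0) (a h : ℝ → ℝ≥0∞) : ℝ → ℝ≥0∞ := prim fun t => supHardy u h t * a t

/-- The non-increasing majorant `t ↦ sup_{t ≤ τ} u(τ)`. -/
def supTail (u : ℝ → ℝ≥0) : ℝ → ℝ≥0∞ := supFrom fun τ => (u τ : ℝ≥0∞)

/-- The limit of `φ` at infinity. -/
def phiLim (p : ℝ) (u : ℝ → ℝ≥0) (v : ℝ → ℝ≥0∞) : ℝ≥0∞ := ⨅ t : ℝ, phi p u v t

/-- `∫_0^t v(x)^{1-p'} k(x,t)^{p'} dx`. -/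
def kernPow (p : ℝ) (u : ℝ → ℝ≥0) (a v : ℝ → ℝ≥0∞) (t : ℝ) : ℝ≥0∞ :=
  ∫⁻ x in Ioo 0 t, dualWeight p v x * kern u a x t ^ conj p

/-- `∫_{(0,t]} A^{p'} d(-φ)`. -/
def primPow (p : ℝ) (u : ℝ → ℝ≥0) (a v : ℝ → ℝ≥0∞) (t : ℝ) : ℝ≥0∞ :=
  ∫⁻ s in Ioc 0 t, prim a s ^ conj p ∂(decrMeasure (phi p u v))

/-- `∫_t^∞ k(t,y)^q w(y) dy`. -/
def kernTail (q : ℝ) (u : ℝ → ℝ≥0) (a w : ℝ → ℝ≥0∞) (t : ℝ) : ℝ≥0∞ :=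
  ∫⁻ y in Ioi t, kern u a t y ^ q * w y

/-- `∫_s A^q w`. -/
def massA (q : ℝ) (a w : ℝ → ℝ≥0∞) (s : Set ℝ) : ℝ≥0∞ := ∫⁻ y in s, prim a y ^ q * w y

lemma supFrom_antitone (f : ℝ → ℝ≥0∞) : Antitone (supFrom f) := fun _ _ h =>
  iSup_le fun τ => iSup_le fun hτ => le_iSup₂_of_le τ (h.trans hτ) le_rfl

lemma le_supFrom (f : ℝ → ℝ≥0∞) {t τ : ℝ} (h : t ≤ τ) : f τ ≤ supFrom f t :=
  le_iSup₂_of_le τ h le_rfl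

lemma supFrom_le {f : ℝ → ℝ≥0∞} {t : ℝ} {B : ℝ≥0∞} (h : ∀ τ, t ≤ τ → f τ ≤ B) :
    supFrom f t ≤ B := iSup₂_le h

lemma supTail_antitone (u : ℝ → ℝ≥0) : Antitone (supTail u) := supFrom_antitone _

lemma supHardy_antitone (u : ℝ → ℝ≥0) (h : ℝ → ℝ≥0∞) : Antitone (supHardy u h) :=
  supFrom_antitone _

lemma supTail_mul_prim_le (u : ℝ → ℝ≥0) (h : ℝ → ℝ≥0∞) (t : ℝ) :
    supTail u t * prim h t ≤ supHardy u h t := by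
  rw [supTail, supFrom, ENNReal.iSup_mul]
  refine iSup_le fun τ => ?_
  rw [ENNReal.iSup_mul]
  refine iSup_le fun hτ => le_trans ?_ (le_supFrom _ hτ)
  gcongr
  exact prim_mono h hτ

lemma supHardy_mono {u : ℝ → ℝ≥0} {g h : ℝ → ℝ≥0∞} (hgh : ∀ x, 0 < x → g x ≤ h x) (t : ℝ) :
    supHardy u g t ≤ supHardy u h t :=
  supFrom_le fun τ hτ => le_trans (by
    gcongr
    exact setLIntegral_mono' measurableSet_Ioo fun x hx => hgh x hx.1) (le_supFrom _ hτ)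

lemma iterHardy_mono {u : ℝ → ℝ≥0} {a g h : ℝ → ℝ≥0∞} (hgh : ∀ x, 0 < x → g x ≤ h x) (x : ℝ) :
    iterHardy u a g x ≤ iterHardy u a h x :=
  lintegral_mono fun t => by gcongr; exact supHardy_mono hgh t

lemma prim_const_mul {c : ℝ≥0∞} (hc : c ≠ ∞) (h : ℝ → ℝ≥0∞) (x : ℝ) :
    prim (fun y => c * h y) x = c * prim h x := lintegral_const_mul' _ _ hc

lemma iterHardy_const_mul {u : ℝ → ℝ≥0} {a h : ℝ → ℝ≥0∞} {c : ℝ≥0∞} (hc : c ≠ ∞) (x : ℝ) :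
    iterHardy u a (fun y => c * h y) x = c * iterHardy u a h x := by
  have : ∀ t, supHardy u (fun y => c * h y) t * a t = c * (supHardy u h t * a t) := fun t => by
    rw [← mul_assoc]; congr 1
    simp only [supHardy, supFrom, prim_const_mul hc, ENNReal.mul_iSup]
    refine iSup_congr fun τ => iSup_congr fun _ => ?_
    ring
  simp only [iterHardy, this]
  exact prim_const_mul hc _ x

lemma kern_mono_right (u : ℝ → ℝ≥0) (a : ℝ → ℝ≥0∞) (x : ℝ) : Monotone (kern u a x) :=
  fun _ _ h => lintegral_mono_set (Ioo_subset_Ioo_right h)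

lemma kern_antitone_left (u : ℝ → ℝ≥0) (a : ℝ → ℝ≥0∞) (y : ℝ) :
    Antitone fun x => kern u a x y :=
  fun _ _ h => lintegral_mono_set (Ioo_subset_Ioo_left h)

namespace Admissible

variable {p q : ℝ} {u : ℝ → ℝ≥0} {a v w : ℝ → ℝ≥0∞}

lemma p_pos (H : Admissible p q u a v w) : 0 < p := zero_lt_one.trans H.one_lt_p

lemma q_pos (H : Admissible p q u a v w) : 0 < q := zero_lt_one.trans H.one_lt_q

lemma conj_pos (H : Admissible p q u a v w) : 0 < conj p := SupHardy.conj_pos H.one_lt_p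

lemma aemeasurable_dualWeight (H : Admissible p q u a v w) :
    AEMeasurable (dualWeight p v) (volume.restrict (Ioi 0)) :=
  H.weight_v.aemeasurable.pow_const _

lemma prim_a_ne_top (H : Admissible p q u a v w) {x : ℝ} (hx : 0 < x) : prim a x ≠ ∞ :=
  (H.weight_a.lt_top x hx).ne

lemma prim_a_pos (H : Admissible p q u a v w) {x : ℝ} (hx : 0 < x) : 0 < prim a x :=
  H.weight_a.pos x hx

lemma ae_ne_top_of_prim {f : ℝ → ℝ≥0∞} (hf : AEMeasurable f (volume.restrict (Ioi 0)))
    (hfin : ∀ x, 0 < x → prim f x < ∞) : ∀ᵐ x ∂(volume.restrict (Ioi 0)), f x ≠ ∞ := by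
  have : Ioi (0 : ℝ) = ⋃ n : ℕ, Ioo 0 ((n : ℝ) + 1) := by
    ext x; simp only [mem_Ioi, mem_iUnion, mem_Ioo]
    exact ⟨fun h => let ⟨n, hn⟩ := exists_nat_gt x; ⟨n, h, by linarith⟩, fun ⟨_, h, _⟩ => h⟩
  rw [this, ae_restrict_iUnion_iff]
  intro n
  filter_upwards [ae_lt_top' (hf.mono_measure (Measure.restrict_mono Ioo_subset_Ioi_self le_rfl))
    (hfin ((n : ℝ) + 1) (by positivity)).ne] with x hx using hx.ne

lemma ae_v (H : Admissible p q u a v w) :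
    ∀ᵐ x ∂(volume.restrict (Ioi 0)), v x ≠ 0 ∧ v x ≠ ∞ := by
  filter_upwards [ae_ne_top_of_prim H.weight_v.aemeasurable H.weight_v.lt_top,
    ae_ne_top_of_prim H.aemeasurable_dualWeight fun x hx => (H.dual x hx).2] with x h1 h2
  refine ⟨fun h0 => h2 ?_, h1⟩
  rw [dualWeight, h0, ENNReal.zero_rpow_of_neg]
  linarith [one_lt_conj H.one_lt_p]

lemma ae_v_restrict (H : Admissible p q u a v w) {E : Set ℝ} (hE : E ⊆ Ioi 0) :
    ∀ᵐ x ∂(volume.restrict E), v x ≠ 0 ∧ v x ≠ ∞ :=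
  ae_mono (Measure.restrict_mono hE le_rfl) H.ae_v

lemma conj_eq (H : Admissible p q u a v w) : p * (1 - conj p) + 1 = 1 - conj p := by
  have := (holderConjugate_conj H.one_lt_p).mul_eq_add
  nlinarith

lemma conj_mul_sub_one (H : Admissible p q u a v w) : p * (conj p - 1) = conj p := by
  have := (holderConjugate_conj H.one_lt_p).mul_eq_add
  nlinarith

/-- Hölder's inequality, with the norm of the source space and its dual weight. -/
lemma holder (H : Admissible p q u a v w) {E : Set ℝ} (hE : E ⊆ Ioi 0) {h f : ℝ → ℝ≥0∞}
    (hh : AEMeasurable h (volume.restrict (Ioi 0))) (hf : AEMeasurable f (volume.restrict (Ioi 0))) :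
    ∫⁻ x in E, h x * f x ≤ (∫⁻ x in E, h x ^ p * v x) ^ (1 / p)
      * (∫⁻ x in E, dualWeight p v x * f x ^ conj p) ^ (1 / conj p) := by
  have hμ := Measure.restrict_mono hE (le_refl (volume : Measure ℝ))
  have hp := H.p_pos
  have hp' := H.conj_pos
  have key := ENNReal.lintegral_mul_le_Lp_mul_Lq (volume.restrict E)
    (holderConjugate_conj H.one_lt_p) (f := fun x => h x * v x ^ (1 / p))
    (g := fun x => v x ^ (-(1 / p)) * f x)
    ((hh.mono_measure hμ).mul ((H.weight_v.aemeasurable.mono_measure hμ).pow_const _))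
    (((H.weight_v.aemeasurable.mono_measure hμ).pow_const _).mul (hf.mono_measure hμ))
  have e0 : ∫⁻ x in E, h x * f x = ∫⁻ x in E,
      ((fun x => h x * v x ^ (1 / p)) * fun x => v x ^ (-(1 / p)) * f x) x := by
    refine lintegral_congr_ae ?_
    filter_upwards [H.ae_v_restrict hE] with x hx
    simp only [Pi.mul_apply]
    calc h x * f x = h x * 1 * f x := by rw [mul_one]
      _ = h x * (v x ^ (1 / p) * v x ^ (-(1 / p))) * f x := by
          rw [← ENNReal.rpow_add _ _ hx.1 hx.2, add_neg_cancel, ENNReal.rpow_zero]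
      _ = _ := by ring
  rw [e0]
  refine key.trans (le_of_eq ?_)
  congr 2
  · refine lintegral_congr fun x => ?_
    rw [ENNReal.mul_rpow_of_nonneg _ _ hp.le, ← ENNReal.rpow_mul, one_div_mul_cancel hp.ne',
      ENNReal.rpow_one]
  · refine lintegral_congr fun x => ?_
    rw [ENNReal.mul_rpow_of_nonneg _ _ hp'.le, ← ENNReal.rpow_mul, dualWeight]
    congr 2
    have := H.conj_mul_sub_one
    field_simp
    linarith

lemma setLIntegral_le_rpow (H : Admissible p q u a v w) {E : Set ℝ} (hE : E ⊆ Ioi 0)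
    {h : ℝ → ℝ≥0∞} (hh : AEMeasurable h (volume.restrict (Ioi 0))) :
    ∫⁻ x in E, h x ≤ (∫⁻ x in E, h x ^ p * v x) ^ (1 / p)
      * (∫⁻ x in E, dualWeight p v x) ^ (1 / conj p) := by
  simpa using H.holder hE hh (f := fun _ => 1) aemeasurable_const

lemma lintegral_dualWeight_mul_rpow (H : Admissible p q u a v w) {E : Set ℝ} (hE : E ⊆ Ioi 0)
    (f : ℝ → ℝ≥0∞) :
    ∫⁻ x in E, (dualWeight p v x * f x) ^ p * v x = ∫⁻ x in E, dualWeight p v x * f x ^ p := by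
  refine lintegral_congr_ae ?_
  filter_upwards [H.ae_v_restrict hE] with x hx
  rw [ENNReal.mul_rpow_of_nonneg _ _ H.p_pos.le, dualWeight, ← ENNReal.rpow_mul,
    mul_right_comm, mul_comm (1 - conj p) p]
  congr 1
  nth_rewrite 2 [← ENNReal.rpow_one (v x)]
  rw [← ENNReal.rpow_add _ _ hx.1 hx.2, H.conj_eq]

/-! ### The function `φ` and its Lebesgue–Stieltjes measure -/

lemma phi_antitone : Antitone (phi p u v) := supFrom_antitone _

lemma supTail_rpow_mul_le_phi (H : Admissible p q u a v w) {t τ : ℝ} (h : t ≤ τ) :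
    supTail u τ ^ conj p * prim (dualWeight p v) τ ≤ phi p u v t := by
  rw [supTail, supFrom, rpow_biSup H.conj_pos, ENNReal.iSup_mul]
  refine iSup_le fun s => ?_
  rw [ENNReal.iSup_mul]
  refine iSup_le fun hs => le_trans ?_ (le_supFrom _ (h.trans hs))
  gcongr
  exact prim_mono _ hs

lemma supTail_mul_le_phi (H : Admissible p q u a v w) {t τ : ℝ} (h : t ≤ τ) :
    supTail u τ * prim (dualWeight p v) τ ^ (1 / conj p) ≤ phi p u v t ^ (1 / conj p) := by
  have hp' := H.conj_pos
  refine le_trans (le_of_eq ?_) (ENNReal.rpow_le_rpow (H.supTail_rpow_mul_le_phi h)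
    (by positivity))
  rw [ENNReal.mul_rpow_of_nonneg _ _ (by positivity), ← ENNReal.rpow_mul,
    mul_one_div_cancel hp'.ne', ENNReal.rpow_one]

lemma supTail_ne_top (H : Admissible p q u a v w) {t : ℝ} (ht : 0 < t)
    (hφ : phi p u v t ≠ ∞) : supTail u t ≠ ∞ := fun h => by
  have := H.supTail_rpow_mul_le_phi (le_refl t)
  rw [h, ENNReal.top_rpow_of_pos H.conj_pos, ENNReal.top_mul (H.dual t ht).1.ne'] at this
  exact hφ (top_le_iff.1 this)

lemma continuousOn_phi_arg (H : Admissible p q u a v w) :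
    ContinuousOn (fun τ => (u τ : ℝ≥0∞) ^ conj p * prim (dualWeight p v) τ) (Ioi 0) := by
  have hV := continuousOn_prim (f := dualWeight p v) fun x hx => (H.dual x hx).2.ne
  have hu : ContinuousOn (fun τ => (u τ : ℝ≥0∞) ^ conj p) (Ioi 0) :=
    (ENNReal.continuous_rpow_const.comp ENNReal.continuous_coe).comp_continuousOn H.cont_u
  intro x hx
  refine ENNReal.Tendsto.mul (hu x hx) (Or.inr (H.dual x hx).2.ne) (hV x hx)
    (Or.inr (ENNReal.rpow_ne_top_of_nonneg H.conj_pos.le ENNReal.coe_ne_top))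

lemma phi_ne_top (H : Admissible p q u a v w) {s : ℝ} (hs : phi p u v s ≠ ∞) {t : ℝ}
    (ht : 0 < t) : phi p u v t ≠ ∞ := by
  rcases le_total s t with h | h
  · exact ne_top_of_le_ne_top hs (phi_antitone h)
  obtain ⟨m, hm, hmax⟩ := (isCompact_Icc (a := t) (b := s)).exists_isMaxOn (nonempty_Icc.2 h)
    (H.continuousOn_phi_arg.mono fun x hx => ht.trans_le hx.1)
  have hm0 : 0 < m := ht.trans_le hm.1
  have hb : phi p u v t ≤ max ((u m : ℝ≥0∞) ^ conj p * prim (dualWeight p v) m) (phi p u v s) := by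
    refine supFrom_le fun τ hτ => ?_
    rcases le_total τ s with h' | h'
    · exact le_max_of_le_left (hmax ⟨hτ, h'⟩)
    · exact le_max_of_le_right (le_supFrom _ h')
  refine ne_top_of_le_ne_top (max_lt ?_ hs.lt_top).ne hb
  exact ENNReal.mul_lt_top (ENNReal.rpow_lt_top_of_nonneg H.conj_pos.le ENNReal.coe_ne_top)
    (H.dual m hm0).2

lemma continuousAt_phi (H : Admissible p q u a v w) {x : ℝ} (hx : 0 < x) :
    ContinuousAt (phi p u v) x := by
  have hg := H.continuousOn_phi_arg
  set g := fun τ => (u τ : ℝ≥0∞) ^ conj p * prim (dualWeight p v) τ with hgdef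
  have hφ : phi p u v = supFrom g := rfl
  rw [hφ, ContinuousAt, tendsto_order]
  constructor
  · intro c hc
    obtain ⟨τ, hτ⟩ := lt_iSup_iff.1 hc
    obtain ⟨hτx, hcτ⟩ := lt_iSup_iff.1 hτ
    rcases eq_or_lt_of_le hτx with rfl | hlt
    · have hgx : ContinuousAt g x := hg.continuousAt (Ioi_mem_nhds hx)
      filter_upwards [hgx.eventually (lt_mem_nhds hcτ)] with y hy
      exact hy.trans_le (le_supFrom g le_rfl)
    · filter_upwards [Iio_mem_nhds hlt] with y hy
      exact hcτ.trans_le (le_supFrom g (le_of_lt hy))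
  · intro c hc
    obtain ⟨d, hd, hdc⟩ := exists_between hc
    have hgx : ContinuousAt g x := hg.continuousAt (Ioi_mem_nhds hx)
    obtain ⟨l, r, hlr, hsub⟩ := mem_nhds_iff_exists_Ioo_subset.1
      (hgx.eventually (gt_mem_nhds ((le_supFrom g le_rfl).trans_lt hd)))
    filter_upwards [Ioi_mem_nhds hlr.1] with y hy
    refine lt_of_le_of_lt (supFrom_le fun τ hτ => ?_) hdc
    rcases le_total x τ with h | h
    · exact (le_supFrom g h).trans hd.le
    · exact (hsub ⟨lt_of_lt_of_le hy hτ, h.trans_lt hlr.2⟩).le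

lemma decrMeasure_Ioc (H : Admissible p q u a v w) (hφ : ∀ t, 0 < t → phi p u v t ≠ ∞)
    {x y : ℝ} (hx : 0 < x) (hxy : x ≤ y) :
    phi p u v x = phi p u v y + decrMeasure (phi p u v) (Ioc x y) := by
  have hy : 0 < y := hx.trans_le hxy
  have hm : Monotone (fun s : ℝ => -(phi p u v (Real.exp s)).toReal) := fun s t h =>
    neg_le_neg (ENNReal.toReal_mono (hφ _ (Real.exp_pos _))
      (phi_antitone (Real.exp_le_exp.2 h)))
  have hc : ∀ s, hm.stieltjesFunction s = -(phi p u v (Real.exp s)).toReal := fun s => by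
    rw [hm.stieltjesFunction_eq]
    refine ContinuousWithinAt.rightLim_eq ?_
    refine ContinuousAt.continuousWithinAt ?_
    have h1 : ContinuousAt (fun s => phi p u v (Real.exp s)) s :=
      (H.continuousAt_phi (Real.exp_pos s)).comp Real.continuous_exp.continuousAt
    exact ((ENNReal.tendsto_toReal (hφ _ (Real.exp_pos s))).comp h1).neg
  have hpre : Real.exp ⁻¹' Ioc x y = Ioc (Real.log x) (Real.log y) := by
    ext s; simp only [mem_preimage, mem_Ioc, Real.log_lt_iff_lt_exp hx, Real.le_log_iff_exp_le hy]
  rw [decrMeasure, dif_pos hm, Measure.map_apply Real.measurable_exp measurableSet_Ioc, hpre,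
    StieltjesFunction.measure_Ioc, hc, hc, Real.exp_log hx, Real.exp_log hy]
  have hle : phi p u v y ≤ phi p u v x := phi_antitone hxy
  rw [neg_sub_neg, ENNReal.ofReal_sub _ ENNReal.toReal_nonneg, ENNReal.ofReal_toReal (hφ x hx),
    ENNReal.ofReal_toReal (hφ y hy), add_tsub_cancel_of_le hle]

lemma decrMeasure_Ici_le (H : Admissible p q u a v w) (hφ : ∀ t, 0 < t → phi p u v t ≠ ∞)
    {x : ℝ} (hx : 0 < x) : decrMeasure (phi p u v) (Ici x) ≤ phi p u v x := by
  have h1 : ∀ s ∈ Ioo 0 x, decrMeasure (phi p u v) (Ici x) ≤ phi p u v s := fun s hs => by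
    have hsub : Ici x ⊆ ⋃ n : ℕ, Ioc s (x + n) := fun y hy => by
      obtain ⟨n, hn⟩ := exists_nat_gt (y - x)
      exact mem_iUnion.2 ⟨n, hs.2.trans_le hy, by linarith⟩
    refine (measure_mono hsub).trans ?_
    rw [Monotone.measure_iUnion fun m n h => Ioc_subset_Ioc_right (by gcongr)]
    refine iSup_le fun n => ?_
    have hn : (0 : ℝ) ≤ n := by positivity
    rw [H.decrMeasure_Ioc hφ hs.1 (show s ≤ x + n by linarith [hs.2])]
    exact le_add_self
  refine ge_of_tendsto ((H.continuousAt_phi hx).tendsto.mono_left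
    (nhdsWithin_le_nhds (s := Iio x))) ?_
  filter_upwards [Ioo_mem_nhdsLT hx] with s hs using h1 s hs

lemma phi_le_decrMeasure_Ici_add (H : Admissible p q u a v w)
    (hφ : ∀ t, 0 < t → phi p u v t ≠ ∞) {x : ℝ} (hx : 0 < x) :
    phi p u v x ≤ decrMeasure (phi p u v) (Ici x) + phiLim p u v := by
  rw [phiLim, ENNReal.add_iInf]
  refine le_iInf fun t => ?_
  have h := H.decrMeasure_Ioc hφ hx (le_max_left x t)
  have h0 : phi p u v (max x t) ≤ phi p u v t := phi_antitone (le_max_right x t)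
  by_cases hxt : x < max x t
  · have h2 : decrMeasure (phi p u v) (Ioc x (max x t)) ≤ decrMeasure (phi p u v) (Ici x) :=
      measure_mono fun y hy => hy.1.le
    rw [h, add_comm]
    exact add_le_add h2 h0
  · have : max x t = x := le_antisymm (not_lt.1 hxt) (le_max_left _ _)
    rw [this] at h0
    exact h0.trans le_add_self

lemma termLim_rpow (H : Admissible p q u a v w) :
    termLim p q u a v w ^ q = massA q a w (Ioi 0) * phiLim p u v ^ (q / conj p) := by
  have hp' := H.conj_pos
  have hq := H.q_pos
  have e : ∀ t, supFrom (fun τ => (u τ : ℝ≥0∞) * prim (dualWeight p v) τ ^ (1 / conj p)) t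
      = phi p u v t ^ (1 / conj p) := fun t => by
    rw [phi, supFrom, supFrom, rpow_biSup (by positivity)]
    refine iSup_congr fun τ => iSup_congr fun _ => ?_
    rw [ENNReal.mul_rpow_of_nonneg _ _ (by positivity), ← ENNReal.rpow_mul,
      mul_one_div_cancel hp'.ne', ENNReal.rpow_one]
  have hlim : limUnder atTop
      (supFrom fun τ => (u τ : ℝ≥0∞) * prim (dualWeight p v) τ ^ (1 / conj p))
      = phiLim p u v ^ (1 / conj p) := by
    rw [(tendsto_atTop_iInf (supFrom_antitone _)).limUnder_eq]
    simp_rw [e]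
    exact ((ENNReal.orderIsoRpow (1 / conj p) (by positivity)).map_iInf _).symm
  rw [termLim, hlim, ENNReal.mul_rpow_of_nonneg _ _ hq.le, ← ENNReal.rpow_mul,
    one_div_mul_cancel hq.ne', ENNReal.rpow_one, ← ENNReal.rpow_mul, massA]
  congr 2; ring

end Admissible

/-! ### Continuous conditions and their discrete forms -/

/-- The functional that pairs a non-decreasing function `Θ` with the tails of `w`. With
`Θ = kernPow` it is `termA1` for `p ≤ q` and `termB2` for `q < p`; with `Θ = primPow` it is `termA4`
or `termB4`. -/
def condTail (p q : ℝ) (Θ w : ℝ → ℝ≥0∞) : ℝ≥0∞ :=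
  if p ≤ q then ⨆ (t : ℝ) (_ : 0 < t), Θ t ^ (1 / conj p) * (∫⁻ y in Ioi t, w y) ^ (1 / q)
  else (∫⁻ t in Ioi 0, Θ t ^ (rExp p q / conj p) * (∫⁻ y in Ioi t, w y) ^ (rExp p q / p) * w t)
    ^ (1 / rExp p q)

/-- The functional that pairs a non-increasing function `Ψ` with the primitive of `f`. With
`Ψ(x) = ∫_{[x,∞)} d(-φ)` and `f = A^q w` it is `termA3` for `p ≤ q` and `termB3` for `q < p`. -/
def condHead (p q : ℝ) (Ψ f : ℝ → ℝ≥0∞) : ℝ≥0∞ :=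
  if p ≤ q then ⨆ (x : ℝ) (_ : 0 < x), Ψ x ^ (1 / conj p) * (∫⁻ y in Ioo 0 x, f y) ^ (1 / q)
  else (∫⁻ x in Ioi 0, Ψ x ^ (rExp p q / conj p) * (∫⁻ y in Ioo 0 x, f y) ^ (rExp p q / p) * f x)
    ^ (1 / rExp p q)

/-- The functional that pairs the primitive of `v^{1-p'}` with `kernTail`, for either order of the
exponents. -/
def condKern (p q : ℝ) (u : ℝ → ℝ≥0) (a v w : ℝ → ℝ≥0∞) : ℝ≥0∞ :=
  if p ≤ q then termA2 p q u a v w else termB1 p q u a v w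

lemma div_mul_div_cancel_left_comm {q : ℝ} (hq : q ≠ 0) (c r : ℝ) : q / c * (r / q) = r / c := by
  rw [mul_comm, div_mul_div_cancel₀ hq]

lemma rpow_one_div_mul_self {B : ℝ≥0∞} {r q : ℝ} (hr : 0 < r) (hq : 0 < q) :
    ((B ^ (1 / r)) ^ q) ^ (r / q) = B := by
  rw [← ENNReal.rpow_mul, ← ENNReal.rpow_mul,
    show 1 / r * (q * (r / q)) = 1 by field_simp, ENNReal.rpow_one]

/-- The discrete form of `condTail`. For `q < p` each block contributes an integral over itself, by
the power rule `rpow_setLIntegral_le_of_right` for the tails of `w`. -/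
lemma seqNorm_le_condTail {p q : ℝ} (hq : 0 < q) (hp : 1 < p) {Θ w : ℝ → ℝ≥0∞}
    (hΘ : MonotoneOn Θ (Ioi 0)) (hw : ∀ t, 0 < t → ∫⁻ y in Ioi t, w y ≠ ∞) {J : ℤ → Set ℝ}
    (hJ : ∀ k, MeasurableSet (J k)) (hd : Pairwise (Function.onFun Disjoint J)) {m : ℤ → ℝ}
    (hm : ∀ k, (J k).Nonempty → 0 < m k ∧ ∀ t ∈ J k, m k ≤ t) :
    seqNorm p q (fun k => Θ (m k) ^ (q / conj p) * ∫⁻ y in J k, w y)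
      ≤ 2 * condTail p q Θ w ^ q := by
  have hp' := conj_pos hp
  have hJ0 : ∀ k, J k ⊆ Ioi 0 := fun k t ht =>
    (hm k ⟨t, ht⟩).1.trans_le ((hm k ⟨t, ht⟩).2 t ht)
  have htail : ∀ k, (J k).Nonempty → ∫⁻ y in J k, w y ≤ ∫⁻ y in Ioi (m k), w y := fun k hk => by
    rw [setLIntegral_congr (Ioi_ae_eq_Ici (a := m k))]
    exact lintegral_mono_set fun t ht => (hm k hk).2 t ht
  rcases le_or_gt p q with hpq | hpq
  · rw [seqNorm_of_le hpq, condTail, if_pos hpq]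
    refine iSup_le fun k => ?_
    rcases (J k).eq_empty_or_nonempty with h0 | hk
    · simp [h0]
    refine le_trans ?_ (le_mul_of_one_le_left zero_le (by norm_num))
    calc Θ (m k) ^ (q / conj p) * ∫⁻ y in J k, w y
        ≤ Θ (m k) ^ (q / conj p) * ∫⁻ y in Ioi (m k), w y := mul_le_mul_right (htail k hk) _
      _ = (Θ (m k) ^ (1 / conj p) * (∫⁻ y in Ioi (m k), w y) ^ (1 / q)) ^ q := by
          rw [ENNReal.mul_rpow_of_nonneg _ _ hq.le, ← ENNReal.rpow_mul, ← ENNReal.rpow_mul,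
            one_div_mul_cancel hq.ne', ENNReal.rpow_one, div_mul_eq_mul_div, one_mul]
      _ ≤ _ := by
          gcongr
          exact le_iSup₂_of_le (m k) (hm k hk).1 le_rfl
  · have hr := rExp_pos hq hpq
    have hp0 : 0 < p := hq.trans hpq
    refine seqNorm_le_of_lt hq hpq ?_
    rw [condTail, if_neg (not_le.2 hpq), ENNReal.mul_rpow_of_nonneg _ _ (div_pos hr hq).le,
      rpow_one_div_mul_self hr hq]
    refine le_trans ?_ (mul_le_mul_right (tsum_setLIntegral_le hJ hd (Ioi 0) hJ0
      (fun t => Θ t ^ (rExp p q / conj p) * (∫⁻ y in Ioi t, w y) ^ (rExp p q / p) * w t)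
      volume) _)
    rw [← ENNReal.tsum_mul_left]
    refine ENNReal.tsum_le_tsum fun k => ?_
    rcases (J k).eq_empty_or_nonempty with h0 | hk
    · simp [h0, ENNReal.zero_rpow_of_pos (div_pos hr hq)]
    have hs : 0 ≤ rExp p q / p := by positivity
    rw [ENNReal.mul_rpow_of_nonneg _ _ (div_pos hr hq).le, ← ENNReal.rpow_mul,
      div_mul_div_cancel_left_comm hq.ne']
    have h1 : (∫⁻ y in J k, w y) ^ (rExp p q / q) ≤ 2 ^ (rExp p q / q) *
        ∫⁻ x in J k, (∫⁻ y in Ioi x, w y) ^ (rExp p q / p) * w x := by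
      rw [rExp_div_q hq hpq]
      exact rpow_setLIntegral_le_of_right hs (hJ k)
        (ne_top_of_le_ne_top (hw _ (hm k hk).1) (htail k hk))
        fun x _ => lintegral_mono_set inter_subset_right
    calc Θ (m k) ^ (rExp p q / conj p) * (∫⁻ y in J k, w y) ^ (rExp p q / q)
        ≤ Θ (m k) ^ (rExp p q / conj p) * (2 ^ (rExp p q / q) *
          ∫⁻ x in J k, (∫⁻ y in Ioi x, w y) ^ (rExp p q / p) * w x) := by gcongr
      _ = 2 ^ (rExp p q / q) * (Θ (m k) ^ (rExp p q / conj p) *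
          ∫⁻ x in J k, (∫⁻ y in Ioi x, w y) ^ (rExp p q / p) * w x) := by ring
      _ ≤ 2 ^ (rExp p q / q) * ∫⁻ x in J k, Θ (m k) ^ (rExp p q / conj p) *
          ((∫⁻ y in Ioi x, w y) ^ (rExp p q / p) * w x) := by
          gcongr; exact lintegral_const_mul_le _ _
      _ ≤ _ := by
          gcongr 2 ^ (rExp p q / q) * ?_
          refine setLIntegral_mono' (hJ k) fun x hx => ?_
          rw [mul_assoc]
          gcongr
          exact hΘ (hm k hk).1 (hJ0 k hx) ((hm k hk).2 x hx)

/-- The discrete form of `condHead`. -/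
lemma seqNorm_le_condHead {p q : ℝ} (hq : 0 < q) (hp : 1 < p) {Ψ f : ℝ → ℝ≥0∞}
    (hΨ : AntitoneOn Ψ (Ioi 0)) (hf : ∀ t, 0 < t → prim f t ≠ ∞) {J : ℤ → Set ℝ}
    (hJ : ∀ k, MeasurableSet (J k)) (hd : Pairwise (Function.onFun Disjoint J))
    (hJ0 : ∀ k, J k ⊆ Ioi 0) {b : ℤ → ℝ}
    (hb : ∀ k, (J k).Nonempty → ∀ t ∈ J k, t ≤ b k) :
    seqNorm p q (fun k => Ψ (b k) ^ (q / conj p) * ∫⁻ y in J k, f y)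
      ≤ 2 * condHead p q Ψ f ^ q := by
  have hp' := conj_pos hp
  have hb0 : ∀ k, (J k).Nonempty → 0 < b k := fun k ⟨t, ht⟩ =>
    (mem_Ioi.1 (hJ0 k ht)).trans_le (hb k ⟨t, ht⟩ t ht)
  have hhead : ∀ k, (J k).Nonempty → ∫⁻ y in J k, f y ≤ ∫⁻ y in Ioo 0 (b k), f y := fun k hk => by
    rw [setLIntegral_congr (Ioo_ae_eq_Ioc (a := 0) (b := b k))]
    exact lintegral_mono_set fun t ht => ⟨hJ0 k ht, hb k hk t ht⟩
  rcases le_or_gt p q with hpq | hpq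
  · rw [seqNorm_of_le hpq, condHead, if_pos hpq]
    refine iSup_le fun k => ?_
    rcases (J k).eq_empty_or_nonempty with h0 | hk
    · simp [h0]
    refine le_trans ?_ (le_mul_of_one_le_left zero_le (by norm_num))
    calc Ψ (b k) ^ (q / conj p) * ∫⁻ y in J k, f y
        ≤ Ψ (b k) ^ (q / conj p) * ∫⁻ y in Ioo 0 (b k), f y := mul_le_mul_right (hhead k hk) _
      _ = (Ψ (b k) ^ (1 / conj p) * (∫⁻ y in Ioo 0 (b k), f y) ^ (1 / q)) ^ q := by
          rw [ENNReal.mul_rpow_of_nonneg _ _ hq.le, ← ENNReal.rpow_mul, ← ENNReal.rpow_mul,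
            one_div_mul_cancel hq.ne', ENNReal.rpow_one, div_mul_eq_mul_div, one_mul]
      _ ≤ _ := by
          gcongr
          exact le_iSup₂_of_le (b k) (hb0 k hk) le_rfl
  · have hr := rExp_pos hq hpq
    have hp0 : 0 < p := hq.trans hpq
    refine seqNorm_le_of_lt hq hpq ?_
    rw [condHead, if_neg (not_le.2 hpq), ENNReal.mul_rpow_of_nonneg _ _ (div_pos hr hq).le,
      rpow_one_div_mul_self hr hq]
    refine le_trans ?_ (mul_le_mul_right (tsum_setLIntegral_le hJ hd (Ioi 0) hJ0
      (fun t => Ψ t ^ (rExp p q / conj p) * (∫⁻ y in Ioo 0 t, f y) ^ (rExp p q / p) * f t)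
      volume) _)
    rw [← ENNReal.tsum_mul_left]
    refine ENNReal.tsum_le_tsum fun k => ?_
    rcases (J k).eq_empty_or_nonempty with h0 | hk
    · simp [h0, ENNReal.zero_rpow_of_pos (div_pos hr hq)]
    have hs : 0 ≤ rExp p q / p := by positivity
    rw [ENNReal.mul_rpow_of_nonneg _ _ (div_pos hr hq).le, ← ENNReal.rpow_mul,
      div_mul_div_cancel_left_comm hq.ne']
    have h1 : (∫⁻ y in J k, f y) ^ (rExp p q / q) ≤ 2 ^ (rExp p q / q) *
        ∫⁻ x in J k, (∫⁻ y in Ioo 0 x, f y) ^ (rExp p q / p) * f x := by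
      rw [rExp_div_q hq hpq]
      exact rpow_setLIntegral_le_of_left hs (hJ k)
        (ne_top_of_le_ne_top (hf _ (hb0 k hk)) (hhead k hk))
        fun x _ => lintegral_mono_set fun t ht => ⟨hJ0 k ht.1, ht.2⟩
    calc Ψ (b k) ^ (rExp p q / conj p) * (∫⁻ y in J k, f y) ^ (rExp p q / q)
        ≤ Ψ (b k) ^ (rExp p q / conj p) * (2 ^ (rExp p q / q) *
          ∫⁻ x in J k, (∫⁻ y in Ioo 0 x, f y) ^ (rExp p q / p) * f x) := by gcongr
      _ = 2 ^ (rExp p q / q) * (Ψ (b k) ^ (rExp p q / conj p) *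
          ∫⁻ x in J k, (∫⁻ y in Ioo 0 x, f y) ^ (rExp p q / p) * f x) := by ring
      _ ≤ 2 ^ (rExp p q / q) * ∫⁻ x in J k, Ψ (b k) ^ (rExp p q / conj p) *
          ((∫⁻ y in Ioo 0 x, f y) ^ (rExp p q / p) * f x) := by
          gcongr; exact lintegral_const_mul_le _ _
      _ ≤ _ := by
          gcongr 2 ^ (rExp p q / q) * ?_
          refine setLIntegral_mono' (hJ k) fun x hx => ?_
          rw [mul_assoc]
          gcongr
          exact hΨ (hJ0 k hx) (hb0 k hk) (hb k hk x hx)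

lemma tsum_lev_sub_one_le {f : ℝ → ℝ≥0∞} (hf : Measurable f) (g : ℝ → ℝ≥0∞) :
    ∑' k : ℤ, ∫⁻ t in lev f (k - 1), g t ≤ ∫⁻ t in Ioi 0, g t := by
  refine ((Equiv.subRight (1 : ℤ)).tsum_eq (fun k => ∫⁻ t in lev f k, g t)).trans_le ?_
  exact tsum_setLIntegral_le (measurableSet_lev hf) (pairwise_disjoint_lev f) _
    (lev_subset_Ioi f) g volume

namespace Admissible

variable {p q : ℝ} {u : ℝ → ℝ≥0} {a v w : ℝ → ℝ≥0∞}

lemma prim_massA_ne_top (H : Admissible p q u a v w) {x : ℝ} (hx : 0 < x) :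
    prim (fun y => prim a y ^ q * w y) x ≠ ∞ := by
  have h1 : prim (fun y => prim a y ^ q * w y) x ≤ prim (fun y => prim a x ^ q * w y) x := by
    refine setLIntegral_mono' measurableSet_Ioo fun y hy => ?_
    gcongr
    · exact H.q_pos.le
    · exact prim_mono a hy.2.le
  have hA : prim a x ^ q ≠ ∞ := ENNReal.rpow_ne_top_of_nonneg H.q_pos.le (H.prim_a_ne_top hx)
  rw [prim_const_mul hA] at h1
  exact ne_top_of_le_ne_top (ENNReal.mul_ne_top hA (H.weight_w.lt_top x hx).ne) h1

/-- The discrete form of `condHead` and `termLim` together, stated for `φ` itself: `φ(b)` is the sum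
of `∫_{[b,∞)} d(-φ)` and the limit of `φ` at infinity. -/
lemma seqNorm_phi_le (H : Admissible p q u a v w) (hφ : ∀ t, 0 < t → phi p u v t ≠ ∞)
    {J : ℤ → Set ℝ} (hJ : ∀ k, MeasurableSet (J k)) (hd : Pairwise (Function.onFun Disjoint J))
    (hJ0 : ∀ k, J k ⊆ Ioi 0) {b : ℤ → ℝ} (hb : ∀ k, (J k).Nonempty → ∀ t ∈ J k, t ≤ b k) :
    seqNorm p q (fun k => phi p u v (b k) ^ (q / conj p) * massA q a w (J k))
      ≤ 2 ^ (q / conj p) * 4 *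
        (condHead p q (fun x => decrMeasure (phi p u v) (Ici x)) (fun y => prim a y ^ q * w y) ^ q
          + termLim p q u a v w ^ q) := by
  have hp' := H.conj_pos
  have hq := H.q_pos
  have hs : 0 ≤ q / conj p := by positivity
  set D : ℝ → ℝ≥0∞ := fun x => decrMeasure (phi p u v) (Ici x) with hD
  set ℓ := phiLim p u v
  have h1 : ∀ k, phi p u v (b k) ^ (q / conj p) * massA q a w (J k)
      ≤ 2 ^ (q / conj p) * (D (b k) ^ (q / conj p) * massA q a w (J k)
        + ℓ ^ (q / conj p) * massA q a w (J k)) := fun k => by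
    rcases (J k).eq_empty_or_nonempty with h0 | ⟨t, ht⟩
    · simp [massA, h0]
    have hb0 : 0 < b k := (mem_Ioi.1 (hJ0 k ht)).trans_le (hb k ⟨t, ht⟩ t ht)
    calc phi p u v (b k) ^ (q / conj p) * massA q a w (J k)
        ≤ (D (b k) + ℓ) ^ (q / conj p) * massA q a w (J k) := by
          gcongr; exact H.phi_le_decrMeasure_Ici_add hφ hb0
      _ ≤ 2 ^ (q / conj p) * (D (b k) ^ (q / conj p) + ℓ ^ (q / conj p)) * massA q a w (J k) := by
          gcongr; exact sum_two_rpow hs _ _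
      _ = _ := by ring
  have h2 : seqNorm p q (fun k => D (b k) ^ (q / conj p) * massA q a w (J k))
      ≤ 2 * condHead p q D (fun y => prim a y ^ q * w y) ^ q :=
    seqNorm_le_condHead hq H.one_lt_p (fun s _ t _ h => measure_mono (Ici_subset_Ici.2 h))
      (fun t ht => H.prim_massA_ne_top ht) hJ hd hJ0 hb
  have h3 : seqNorm p q (fun k => ℓ ^ (q / conj p) * massA q a w (J k))
      ≤ termLim p q u a v w ^ q := by
    refine (seqNorm_le_tsum hq _).trans ?_
    rw [ENNReal.tsum_mul_left, H.termLim_rpow, mul_comm]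
    gcongr
    exact tsum_setLIntegral_le hJ hd (Ioi 0) hJ0 _ volume
  refine (seqNorm_mono hq h1).trans ?_
  rw [seqNorm_const_mul hq, mul_assoc]
  gcongr
  refine (seqNorm_add_le hq _ _).trans ?_
  calc 2 * (seqNorm p q (fun k => D (b k) ^ (q / conj p) * massA q a w (J k))
        + seqNorm p q fun k => ℓ ^ (q / conj p) * massA q a w (J k))
      ≤ 2 * (2 * condHead p q D (fun y => prim a y ^ q * w y) ^ q
        + 2 * termLim p q u a v w ^ q) := by
        gcongr
        exact h3.trans (le_mul_of_one_le_left zero_le (by norm_num))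
    _ = _ := by ring

/-- The discrete form of `condKern`. -/
lemma seqNorm_le_condKern (H : Admissible p q u a v w) {ν : Measure ℝ}
    (hν : ∀ t, 0 < t → ν (Ici t) ≤ kernTail q u a w t) {J : ℤ → Set ℝ}
    (hJ : ∀ k, MeasurableSet (J k)) (hd : Pairwise (Function.onFun Disjoint J)) {x : ℤ → ℝ}
    (hx : ∀ k, (J k).Nonempty → 0 < x k ∧ ∀ t ∈ J k, x k ≤ t) :
    seqNorm p q (fun k => prim (dualWeight p v) (x k) ^ (q / conj p) * ν (J k))
      ≤ 2 ^ (q / conj p) * condKern p q u a v w ^ q := by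
  have hp' := H.conj_pos
  have hq := H.q_pos
  rcases le_or_gt p q with hpq | hpq
  · rw [seqNorm_of_le hpq, condKern, if_pos hpq]
    refine iSup_le fun k => ?_
    rcases (J k).eq_empty_or_nonempty with h0 | hk
    · simp [h0]
    refine le_trans ?_ (le_mul_of_one_le_left zero_le
      (ENNReal.one_le_rpow (by norm_num) (div_pos hq hp')))
    calc prim (dualWeight p v) (x k) ^ (q / conj p) * ν (J k)
        ≤ prim (dualWeight p v) (x k) ^ (q / conj p) * kernTail q u a w (x k) := by
          gcongr
          exact (measure_mono fun t ht => (hx k hk).2 t ht).trans (hν _ (hx k hk).1)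
      _ = (prim (dualWeight p v) (x k) ^ (1 / conj p) * kernTail q u a w (x k) ^ (1 / q)) ^ q := by
          rw [ENNReal.mul_rpow_of_nonneg _ _ hq.le, ← ENNReal.rpow_mul, ← ENNReal.rpow_mul,
            one_div_mul_cancel hq.ne', ENNReal.rpow_one, div_mul_eq_mul_div, one_mul]
      _ ≤ _ := by
          gcongr
          exact le_iSup₂_of_le (x k) (hx k hk).1 le_rfl
  · have hr := rExp_pos hq hpq
    have hp0 := H.p_pos
    have hq' := SupHardy.conj_pos H.one_lt_q
    refine seqNorm_le_of_lt hq hpq ?_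
    rw [condKern, if_neg (not_le.2 hpq), ENNReal.mul_rpow_of_nonneg _ _ (div_pos hr hq).le,
      ← ENNReal.rpow_mul, div_mul_div_cancel_left_comm hq.ne', termB1, rpow_one_div_mul_self hr hq]
    set G : ℝ → ℝ≥0∞ := fun t =>
      prim (dualWeight p v) t ^ (rExp p q / conj q) * dualWeight p v t with hG
    have hGm : AEMeasurable G (volume.restrict (Ioi 0)) :=
      ((measurable_prim _).pow_const _).aemeasurable.mul H.aemeasurable_dualWeight
    have h1 : ∀ k, (prim (dualWeight p v) (x k) ^ (q / conj p) * ν (J k)) ^ (rExp p q / q)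
        ≤ 2 ^ (rExp p q / conj p) *
          ∫⁻ t in Ioi 0, (Iio (x k)).indicator (fun t => ν (J k) ^ (rExp p q / q) * G t) t := by
      intro k
      rcases (J k).eq_empty_or_nonempty with h0 | hk
      · simp [h0, ENNReal.zero_rpow_of_pos (div_pos hr hq)]
      rw [ENNReal.mul_rpow_of_nonneg _ _ (div_pos hr hq).le, ← ENNReal.rpow_mul,
        div_mul_div_cancel_left_comm hq.ne', lintegral_indicator measurableSet_Iio,
        Measure.restrict_restrict measurableSet_Iio, Iio_inter_Ioi]
      have h2 : prim (dualWeight p v) (x k) ^ (rExp p q / conj p) ≤ 2 ^ (rExp p q / conj p) *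
          ∫⁻ t in Ioo 0 (x k), G t := by
        rw [rExp_div_conj H.one_lt_q hpq]
        refine rpow_setLIntegral_le_of_left (by positivity) measurableSet_Ioo
          (H.dual _ (hx k hk).1).2.ne fun t ht => ?_
        exact lintegral_mono_set fun s hs => ⟨hs.1.1, hs.2⟩
      calc prim (dualWeight p v) (x k) ^ (rExp p q / conj p) * ν (J k) ^ (rExp p q / q)
          ≤ 2 ^ (rExp p q / conj p) * (∫⁻ t in Ioo 0 (x k), G t) * ν (J k) ^ (rExp p q / q) := by
            gcongr
        _ = 2 ^ (rExp p q / conj p) * (ν (J k) ^ (rExp p q / q) * ∫⁻ t in Ioo 0 (x k), G t) := by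
            ring
        _ ≤ _ := by gcongr; exact lintegral_const_mul_le _ _
    refine (ENNReal.tsum_le_tsum h1).trans ?_
    rw [ENNReal.tsum_mul_left, ← lintegral_tsum fun k =>
      (hGm.const_mul _).indicator measurableSet_Iio]
    gcongr 2 ^ (rExp p q / conj p) * ?_
    refine setLIntegral_mono' measurableSet_Ioi fun t ht => ?_
    have h3 : ∀ k, (Iio (x k)).indicator (fun t => ν (J k) ^ (rExp p q / q) * G t) t
        ≤ G t * ν (J k ∩ Ici t) ^ (rExp p q / q) := fun k => by
      by_cases htk : t < x k
      · rw [indicator_of_mem (by exact htk), mul_comm]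
        rcases (J k).eq_empty_or_nonempty with h0 | hk
        · simp [h0]
        gcongr
        exact fun s hs => ⟨hs, htk.le.trans ((hx k hk).2 s hs)⟩
      · rw [indicator_of_notMem (by exact htk)]; exact zero_le
    refine (ENNReal.tsum_le_tsum h3).trans ?_
    rw [ENNReal.tsum_mul_left]
    gcongr
    refine (tsum_rpow_le_rpow_tsum _ ?_).trans ?_
    · rw [rExp_div_q hq hpq]
      have : 0 < rExp p q / p := by positivity
      linarith
    · refine ENNReal.rpow_le_rpow ?_ (div_pos hr hq).le
      rw [← measure_iUnion (fun i j hij => (hd hij).mono inter_subset_left inter_subset_left)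
        fun k => (hJ k).inter measurableSet_Ici]
      exact (measure_mono (iUnion_subset fun k => inter_subset_right)).trans (hν t ht)

/-- Hardy's inequality with respect to a measure whose tails are dominated by those of the
kernel. -/
lemma setLIntegral_prim_rpow_le (H : Admissible p q u a v w) {ν : Measure ℝ}
    (hν : ∀ t, 0 < t → ν (Ici t) ≤ kernTail q u a w t) {h : ℝ → ℝ≥0∞}
    (hh : AEMeasurable h (volume.restrict (Ioi 0))) (hfin : ∀ x, 0 < x → prim h x ≠ ∞) :
    ∫⁻ t in Ioi 0, prim h t ^ q ∂ν
      ≤ 4 ^ q * 2 ^ (q / conj p) * condKern p q u a v w ^ q * energy p v h ^ (q / p) := by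
  have hp' := H.conj_pos
  have hq := H.q_pos
  have hp := H.p_pos
  have hmeas := measurable_prim h
  obtain ⟨x, hx⟩ := exists_lev_left (fun s _ t _ hst => prim_mono h hst) (continuousOn_prim hfin)
    (tendsto_prim_zero (hfin 1 one_pos))
  have h0 := setLIntegral_rpow_mul_le_tsum_lev (g := fun _ => 1) hmeas hfin hq ν
  simp only [mul_one, setLIntegral_one] at h0
  refine h0.trans ?_
  have h1 : ∀ k : ℤ, ((2 : ℝ≥0∞) ^ (k + 1)) ^ q * ν (lev (prim h) k)
      ≤ 4 ^ q * (prim (dualWeight p v) (x k) ^ (q / conj p) * ν (lev (prim h) k)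
        * (∫⁻ t in lev (prim h) (k - 1), h t ^ p * v t) ^ (q / p)) := fun k => by
    rcases (lev (prim h) k).eq_empty_or_nonempty with he | hk
    · simp [he]
    obtain ⟨x0, x1, x2, x3, x4, x5, x6⟩ := hx k hk
    have e1 : (2 : ℝ≥0∞) ^ (k - 1) = ∫⁻ t in Ioo (x (k - 1)) (x k), h t := by
      have := prim_eq_add (f := h) x3.le x4.le
      rw [x1, x5, two_zpow_eq_sub_one, mul_two] at this
      exact (ENNReal.add_right_inj (two_zpow_ne_top _)).1 this
    have e2 : (2 : ℝ≥0∞) ^ (k - 1) ≤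
        (∫⁻ t in lev (prim h) (k - 1), h t ^ p * v t) ^ (1 / p)
          * prim (dualWeight p v) (x k) ^ (1 / conj p) := by
      rw [e1]
      refine (H.setLIntegral_le_rpow (Ioo_subset_Ioi_self.trans (Ioi_subset_Ioi x3.le)) hh).trans ?_
      have s1 : Ioo (x (k - 1)) (x k) ⊆ lev (prim h) (k - 1) := Ioo_subset_Ico_self.trans x6
      have s2 : Ioo (x (k - 1)) (x k) ⊆ Ioo 0 (x k) := Ioo_subset_Ioo_left x3.le
      rw [prim]
      gcongr
    have e3 : (2 : ℝ≥0∞) ^ (k + 1) = 4 * 2 ^ (k - 1) := by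
      rw [two_zpow_add_one, two_zpow_eq_sub_one]; ring
    rw [e3, ENNReal.mul_rpow_of_nonneg _ _ hq.le, mul_assoc]
    gcongr 4 ^ q * ?_
    calc ((2 : ℝ≥0∞) ^ (k - 1)) ^ q * ν (lev (prim h) k)
        ≤ ((∫⁻ t in lev (prim h) (k - 1), h t ^ p * v t) ^ (1 / p)
          * prim (dualWeight p v) (x k) ^ (1 / conj p)) ^ q * ν (lev (prim h) k) := by gcongr
      _ = _ := by
        rw [ENNReal.mul_rpow_of_nonneg _ _ hq.le, ← ENNReal.rpow_mul, ← ENNReal.rpow_mul,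
          div_mul_eq_mul_div, one_mul, div_mul_eq_mul_div, one_mul]
        ring
  refine (ENNReal.tsum_le_tsum h1).trans ?_
  rw [ENNReal.tsum_mul_left, mul_assoc, mul_assoc]
  gcongr 4 ^ q * ?_
  refine (tsum_mul_rpow_le_seqNorm hp hq _ _).trans ?_
  rw [← mul_assoc]
  gcongr
  · exact H.seqNorm_le_condKern hν (measurableSet_lev hmeas) (pairwise_disjoint_lev _)
      fun k hk => ⟨(hx k hk).1, (hx k hk).2.2.1⟩
  · exact tsum_lev_sub_one_le hmeas _

end Admissible

/-! ### The supremal operator -/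

/-- The part `sup_{t ≤ τ} (sup_{τ ≤ s} u(s)) ∫_t^τ h` of `T_u h(t)`, in which `h` is integrated
beyond `t` only. -/
def supHardyTail (u : ℝ → ℝ≥0) (h : ℝ → ℝ≥0∞) (t : ℝ) : ℝ≥0∞ :=
  ⨆ (τ : ℝ) (_ : t ≤ τ), supTail u τ * ∫⁻ s in Ioo t τ, h s

lemma le_supHardyTail (u : ℝ → ℝ≥0) (h : ℝ → ℝ≥0∞) {t τ : ℝ} (hτ : t ≤ τ) :
    supTail u τ * ∫⁻ s in Ioo t τ, h s ≤ supHardyTail u h t := le_iSup₂_of_le τ hτ le_rfl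

lemma supHardyTail_antitone (u : ℝ → ℝ≥0) (h : ℝ → ℝ≥0∞) : Antitone (supHardyTail u h) :=
  fun _ _ hst => iSup₂_le fun τ hτ => le_trans (by gcongr) (le_supHardyTail u h (hst.trans hτ))

lemma supHardy_le (u : ℝ → ℝ≥0) (h : ℝ → ℝ≥0∞) {t : ℝ} (ht : 0 < t) :
    supHardy u h t ≤ supTail u t * prim h t + supHardyTail u h t := by
  refine supFrom_le fun τ hτ => ?_
  rw [prim_eq_add ht.le hτ, mul_add]
  have hu : (u τ : ℝ≥0∞) ≤ supTail u τ := le_supFrom (fun τ => (u τ : ℝ≥0∞)) le_rfl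
  refine add_le_add ?_ (le_trans ?_ (le_supHardyTail u h hτ))
  · gcongr; exact hu.trans (supTail_antitone u hτ)
  · gcongr

lemma supHardyTail_le_add {u : ℝ → ℝ≥0} {h : ℝ → ℝ≥0∞} {t t' : ℝ} (htt : t ≤ t') {B : ℝ≥0∞}
    (hB : ∀ τ, t ≤ τ → τ ≤ t' → supTail u τ * ∫⁻ s in Ioo t τ, h s ≤ B) :
    supHardyTail u h t ≤ B + supHardyTail u h t' := by
  refine iSup₂_le fun τ hτ => ?_
  rcases le_total τ t' with h1 | h1
  · exact (hB τ hτ h1).trans le_self_add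
  · rw [setLIntegral_Ioo_add_Ioo htt h1, mul_add]
    refine add_le_add (le_trans ?_ (hB t' htt le_rfl)) (le_supHardyTail u h h1)
    gcongr
    exact supTail_antitone u h1

lemma supHardyTail_le_mul_add (u : ℝ → ℝ≥0) (h : ℝ → ℝ≥0∞) {t t' : ℝ} (htt : t ≤ t') :
    supHardyTail u h t ≤ supTail u t * (∫⁻ s in Ioo t t', h s) + supHardyTail u h t' :=
  supHardyTail_le_add htt fun τ h1 h2 => by
    gcongr
    exact supTail_antitone u h1

lemma supHardyTail_le_mul (u : ℝ → ℝ≥0) (h : ℝ → ℝ≥0∞) {t : ℝ} (ht : 0 < t) :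
    supHardyTail u h t ≤ supTail u t * ∫⁻ s in Ioi 0, h s :=
  iSup₂_le fun τ hτ => by
    gcongr
    · exact supTail_antitone u hτ
    · exact fun s hs => ht.trans hs.1

lemma supHardyTail_eq_zero {u : ℝ → ℝ≥0} {h : ℝ → ℝ≥0∞} {n t : ℝ} (hn : ∀ x, n ≤ x → h x = 0)
    (ht : n ≤ t) : supHardyTail u h t = 0 := by
  refine le_antisymm (iSup₂_le fun τ _ => ?_) zero_le
  rw [setLIntegral_congr_fun measurableSet_Ioo (g := fun _ => 0)
    fun s hs => hn s (ht.trans hs.1.le)]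
  simp

namespace Admissible

variable {p q : ℝ} {u : ℝ → ℝ≥0} {a v w : ℝ → ℝ≥0∞}

/-- The local Hölder estimate behind every bound of the tail operator. -/
lemma supHardyTail_le (H : Admissible p q u a v w) {h : ℝ → ℝ≥0∞}
    (hh : AEMeasurable h (volume.restrict (Ioi 0))) {t t' : ℝ} (ht : 0 < t) (htt : t ≤ t') :
    supHardyTail u h t ≤ phi p u v t ^ (1 / conj p) * (∫⁻ x in Ioo t t', h x ^ p * v x) ^ (1 / p)
      + supHardyTail u h t' := by
  have hp := H.p_pos
  have hp' := H.conj_pos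
  refine supHardyTail_le_add htt fun τ h1 h2 => ?_
  have hsub : Ioo t τ ⊆ Ioi 0 := fun x hx => ht.trans hx.1
  calc supTail u τ * ∫⁻ s in Ioo t τ, h s
      ≤ supTail u τ * ((∫⁻ x in Ioo t τ, h x ^ p * v x) ^ (1 / p)
        * (∫⁻ x in Ioo t τ, dualWeight p v x) ^ (1 / conj p)) := by
        gcongr; exact H.setLIntegral_le_rpow hsub hh
    _ ≤ supTail u τ * ((∫⁻ x in Ioo t t', h x ^ p * v x) ^ (1 / p)
        * prim (dualWeight p v) τ ^ (1 / conj p)) := by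
        rw [prim]; gcongr
    _ = supTail u τ * prim (dualWeight p v) τ ^ (1 / conj p)
        * (∫⁻ x in Ioo t t', h x ^ p * v x) ^ (1 / p) := by ring
    _ ≤ _ := by
        gcongr; exact H.supTail_mul_le_phi h1

/-- Discretization of the tail operator along its own level sets: on the level set of order `k`,
which lies to the left of `b k`, it is controlled by the value of `φ` at `b k` and by the energy of
`h` on the next level set. -/
lemma exists_lev_supHardyTail (H : Admissible p q u a v w)
    (hφ : ∀ t, 0 < t → phi p u v t ≠ ∞) {h : ℝ → ℝ≥0∞}
    (hh : AEMeasurable h (volume.restrict (Ioi 0))) (hfin : ∫⁻ s in Ioi 0, h s ≠ ∞) {n : ℝ}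
    (hn : ∀ x, n ≤ x → h x = 0) :
    ∃ b : ℤ → ℝ, ∀ k, (lev (supHardyTail u h) k).Nonempty → 0 < b k ∧ b k < n ∧
      (∀ t ∈ lev (supHardyTail u h) k, t ≤ b k) ∧
      (2 : ℝ≥0∞) ^ (k - 1) ≤ phi p u v (b k) ^ (1 / conj p)
        * (∫⁻ x in lev (supHardyTail u h) (k - 1), h x ^ p * v x) ^ (1 / p) := by
  have hp := H.p_pos
  set F := supHardyTail u h with hF
  have hanti : Antitone F := supHardyTail_antitone u h
  have hcont : ContinuousOn F (Ioi 0) := by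
    intro x hx
    have hx2 : 0 < x / 2 := half_pos hx
    have hU : supTail u (x / 2) ≠ ∞ := H.supTail_ne_top hx2 (hφ _ hx2)
    refine (continuousAt_of_le_add (l := x / 2) (r := x + 1)
      (g := fun s => supTail u (x / 2) * h s) ⟨half_lt_self hx, lt_add_one x⟩ ?_
      ?_).continuousWithinAt
    · rw [lintegral_const_mul' _ _ hU]
      exact ENNReal.mul_ne_top hU (ne_top_of_le_ne_top hfin
        (lintegral_mono_set fun s hs => hx2.trans hs.1))
    · intro s t hs hst _
      refine ⟨?_, (hanti hst).trans le_self_add⟩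
      rw [lintegral_const_mul' _ _ hU, add_comm]
      refine (supHardyTail_le_mul_add u h hst).trans ?_
      gcongr
      exact supTail_antitone u hs.le
  have hzero : ∀ t, n ≤ t → F t = 0 := fun t ht => supHardyTail_eq_zero hn ht
  have hlim : Tendsto F atTop (𝓝 0) :=
    tendsto_const_nhds.congr' (by
      filter_upwards [eventually_ge_atTop n] with t ht using (hzero t ht).symm)
  obtain ⟨b, hb⟩ := exists_lev_right (hanti.antitoneOn _) hcont hlim
  refine ⟨b, fun k hk => ?_⟩
  obtain ⟨b0, b1, b2, b3, b4, b5, b6⟩ := hb k hk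
  refine ⟨b0, lt_of_not_ge fun hnb => ?_, b2, ?_⟩
  · rw [hzero _ hnb] at b1
    exact (two_zpow_pos k).ne b1
  · have h1 := H.supHardyTail_le hh b0 b4.le
    rw [← hF, b1, b5, two_zpow_eq_sub_one, mul_two] at h1
    have h2 := (ENNReal.add_le_add_iff_right (two_zpow_ne_top _)).1 h1
    refine h2.trans ?_
    gcongr
    exact Ioo_subset_Ioc_self.trans b6

/-- Weighted bound of the tail operator, for any exponent `s > 0`. It is used with `s = 1` and the
weight `a`, and with `s = q` and the weight `A^q w`. -/
lemma exists_setLIntegral_supHardyTail_le (H : Admissible p q u a v w) {s : ℝ} (hs : 0 < s)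
    (hφ : ∀ t, 0 < t → phi p u v t ≠ ∞) {h : ℝ → ℝ≥0∞}
    (hh : AEMeasurable h (volume.restrict (Ioi 0))) (hfin : ∫⁻ s in Ioi 0, h s ≠ ∞) {n : ℝ}
    (hn : ∀ x, n ≤ x → h x = 0) (f : ℝ → ℝ≥0∞) :
    ∃ (J : ℤ → Set ℝ) (b : ℤ → ℝ), (∀ k, MeasurableSet (J k)) ∧
      Pairwise (Function.onFun Disjoint J) ∧ (∀ k, J k ⊆ Ioi 0) ∧
      (∀ k, (J k).Nonempty → 0 < b k ∧ b k < n ∧ ∀ t ∈ J k, t ≤ b k) ∧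
      ∫⁻ t in Ioi 0, supHardyTail u h t ^ s * f t
        ≤ 4 ^ s * (seqNorm p s (fun k => phi p u v (b k) ^ (s / conj p) * ∫⁻ t in J k, f t)
          * energy p v h ^ (s / p)) := by
  have hp := H.p_pos
  have hp' := H.conj_pos
  obtain ⟨b, hb⟩ := H.exists_lev_supHardyTail hφ hh hfin hn
  set F := supHardyTail u h with hF
  have hmeas : Measurable F := (supHardyTail_antitone u h).measurable
  have hFfin : ∀ t, 0 < t → F t ≠ ∞ := fun t ht =>
    ne_top_of_le_ne_top (ENNReal.mul_ne_top (H.supTail_ne_top ht (hφ t ht)) hfin)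
      (supHardyTail_le_mul u h ht)
  refine ⟨lev F, b, measurableSet_lev hmeas, pairwise_disjoint_lev F, lev_subset_Ioi F,
    fun k hk => ⟨(hb k hk).1, (hb k hk).2.1, (hb k hk).2.2.1⟩, ?_⟩
  refine (setLIntegral_rpow_mul_le_tsum_lev hmeas hFfin hs volume).trans ?_
  have h1 : ∀ k : ℤ, ((2 : ℝ≥0∞) ^ (k + 1)) ^ s * ∫⁻ t in lev F k, f t
      ≤ 4 ^ s * (phi p u v (b k) ^ (s / conj p) * (∫⁻ t in lev F k, f t)
        * (∫⁻ t in lev F (k - 1), h t ^ p * v t) ^ (s / p)) := fun k => by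
    rcases (lev F k).eq_empty_or_nonempty with he | hk
    · simp [he]
    have e3 : (2 : ℝ≥0∞) ^ (k + 1) = 4 * 2 ^ (k - 1) := by
      rw [two_zpow_add_one, two_zpow_eq_sub_one]; ring
    rw [e3, ENNReal.mul_rpow_of_nonneg _ _ hs.le, mul_assoc]
    gcongr 4 ^ s * ?_
    calc ((2 : ℝ≥0∞) ^ (k - 1)) ^ s * ∫⁻ t in lev F k, f t
        ≤ (phi p u v (b k) ^ (1 / conj p) *
          (∫⁻ t in lev F (k - 1), h t ^ p * v t) ^ (1 / p)) ^ s * ∫⁻ t in lev F k, f t :=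
          mul_le_mul_left (ENNReal.rpow_le_rpow (hb k hk).2.2.2 hs.le) _
      _ = _ := by
        rw [ENNReal.mul_rpow_of_nonneg _ _ hs.le, ← ENNReal.rpow_mul, ← ENNReal.rpow_mul,
          div_mul_eq_mul_div, one_mul, div_mul_eq_mul_div, one_mul]
        ring
  refine (ENNReal.tsum_le_tsum h1).trans ?_
  rw [ENNReal.tsum_mul_left]
  gcongr 4 ^ s * ?_
  refine (tsum_mul_rpow_le_seqNorm hp hs _ _).trans ?_
  gcongr
  exact tsum_lev_sub_one_le hmeas _

lemma rExp_one (H : Admissible p q u a v w) : rExp p 1 = conj p := by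
  have := one_div_conj H.one_lt_p
  rw [rExp, div_one, ← this, one_div, inv_inv]

/-- For `h` carried by `(0,β)`, the integral `∫_0^β (supHardyTail h) a` is controlled by
`primPow` at `β` and the boundary term `A(β)^{p'} φ(β)`. -/
lemma setLIntegral_supHardyTail_mul_le (H : Admissible p q u a v w)
    (hφ : ∀ t, 0 < t → phi p u v t ≠ ∞) {h : ℝ → ℝ≥0∞}
    (hh : AEMeasurable h (volume.restrict (Ioi 0))) (hfin : ∫⁻ s in Ioi 0, h s ≠ ∞) {β : ℝ}
    (hn : ∀ x, β ≤ x → h x = 0) :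
    ∫⁻ t in Ioo 0 β, supHardyTail u h t * a t
      ≤ 4 * ((primPow p u a v β + prim a β ^ conj p * phi p u v β) ^ (1 / conj p)
          * energy p v h ^ (1 / p)) := by
  have hp' := H.conj_pos
  obtain ⟨J, b, hJ, hd, hJ0, hb, hle⟩ :=
    H.exists_setLIntegral_supHardyTail_le one_pos hφ hh hfin hn a
  simp only [ENNReal.rpow_one] at hle
  refine (lintegral_mono_set Ioo_subset_Ioi_self).trans (hle.trans ?_)
  gcongr 4 * (?_ * _)
  rw [seqNorm_of_lt H.one_lt_p, H.rExp_one, div_one]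
  refine ENNReal.rpow_le_rpow ?_ (by positivity)
  have hs1 : 1 ≤ conj p := (one_lt_conj H.one_lt_p).le
  set D := decrMeasure (phi p u v)
  have hterm : ∀ k, (phi p u v (b k) ^ (1 / conj p) * ∫⁻ t in J k, a t) ^ conj p
      ≤ (∫⁻ s in Ioc 0 β, (Ioi (b k)).indicator (fun _ => (∫⁻ t in J k, a t) ^ conj p) s ∂D)
        + (∫⁻ t in J k, a t) ^ conj p * phi p u v β := fun k => by
    rcases (J k).eq_empty_or_nonempty with he | hk
    · simp [he, ENNReal.zero_rpow_of_pos hp']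
    obtain ⟨b0, b1, _⟩ := hb k hk
    rw [ENNReal.mul_rpow_of_nonneg _ _ hp'.le, ← ENNReal.rpow_mul, one_div_mul_cancel hp'.ne',
      ENNReal.rpow_one, H.decrMeasure_Ioc hφ b0 b1.le, add_mul, add_comm,
      lintegral_indicator measurableSet_Ioi, lintegral_const, Measure.restrict_restrict
      measurableSet_Ioi, Measure.restrict_apply MeasurableSet.univ, univ_inter]
    refine add_le_add (le_of_eq ?_) (le_of_eq (mul_comm _ _))
    rw [mul_comm]
    congr 2
    ext s; simp only [mem_Ioc, mem_inter_iff, mem_Ioi]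
    exact ⟨fun hs => ⟨hs.1, b0.trans hs.1, hs.2⟩, fun hs => ⟨hs.1, hs.2.2⟩⟩
  refine (ENNReal.tsum_le_tsum hterm).trans ?_
  rw [ENNReal.tsum_add, ENNReal.tsum_mul_right]
  refine add_le_add ?_ ?_
  · rw [← lintegral_tsum fun k => (measurable_const.indicator measurableSet_Ioi).aemeasurable]
    refine setLIntegral_mono' measurableSet_Ioc fun s hs => ?_
    have h3 : ∀ k, (Ioi (b k)).indicator (fun _ => (∫⁻ t in J k, a t) ^ conj p) s
        ≤ (∫⁻ t in J k ∩ Iio s, a t) ^ conj p := fun k => by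
      by_cases hsk : b k < s
      · rw [indicator_of_mem (by exact hsk)]
        rcases (J k).eq_empty_or_nonempty with he | hk
        · simp [he]
        · have : J k ∩ Iio s = J k := inter_eq_left.2 fun t ht => ((hb k hk).2.2 t ht).trans_lt hsk
          rw [this]
      · rw [indicator_of_notMem (by exact hsk)]; exact zero_le
    refine (ENNReal.tsum_le_tsum h3).trans ((tsum_rpow_le_rpow_tsum _ hs1).trans ?_)
    refine ENNReal.rpow_le_rpow ?_ hp'.le
    exact tsum_setLIntegral_le (fun k => (hJ k).inter measurableSet_Iio)
      (fun i j hij => (hd hij).mono inter_subset_left inter_subset_left) (Ioo 0 s)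
      (fun k t ht => ⟨hJ0 k ht.1, ht.2⟩) a volume
  · gcongr
    refine (tsum_rpow_le_rpow_tsum _ hs1).trans (ENNReal.rpow_le_rpow ?_ hp'.le)
    exact tsum_setLIntegral_le hJ hd (Ioo 0 β)
      (fun k t ht => ⟨hJ0 k ht, ((hb k ⟨t, ht⟩).2.2 t ht).trans_lt (hb k ⟨t, ht⟩).2.1⟩) a volume

end Admissible

/-! ### The upper bound -/

lemma sum_five_rpow {s : ℝ} (hs : 0 ≤ s) (a b c d e : ℝ≥0∞) :
    (a + b + c + d + e) ^ s ≤ 5 ^ s * (a ^ s + b ^ s + c ^ s + d ^ s + e ^ s) := by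
  set M := max a (max b (max c (max d e))) with hM
  have ha : a ≤ M := le_max_left _ _
  have hb : b ≤ M := le_max_of_le_right (le_max_left _ _)
  have hc : c ≤ M := le_max_of_le_right (le_max_of_le_right (le_max_left _ _))
  have hd : d ≤ M :=
    le_max_of_le_right (le_max_of_le_right (le_max_of_le_right (le_max_left _ _)))
  have he : e ≤ M :=
    le_max_of_le_right (le_max_of_le_right (le_max_of_le_right (le_max_right _ _)))
  have h1 : a + b + c + d + e ≤ 5 * M := by
    calc a + b + c + d + e ≤ M + M + M + M + M := by gcongr
      _ = 5 * M := by ring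
  refine (ENNReal.rpow_le_rpow h1 hs).trans ?_
  rw [ENNReal.mul_rpow_of_nonneg _ _ hs]
  gcongr
  rw [hM, ENNReal.max_rpow hs, ENNReal.max_rpow hs, ENNReal.max_rpow hs, ENNReal.max_rpow hs]
  refine max_le ?_ (max_le ?_ (max_le ?_ (max_le ?_ ?_)))
  · exact le_self_add.trans (le_self_add.trans (le_self_add.trans le_self_add))
  · exact le_add_self.trans (le_self_add.trans (le_self_add.trans le_self_add))
  · exact le_add_self.trans (le_self_add.trans le_self_add)
  · exact le_add_self.trans le_self_add
  · exact le_add_self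

namespace Admissible

variable {p q : ℝ} {u : ℝ → ℝ≥0} {a v w : ℝ → ℝ≥0∞}

lemma aemeasurable_supTail_mul (H : Admissible p q u a v w) :
    AEMeasurable (fun s => supTail u s * a s) (volume.restrict (Ioi 0)) :=
  (supTail_antitone u).measurable.aemeasurable.mul H.weight_a.aemeasurable

/-- The increment of the operator over an interval `(α,β)`, split into the contribution of `h` to
the left of `α`, of `h` on `(α,β)`, and of `h` to the right of `β`. -/
lemma setLIntegral_supHardy_mul_le (H : Admissible p q u a v w)
    (hφ : ∀ t, 0 < t → phi p u v t ≠ ∞) {h : ℝ → ℝ≥0∞}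
    (hh : AEMeasurable h (volume.restrict (Ioi 0))) (hfin : ∫⁻ s in Ioi 0, h s ≠ ∞) {α β : ℝ}
    (hα : 0 < α) :
    ∫⁻ t in Ioo α β, supHardy u h t * a t ≤ prim h α * kern u a α β
      + kernPow p u a v β ^ (1 / conj p) * (∫⁻ x in Ioo α β, h x ^ p * v x) ^ (1 / p)
      + 4 * ((primPow p u a v β + prim a β ^ conj p * phi p u v β) ^ (1 / conj p)
          * (∫⁻ x in Ioo α β, h x ^ p * v x) ^ (1 / p))
      + prim a β * supHardyTail u h β := by
  have hp := H.p_pos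
  have hp' := H.conj_pos
  have hsub : Ioo α β ⊆ Ioi 0 := fun x hx => hα.trans hx.1
  have hmono := Measure.restrict_mono hsub (le_refl (volume : Measure ℝ))
  have hma : AEMeasurable a (volume.restrict (Ioo α β)) :=
    H.weight_a.aemeasurable.mono_measure hmono
  set g : ℝ → ℝ≥0∞ := (Ioo α β).indicator h with hg
  have hgm : AEMeasurable g (volume.restrict (Ioi 0)) := hh.indicator measurableSet_Ioo
  have hgfin : ∫⁻ s in Ioi 0, g s ≠ ∞ :=
    ne_top_of_le_ne_top hfin (lintegral_mono fun s => indicator_le_self _ _ s)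
  have hgE : energy p v g = ∫⁻ x in Ioo α β, h x ^ p * v x := by
    have : ∀ x, g x ^ p * v x = (Ioo α β).indicator (fun x => h x ^ p * v x) x := fun x => by
      by_cases hx : x ∈ Ioo α β
      · simp [hg, hx]
      · simp [hg, hx, ENNReal.zero_rpow_of_pos hp]
    simp_rw [energy, this]
    rw [lintegral_indicator measurableSet_Ioo, Measure.restrict_restrict measurableSet_Ioo,
      inter_eq_left.2 hsub]
  -- pointwise splitting of `T_u h` on `(α,β)`
  have hpt : ∀ t ∈ Ioo α β, supHardy u h t * a t ≤
      prim h α * (supTail u t * a t) + (supTail u t * a t) * (∫⁻ s in Ioo α t, h s)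
        + supHardyTail u g t * a t + supHardyTail u h β * a t := fun t ht => by
    have h1 := supHardy_le u h (hα.trans ht.1)
    rw [prim_eq_add hα.le ht.1.le] at h1
    have h2 : supHardyTail u h t ≤ supHardyTail u g t + supHardyTail u h β := by
      refine supHardyTail_le_add ht.2.le fun τ h1 h2 => ?_
      refine le_trans (le_of_eq ?_) (le_supHardyTail u g h1)
      congr 1
      refine setLIntegral_congr_fun measurableSet_Ioo fun s hs => ?_
      exact (indicator_of_mem (show s ∈ Ioo α β from ⟨ht.1.trans hs.1, hs.2.trans_le h2⟩) h).symm
    calc supHardy u h t * a t ≤ (supTail u t * (prim h α + ∫⁻ s in Ioo α t, h s)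
          + (supHardyTail u g t + supHardyTail u h β)) * a t := by
          gcongr; exact h1.trans (add_le_add le_rfl h2)
      _ = _ := by ring
  refine (setLIntegral_mono' measurableSet_Ioo hpt).trans ?_
  have hm2 : AEMeasurable (fun t => (supTail u t * a t) * ∫⁻ s in Ioo α t, h s)
      (volume.restrict (Ioo α β)) := by
    refine (H.aemeasurable_supTail_mul.mono_measure hmono).mul ?_
    have : Monotone fun t => ∫⁻ s in Ioo α t, h s := fun _ _ hst =>
      lintegral_mono_set (Ioo_subset_Ioo_right hst)
    exact this.measurable.aemeasurable
  have hm3 : AEMeasurable (fun t => supHardyTail u g t * a t) (volume.restrict (Ioo α β)) :=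
    (supHardyTail_antitone u g).measurable.aemeasurable.mul hma
  rw [lintegral_add_right' _ (hma.const_mul _), lintegral_add_right' _ hm3,
    lintegral_add_right' _ hm2]
  refine add_le_add (add_le_add (add_le_add ?_ ?_) ?_) ?_
  · have hne : prim h α ≠ ∞ := ne_top_of_le_ne_top hfin (lintegral_mono_set Ioo_subset_Ioi_self)
    rw [lintegral_const_mul' _ _ hne]
    exact le_rfl
  · rw [setLIntegral_Ioo_swap (H.aemeasurable_supTail_mul.mono_measure hmono)
      (hh.mono_measure hmono), mul_comm]
    refine (H.holder hsub hh (f := fun s => kern u a s β)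
      (kern_antitone_left u a β).measurable.aemeasurable).trans ?_
    gcongr
    exact lintegral_mono_set (Ioo_subset_Ioo_left hα.le)
  · rw [← hgE]
    refine le_trans (lintegral_mono_set (Ioo_subset_Ioo_left hα.le))
      (H.setLIntegral_supHardyTail_mul_le hφ hgm hgfin fun x hx => ?_)
    exact indicator_of_notMem (fun hx' => absurd hx'.2 (not_lt.2 hx)) h
  · rw [lintegral_const_mul'' _ hma, mul_comm]
    gcongr
    exact lintegral_mono_set (Ioo_subset_Ioo_left hα.le)

/-- The increment over `(α,β)`, with all coefficients moved to a point `m` beyond `β`. The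
boundary term `A(β)^{p'} φ(β)`, which no condition at the single point `β` controls, is split into
`∫_{(β,m]} A^{p'} d(-φ)` and `A(β)^{p'} φ(m)`. -/
lemma setLIntegral_supHardy_mul_le_of_le (H : Admissible p q u a v w)
    (hφ : ∀ t, 0 < t → phi p u v t ≠ ∞) {h : ℝ → ℝ≥0∞}
    (hh : AEMeasurable h (volume.restrict (Ioi 0))) (hfin : ∫⁻ s in Ioi 0, h s ≠ ∞) {α β m : ℝ}
    (hα : 0 < α) (hαβ : α < β) (hβm : β ≤ m) {G : ℝ≥0∞}
    (hG : ∫⁻ x in Ioo α β, h x ^ p * v x ≤ G) (hG' : ∫⁻ x in Ioo β m, h x ^ p * v x ≤ G) :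
    ∫⁻ t in Ioo α β, supHardy u h t * a t ≤ prim h α * kern u a α β
      + kernPow p u a v m ^ (1 / conj p) * G ^ (1 / p)
      + 5 * (primPow p u a v m ^ (1 / conj p) * G ^ (1 / p))
      + 5 * (phi p u v m ^ (1 / conj p) * prim a β * G ^ (1 / p))
      + prim a β * supHardyTail u h m := by
  have hp := H.p_pos
  have hp' := H.conj_pos
  have hβ : 0 < β := hα.trans hαβ
  have hc0 : 0 ≤ 1 / conj p := by positivity
  have hc1 : 1 / conj p ≤ 1 := by
    rw [div_le_one hp']; exact (one_lt_conj H.one_lt_p).le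
  set X := primPow p u a v m + prim a β ^ conj p * phi p u v m with hX
  have hXβ : primPow p u a v β + prim a β ^ conj p * phi p u v β ≤ X := by
    rw [H.decrMeasure_Ioc hφ hβ hβm, mul_add, add_comm (_ * phi p u v m), ← add_assoc, hX]
    gcongr
    rw [primPow, primPow, ← Ioc_union_Ioc_eq_Ioc hβ.le hβm,
      lintegral_union measurableSet_Ioc (Ioc_disjoint_Ioc_of_le le_rfl)]
    gcongr
    rw [← setLIntegral_const]
    refine setLIntegral_mono' measurableSet_Ioc fun s hs => ?_
    gcongr
    exact prim_mono a hs.1.le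
  have hXr : X ^ (1 / conj p) ≤
      primPow p u a v m ^ (1 / conj p) + phi p u v m ^ (1 / conj p) * prim a β := by
    refine (ENNReal.rpow_add_le_add_rpow _ _ hc0 hc1).trans ?_
    rw [ENNReal.mul_rpow_of_nonneg _ _ hc0, ← ENNReal.rpow_mul, mul_one_div_cancel hp'.ne',
      ENNReal.rpow_one, mul_comm (prim a β)]
  have hAφ : prim a β * phi p u v β ^ (1 / conj p) ≤ X ^ (1 / conj p) := by
    refine le_trans (le_of_eq ?_) (ENNReal.rpow_le_rpow (le_add_self.trans hXβ) hc0)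
    rw [ENNReal.mul_rpow_of_nonneg _ _ hc0, ← ENNReal.rpow_mul, mul_one_div_cancel hp'.ne',
      ENNReal.rpow_one]
  -- the part of `h` on `(β,m)` is estimated by Hölder's inequality and costs a boundary term again
  have hF : prim a β * supHardyTail u h β ≤
      X ^ (1 / conj p) * G ^ (1 / p) + prim a β * supHardyTail u h m := by
    calc prim a β * supHardyTail u h β ≤ prim a β * (phi p u v β ^ (1 / conj p)
          * (∫⁻ x in Ioo β m, h x ^ p * v x) ^ (1 / p) + supHardyTail u h m) := by
          gcongr; exact H.supHardyTail_le hh hβ hβm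
      _ ≤ prim a β * (phi p u v β ^ (1 / conj p) * G ^ (1 / p) + supHardyTail u h m) := by
          gcongr
      _ = prim a β * phi p u v β ^ (1 / conj p) * G ^ (1 / p)
          + prim a β * supHardyTail u h m := by ring
      _ ≤ _ := by gcongr
  have hkp : kernPow p u a v β ≤ kernPow p u a v m := by
    refine (lintegral_mono_set (Ioo_subset_Ioo_right hβm)).trans (lintegral_mono fun x => ?_)
    gcongr
    exact kern_mono_right u a x hβm
  refine (H.setLIntegral_supHardy_mul_le hφ hh hfin hα).trans ?_
  calc prim h α * kern u a α β
      + kernPow p u a v β ^ (1 / conj p) * (∫⁻ x in Ioo α β, h x ^ p * v x) ^ (1 / p)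
      + 4 * ((primPow p u a v β + prim a β ^ conj p * phi p u v β) ^ (1 / conj p)
          * (∫⁻ x in Ioo α β, h x ^ p * v x) ^ (1 / p))
      + prim a β * supHardyTail u h β
      ≤ prim h α * kern u a α β + kernPow p u a v m ^ (1 / conj p) * G ^ (1 / p)
      + 4 * (X ^ (1 / conj p) * G ^ (1 / p))
      + (X ^ (1 / conj p) * G ^ (1 / p) + prim a β * supHardyTail u h m) := by
        gcongr
    _ = prim h α * kern u a α β + kernPow p u a v m ^ (1 / conj p) * G ^ (1 / p)
      + 5 * (X ^ (1 / conj p) * G ^ (1 / p)) + prim a β * supHardyTail u h m := by ring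
    _ ≤ prim h α * kern u a α β + kernPow p u a v m ^ (1 / conj p) * G ^ (1 / p)
      + 5 * ((primPow p u a v m ^ (1 / conj p) + phi p u v m ^ (1 / conj p) * prim a β)
        * G ^ (1 / p)) + prim a β * supHardyTail u h m := by gcongr
    _ = _ := by ring

end Admissible

/-- The constant of the upper bound, for `q`-th powers. The summands belong to the five parts of an
increment of the operator. -/
def upperConst (p q : ℝ) : ℝ≥0∞ :=
  20 ^ q * (4 ^ q * 2 ^ (q / conj p) + 2 * 2 * 2 ^ (q / p) + 2 * 5 ^ q * 2 * 2 ^ (q / p)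
    + 2 * 5 ^ q * (2 ^ (q / conj p) * 4) * 2 ^ (q / p) + 2 * (4 ^ q * (2 ^ (q / conj p) * 4)))

lemma upperConst_pos (p q : ℝ) : 0 < upperConst p q := by
  have h : ∀ (n : ℕ) (s : ℝ), n ≠ 0 → (0 : ℝ≥0∞) < (n : ℝ≥0∞) ^ s := fun n s hn =>
    ENNReal.rpow_pos (by exact_mod_cast Nat.pos_of_ne_zero hn) (ENNReal.natCast_ne_top n)
  have h20 := h 20 q (by norm_num)
  have h4 := h 4 q (by norm_num)
  have h2 := h 2 (q / conj p) (by norm_num)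
  push_cast at h20 h4 h2
  refine ENNReal.mul_pos h20.ne' (pos_iff_ne_zero.1 (lt_of_lt_of_le (ENNReal.mul_pos h4.ne' h2.ne')
    (le_self_add.trans (le_self_add.trans (le_self_add.trans le_self_add)))))

lemma upperConst_ne_top (p q : ℝ) : upperConst p q ≠ ∞ := by
  have h : ∀ (n : ℕ) (s : ℝ), n ≠ 0 → (n : ℝ≥0∞) ^ s ≠ ∞ := fun n s hn =>
    ENNReal.rpow_ne_top_of_ne_zero (by exact_mod_cast hn) (ENNReal.natCast_ne_top n)
  have h20 := h 20 q (by norm_num)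
  have h4 := h 4 q (by norm_num)
  have h5 := h 5 q (by norm_num)
  have h2 := h 2 (q / conj p) (by norm_num)
  have h2' := h 2 (q / p) (by norm_num)
  push_cast at h20 h4 h5 h2 h2'
  simp [upperConst, ENNReal.mul_eq_top, h20, h4, h5, h2, h2']

/-- The sum of the `q`-th powers of the five functionals that characterize the inequality, in either
of the cases `p ≤ q` and `q < p`. -/
def condSum (p q : ℝ) (u : ℝ → ℝ≥0) (a v w : ℝ → ℝ≥0∞) : ℝ≥0∞ :=
  condKern p q u a v w ^ q + condTail p q (kernPow p u a v) w ^ q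
    + condTail p q (primPow p u a v) w ^ q
    + (condHead p q (fun x => decrMeasure (phi p u v) (Ici x)) (fun y => prim a y ^ q * w y) ^ q
      + termLim p q u a v w ^ q)

namespace Admissible

variable {p q : ℝ} {u : ℝ → ℝ≥0} {a v w : ℝ → ℝ≥0∞}

lemma kernPow_mono (H : Admissible p q u a v w) : Monotone (kernPow p u a v) := fun _ _ hst =>
  (lintegral_mono_set (Ioo_subset_Ioo_right hst)).trans (lintegral_mono fun x => by
    have := H.conj_pos.le
    gcongr
    exact kern_mono_right u a x hst)

lemma primPow_mono : Monotone (primPow p u a v) := fun _ _ hst =>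
  lintegral_mono_set (Ioc_subset_Ioc_right hst)

/-- Sum of the contributions of the part of `h` that lies to the left of each block: they form an
integral of `(∫_0^x h)^q` against a discrete measure, whose tails are dominated by those of the
kernel. -/
lemma tsum_prim_rpow_mul_le (H : Admissible p q u a v w) {h : ℝ → ℝ≥0∞}
    (hh : AEMeasurable h (volume.restrict (Ioi 0))) (hfin : ∀ x, 0 < x → prim h x ≠ ∞)
    {J : ℤ → Set ℝ} (hJ : ∀ k, MeasurableSet (J k)) (hd : Pairwise (Function.onFun Disjoint J))
    {α : ℤ → ℝ} (hα : ∀ k, (J k).Nonempty → 0 < α k ∧ ∀ t ∈ J k, α k < t) :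
    ∑' k, prim h (α k) ^ q * ∫⁻ y in J k, kern u a (α k) y ^ q * w y
      ≤ 4 ^ q * 2 ^ (q / conj p) * condKern p q u a v w ^ q * energy p v h ^ (q / p) := by
  have hq := H.q_pos
  set c : ℤ → ℝ≥0∞ := fun k => ∫⁻ y in J k, kern u a (α k) y ^ q * w y with hc
  set ν : Measure ℝ := Measure.sum fun k => c k • Measure.dirac (α k) with hν
  have hνt : ∀ t, 0 < t → ν (Ici t) ≤ kernTail q u a w t := fun t ht => by
    rw [hν, Measure.sum_apply _ measurableSet_Ici]
    refine le_trans (ENNReal.tsum_le_tsum fun k => ?_) (tsum_setLIntegral_le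
      (J := fun k => J k ∩ Ioi t) (fun k => (hJ k).inter measurableSet_Ioi)
      (fun i j hij => (hd hij).mono inter_subset_left inter_subset_left) (Ioi t)
      (fun k => inter_subset_right) (fun y => kern u a t y ^ q * w y) volume)
    rw [Measure.smul_apply, Measure.dirac_apply' _ measurableSet_Ici, smul_eq_mul]
    by_cases htk : t ≤ α k
    · rw [indicator_of_mem (by exact htk), Pi.one_apply, mul_one, hc]
      rcases (J k).eq_empty_or_nonempty with he | hk
      · simp [he]
      have : J k ∩ Ioi t = J k := inter_eq_left.2 fun y hy => htk.trans_lt ((hα k hk).2 y hy)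
      simp only [this]
      refine lintegral_mono fun y => ?_
      gcongr
      exact kern_antitone_left u a y htk
    · rw [indicator_of_notMem (by exact htk), mul_zero]; exact zero_le
  refine le_trans ?_ (H.setLIntegral_prim_rpow_le hνt hh hfin)
  have hm : Measurable ((Ioi (0 : ℝ)).indicator fun t => prim h t ^ q) :=
    ((measurable_prim h).pow_const q).indicator measurableSet_Ioi
  rw [← lintegral_indicator measurableSet_Ioi, hν, lintegral_sum_measure]
  refine ENNReal.tsum_le_tsum fun k => ?_
  rw [lintegral_smul_measure, lintegral_dirac' _ hm, smul_eq_mul, mul_comm]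
  rcases (J k).eq_empty_or_nonempty with he | hk
  · simp [hc, he]
  · rw [indicator_of_mem (by exact (hα k hk).1)]

/-- The upper bound for functions that are integrable and carried by a compact subset of the open
half-line: discretization of the operator along its own level sets. -/
lemma setLIntegral_iterHardy_le_of_support (H : Admissible p q u a v w)
    (hφ : ∀ t, 0 < t → phi p u v t ≠ ∞) (hw : ∀ t, 0 < t → ∫⁻ y in Ioi t, w y ≠ ∞)
    {h : ℝ → ℝ≥0∞} (hh : AEMeasurable h (volume.restrict (Ioi 0)))
    (hfin : ∫⁻ s in Ioi 0, h s ≠ ∞) {ε n : ℝ} (hε : 0 < ε) (hhε : ∀ x, x ≤ ε → h x = 0)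
    (hn : ∀ x, n ≤ x → h x = 0) :
    ∫⁻ t in Ioi 0, iterHardy u a h t ^ q * w t
      ≤ upperConst p q * condSum p q u a v w * energy p v h ^ (q / p) := by
  have hp := H.p_pos
  have hq := H.q_pos
  have hp' := H.conj_pos
  set S := iterHardy u a h with hS
  have hprim : ∀ x, prim h x ≠ ∞ := fun x =>
    ne_top_of_le_ne_top hfin (lintegral_mono_set Ioo_subset_Ioi_self)
  -- `T_u h` is bounded, hence `S` is finite and continuous
  have hF : ∀ t, supHardy u h t ≤ supTail u ε * ∫⁻ s in Ioi 0, h s := fun t => by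
    refine supFrom_le fun τ _ => ?_
    rcases le_total τ ε with h1 | h1
    · have : prim h τ = 0 := by
        rw [prim, setLIntegral_congr_fun measurableSet_Ioo (g := fun _ => 0)
          fun s hs => hhε s (hs.2.le.trans h1)]
        simp
      rw [this, mul_zero]; exact zero_le
    · gcongr
      · exact le_supFrom (fun τ => (u τ : ℝ≥0∞)) h1
      · exact lintegral_mono_set Ioo_subset_Ioi_self
  have hB : supTail u ε * ∫⁻ s in Ioi 0, h s ≠ ∞ :=
    ENNReal.mul_ne_top (H.supTail_ne_top hε (hφ ε hε)) hfin
  have hSfin : ∀ x, 0 < x → S x ≠ ∞ := fun x hx => by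
    have : S x ≤ (supTail u ε * ∫⁻ s in Ioi 0, h s) * prim a x := by
      rw [← prim_const_mul hB]
      exact lintegral_mono fun t => mul_le_mul_left (hF t) _
    exact ne_top_of_le_ne_top (ENNReal.mul_ne_top hB (H.prim_a_ne_top hx)) this
  have hSm : Monotone S := prim_mono _
  have hmeas : Measurable S := measurable_prim _
  obtain ⟨x, hx⟩ := exists_lev_left (hSm.monotoneOn _) (continuousOn_prim hSfin)
    (tendsto_prim_zero (hSfin 1 one_pos))
  set J := lev S with hJdef
  have hJ := measurableSet_lev hmeas
  have hd := pairwise_disjoint_lev S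
  have hJfin : ∀ k, ∫⁻ y in J k, w y ≠ ∞ := fun k => by
    rcases (J k).eq_empty_or_nonempty with he | hk
    · simp [he]
    · refine ne_top_of_le_ne_top (hw (x (k - 1)) (hx k hk).2.2.2.1) (lintegral_mono_set ?_)
      exact fun t ht => (hx k hk).2.2.2.2.1.trans_le ((hx k hk).2.2.1 t ht)
  -- `m k` is the median of `w` on `J k`: the conditions with tails of `w` are tested on
  -- `J k ∩ Ioi (m k)`, those with `φ` and `A^q w` on `J k ∩ Iio (m k)`
  have hmed : ∀ k, ∃ m : ℝ, 0 < m ∧ (∫⁻ y in J k, w y ≠ 0 →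
      (∫⁻ y in J k, w y ≤ 2 * ∫⁻ y in J k ∩ Iio m, w y) ∧
      (∫⁻ y in J k, w y ≤ 2 * ∫⁻ y in J k ∩ Ioi m, w y) ∧ x k ≤ m ∧ Ioo (x k) m ⊆ J k) := by
    intro k
    by_cases h0 : ∫⁻ y in J k, w y = 0
    · exact ⟨1, one_pos, fun h => absurd h0 h⟩
    obtain ⟨m, h1, h2⟩ := exists_setLIntegral_median h0 (hJfin k)
    have hne : ∀ A : Set ℝ, ∫⁻ y in J k, w y ≤ 2 * ∫⁻ y in A, w y → A.Nonempty := fun A hA => by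
      rcases A.eq_empty_or_nonempty with he | he
      · rw [he] at hA; simp at hA; exact absurd hA h0
      · exact he
    obtain ⟨s, hsJ, hsm⟩ := hne _ h1
    obtain ⟨t, htJ, htm⟩ := hne _ h2
    obtain ⟨x0, x1, x2, -⟩ := hx k ⟨s, hsJ⟩
    refine ⟨m, lt_trans hsJ.1 hsm, fun _ => ⟨h1, h2, (x2 s hsJ).trans (le_of_lt hsm), ?_⟩⟩
    exact fun z hz => ⟨x0.trans hz.1, x1.symm.trans_le (hSm hz.1.le),
      (hSm (hz.2.trans htm).le).trans_lt htJ.2.2⟩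
  choose m hm0 hm using hmed
  set E : ℤ → ℝ≥0∞ := fun k => ∫⁻ t in J k, h t ^ p * v t with hE
  set G : ℤ → ℝ≥0∞ := fun k => E (k - 1) + E k with hG
  have hGsum : ∑' k, G k ≤ 2 * energy p v h := by
    rw [hG, ENNReal.tsum_add, two_mul]
    exact add_le_add (tsum_lev_sub_one_le hmeas _)
      (tsum_setLIntegral_le hJ hd _ (lev_subset_Ioi S) _ volume)
  set c₁ : ℤ → ℝ≥0∞ := fun k =>
    prim h (x (k - 1)) ^ q * ∫⁻ y in J k, kern u a (x (k - 1)) y ^ q * w y with hc₁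
  set c₂ : ℤ → ℝ≥0∞ := fun k =>
    kernPow p u a v (m k) ^ (q / conj p) * ∫⁻ y in J k ∩ Ioi (m k), w y with hc₂
  set c₃ : ℤ → ℝ≥0∞ := fun k =>
    primPow p u a v (m k) ^ (q / conj p) * ∫⁻ y in J k ∩ Ioi (m k), w y with hc₃
  set c₄ : ℤ → ℝ≥0∞ := fun k =>
    phi p u v (m k) ^ (q / conj p) * massA q a w (J k ∩ Iio (m k)) with hc₄
  set c₅ : ℤ → ℝ≥0∞ := fun k =>
    ∫⁻ y in J k ∩ Iio (m k), supHardyTail u h y ^ q * (prim a y ^ q * w y) with hc₅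
  -- on `J k` the operator is at most `2^(k+1)`, four times its increment `2^(k-1)` over
  -- `(x (k-1), x k)`
  have hterm : ∀ k : ℤ, ((2 : ℝ≥0∞) ^ (k + 1)) ^ q * ∫⁻ y in J k, w y ≤
      20 ^ q * (c₁ k + 2 * (c₂ k * G k ^ (q / p)) + 2 * 5 ^ q * (c₃ k * G k ^ (q / p))
        + 2 * 5 ^ q * (c₄ k * G k ^ (q / p)) + 2 * c₅ k) := by
    intro k
    by_cases h0 : ∫⁻ y in J k, w y = 0
    · rw [h0, mul_zero]; exact zero_le
    have hk : (J k).Nonempty := by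
      rcases (J k).eq_empty_or_nonempty with he | hk
      · simp [he] at h0
      · exact hk
    obtain ⟨x0, x1, x2, x3, x4, x5, x6⟩ := hx k hk
    obtain ⟨m1, m2, m3, m4⟩ := hm k h0
    have e1 : (2 : ℝ≥0∞) ^ (k - 1) = ∫⁻ t in Ioo (x (k - 1)) (x k), supHardy u h t * a t := by
      have := prim_eq_add (f := fun t => supHardy u h t * a t) x3.le x4.le
      change S (x k) = S (x (k - 1)) + _ at this
      rw [x1, x5, two_zpow_eq_sub_one, mul_two] at this
      exact (ENNReal.add_right_inj (two_zpow_ne_top _)).1 this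
    have hb := H.setLIntegral_supHardy_mul_le_of_le hφ hh hfin x3 x4 m3 (G := G k)
      ((lintegral_mono_set (Ioo_subset_Ico_self.trans x6)).trans le_self_add)
      ((lintegral_mono_set m4).trans le_add_self)
    rw [← e1] at hb
    have e3 : (2 : ℝ≥0∞) ^ (k + 1) = 4 * 2 ^ (k - 1) := by
      rw [two_zpow_add_one, two_zpow_eq_sub_one]; ring
    have h20 : (20 : ℝ≥0∞) ^ q = 4 ^ q * 5 ^ q := by
      rw [← ENNReal.mul_rpow_of_nonneg _ _ hq.le]; norm_num
    have hpw : ∀ y : ℝ≥0∞, (y ^ (1 / conj p)) ^ q = y ^ (q / conj p) := fun y => by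
      rw [← ENNReal.rpow_mul, div_mul_eq_mul_div, one_mul]
    have hpw' : ∀ y : ℝ≥0∞, (y ^ (1 / p)) ^ q = y ^ (q / p) := fun y => by
      rw [← ENNReal.rpow_mul, div_mul_eq_mul_div, one_mul]
    have hsum := (ENNReal.rpow_le_rpow hb hq.le).trans (sum_five_rpow hq.le _ _ _ _ _)
    simp only [ENNReal.mul_rpow_of_nonneg _ _ hq.le, hpw, hpw'] at hsum
    rw [e3, ENNReal.mul_rpow_of_nonneg _ _ hq.le, h20, mul_assoc, mul_assoc]
    gcongr 4 ^ q * ?_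
    refine (mul_le_mul_left hsum _).trans ?_
    rw [mul_assoc]
    gcongr 5 ^ q * ?_
    simp only [add_mul]
    have hJx : ∀ y ∈ J k, x k ≤ y := x2
    have hAw : prim a (x k) ^ q * ∫⁻ y in J k, w y ≤ 2 * massA q a w (J k ∩ Iio (m k)) := by
      calc prim a (x k) ^ q * ∫⁻ y in J k, w y
          ≤ prim a (x k) ^ q * (2 * ∫⁻ y in J k ∩ Iio (m k), w y) := by gcongr
        _ = 2 * (prim a (x k) ^ q * ∫⁻ y in J k ∩ Iio (m k), w y) := by ring
        _ ≤ 2 * ∫⁻ y in J k ∩ Iio (m k), prim a (x k) ^ q * w y := by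
            gcongr; exact lintegral_const_mul_le _ _
        _ ≤ _ := by
            gcongr 2 * ?_
            refine setLIntegral_mono' ((hJ k).inter measurableSet_Iio) fun y hy => ?_
            gcongr
            exact prim_mono a (hJx y hy.1)
    refine add_le_add (add_le_add (add_le_add (add_le_add ?_ ?_) ?_) ?_) ?_
    · rw [mul_assoc]
      refine mul_le_mul_right ?_ _
      refine (lintegral_const_mul_le _ _).trans (setLIntegral_mono' (hJ k) fun y hy => ?_)
      gcongr
      exact kern_mono_right u a _ (hJx y hy)
    · calc kernPow p u a v (m k) ^ (q / conj p) * G k ^ (q / p) * ∫⁻ y in J k, w y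
          ≤ kernPow p u a v (m k) ^ (q / conj p) * G k ^ (q / p) *
            (2 * ∫⁻ y in J k ∩ Ioi (m k), w y) := by gcongr
        _ = _ := by simp only [hc₂]; ring
    · calc 5 ^ q * (primPow p u a v (m k) ^ (q / conj p) * G k ^ (q / p)) * ∫⁻ y in J k, w y
          ≤ 5 ^ q * (primPow p u a v (m k) ^ (q / conj p) * G k ^ (q / p)) *
            (2 * ∫⁻ y in J k ∩ Ioi (m k), w y) := by gcongr
        _ = _ := by simp only [hc₃]; ring
    · calc 5 ^ q * (phi p u v (m k) ^ (q / conj p) * prim a (x k) ^ q * G k ^ (q / p))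
            * ∫⁻ y in J k, w y
          = 5 ^ q * (phi p u v (m k) ^ (q / conj p) * G k ^ (q / p))
            * (prim a (x k) ^ q * ∫⁻ y in J k, w y) := by ring
        _ ≤ 5 ^ q * (phi p u v (m k) ^ (q / conj p) * G k ^ (q / p))
            * (2 * massA q a w (J k ∩ Iio (m k))) := by gcongr
        _ = _ := by simp only [hc₄]; ring
    · calc prim a (x k) ^ q * supHardyTail u h (m k) ^ q * ∫⁻ y in J k, w y
          = supHardyTail u h (m k) ^ q * (prim a (x k) ^ q * ∫⁻ y in J k, w y) := by ring
        _ ≤ supHardyTail u h (m k) ^ q * (2 * massA q a w (J k ∩ Iio (m k))) := by gcongr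
        _ = 2 * (supHardyTail u h (m k) ^ q * massA q a w (J k ∩ Iio (m k))) := by ring
        _ ≤ _ := by
            gcongr 2 * ?_
            refine (lintegral_const_mul_le _ _).trans
              (setLIntegral_mono' ((hJ k).inter measurableSet_Iio) fun y hy => ?_)
            gcongr
            exact supHardyTail_antitone u h (le_of_lt hy.2)
  -- the coefficients `c₂ k`, `c₃ k`, `c₄ k` are paired with the energies `G k` by `seqNorm`
  have hdL : Pairwise (Function.onFun Disjoint fun k => J k ∩ Iio (m k)) := fun i j hij =>
    (hd hij).mono inter_subset_left inter_subset_left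
  have hdR : Pairwise (Function.onFun Disjoint fun k => J k ∩ Ioi (m k)) := fun i j hij =>
    (hd hij).mono inter_subset_left inter_subset_left
  have hGq : (∑' k, G k) ^ (q / p) ≤ 2 ^ (q / p) * energy p v h ^ (q / p) := by
    rw [← ENNReal.mul_rpow_of_nonneg _ _ (by positivity)]
    gcongr
  set e := energy p v h ^ (q / p) with he
  have s₁ : ∑' k, c₁ k ≤ 4 ^ q * 2 ^ (q / conj p) * condKern p q u a v w ^ q * e :=
    H.tsum_prim_rpow_mul_le hh (fun x _ => hprim x) hJ hd fun k hk =>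
      ⟨(hx k hk).2.2.2.1, fun t ht => (hx k hk).2.2.2.2.1.trans_le ((hx k hk).2.2.1 t ht)⟩
  have s₂ : ∑' k, c₂ k * G k ^ (q / p) ≤
      2 * condTail p q (kernPow p u a v) w ^ q * (2 ^ (q / p) * e) :=
    (tsum_mul_rpow_le_seqNorm hp hq _ _).trans (mul_le_mul' (seqNorm_le_condTail hq H.one_lt_p
      (H.kernPow_mono.monotoneOn _) hw (fun k => (hJ k).inter measurableSet_Ioi) hdR
      fun k _ => ⟨hm0 k, fun t ht => le_of_lt ht.2⟩) hGq)
  have s₃ : ∑' k, c₃ k * G k ^ (q / p) ≤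
      2 * condTail p q (primPow p u a v) w ^ q * (2 ^ (q / p) * e) :=
    (tsum_mul_rpow_le_seqNorm hp hq _ _).trans (mul_le_mul' (seqNorm_le_condTail hq H.one_lt_p
      (primPow_mono.monotoneOn _) hw (fun k => (hJ k).inter measurableSet_Ioi) hdR
      fun k _ => ⟨hm0 k, fun t ht => le_of_lt ht.2⟩) hGq)
  set P := condHead p q (fun x => decrMeasure (phi p u v) (Ici x))
    (fun y => prim a y ^ q * w y) ^ q + termLim p q u a v w ^ q with hP
  have s₄ : ∑' k, c₄ k * G k ^ (q / p) ≤ 2 ^ (q / conj p) * 4 * P * (2 ^ (q / p) * e) :=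
    (tsum_mul_rpow_le_seqNorm hp hq _ _).trans (mul_le_mul' (H.seqNorm_phi_le hφ
      (fun k => (hJ k).inter measurableSet_Iio) hdL (fun k t ht => lev_subset_Ioi S k ht.1)
      fun k _ t ht => le_of_lt ht.2) hGq)
  have s₅ : ∑' k, c₅ k ≤ 4 ^ q * (2 ^ (q / conj p) * 4 * P * e) := by
    refine (tsum_setLIntegral_le (fun k => (hJ k).inter measurableSet_Iio) hdL (Ioi 0)
      (fun k t ht => lev_subset_Ioi S k ht.1) _ volume).trans ?_
    obtain ⟨I, b, i1, i2, i3, i4, i5⟩ := H.exists_setLIntegral_supHardyTail_le hq hφ hh hfin hn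
      fun y => prim a y ^ q * w y
    refine i5.trans ?_
    gcongr 4 ^ q * (?_ * e)
    exact H.seqNorm_phi_le hφ i1 i2 i3 fun k hk => (i4 k hk).2.2
  refine (setLIntegral_rpow_mul_le_tsum_lev hmeas hSfin hq volume).trans
    ((ENNReal.tsum_le_tsum hterm).trans ?_)
  rw [ENNReal.tsum_mul_left, upperConst, mul_assoc, mul_assoc]
  gcongr 20 ^ q * ?_
  rw [ENNReal.tsum_add, ENNReal.tsum_add, ENNReal.tsum_add, ENNReal.tsum_add,
    ENNReal.tsum_mul_left, ENNReal.tsum_mul_left, ENNReal.tsum_mul_left, ENNReal.tsum_mul_left]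
  set M := condSum p q u a v w with hM
  have t₁ : condKern p q u a v w ^ q ≤ M :=
    le_self_add.trans (le_self_add.trans le_self_add)
  have t₂ : condTail p q (kernPow p u a v) w ^ q ≤ M :=
    le_add_self.trans (le_self_add.trans le_self_add)
  have t₃ : condTail p q (primPow p u a v) w ^ q ≤ M := le_add_self.trans le_self_add
  have t₄ : P ≤ M := le_add_self
  calc ∑' k, c₁ k + 2 * ∑' k, c₂ k * G k ^ (q / p) + 2 * 5 ^ q * ∑' k, c₃ k * G k ^ (q / p)
        + 2 * 5 ^ q * ∑' k, c₄ k * G k ^ (q / p) + 2 * ∑' k, c₅ k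
      ≤ 4 ^ q * 2 ^ (q / conj p) * M * e + 2 * (2 * M * (2 ^ (q / p) * e))
        + 2 * 5 ^ q * (2 * M * (2 ^ (q / p) * e))
        + 2 * 5 ^ q * (2 ^ (q / conj p) * 4 * M * (2 ^ (q / p) * e))
        + 2 * (4 ^ q * (2 ^ (q / conj p) * 4 * M * e)) := by
        refine add_le_add (add_le_add (add_le_add (add_le_add (s₁.trans ?_)
          (mul_le_mul_right (s₂.trans ?_) _)) (mul_le_mul_right (s₃.trans ?_) _))
          (mul_le_mul_right (s₄.trans ?_) _)) (mul_le_mul_right (s₅.trans ?_) _)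
        all_goals gcongr
    _ = _ := by ring

end Admissible

/-! ### Degenerate weights and approximation -/

lemma IsWeight.exists_pos {f : ℝ → ℝ≥0∞} (hf : IsWeight f) {x : ℝ} (hx : 0 < x) :
    ∃ y, 0 < y ∧ y < x ∧ 0 < ∫⁻ t in Ioo y x, f t := by
  have hlim := tendsto_prim_zero (hf.lt_top 1 one_pos).ne
  obtain ⟨y, hy, hyx⟩ := ((hlim.eventually (gt_mem_nhds (hf.pos x hx))).and
    (Ioo_mem_nhdsGT hx)).exists
  refine ⟨y, hyx.1, hyx.2, pos_iff_ne_zero.2 fun h0 => ?_⟩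
  have h1 := prim_eq_add (f := f) hyx.1.le hyx.2.le
  rw [h0, add_zero] at h1
  exact absurd hy (not_lt.2 h1.le)

namespace Admissible

variable {p q : ℝ} {u : ℝ → ℝ≥0} {a v w : ℝ → ℝ≥0∞}

lemma massA_pos (H : Admissible p q u a v w) {x : ℝ} (hx : 0 < x) :
    0 < massA q a w (Ioo 0 x) := by
  obtain ⟨y, hy, _, hpos⟩ := H.weight_w.exists_pos hx
  calc 0 < prim a y ^ q * ∫⁻ t in Ioo y x, w t :=
        ENNReal.mul_pos (ENNReal.rpow_pos (H.prim_a_pos hy) (H.prim_a_ne_top hy)).ne' hpos.ne'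
    _ ≤ ∫⁻ t in Ioo y x, prim a y ^ q * w t := lintegral_const_mul_le _ _
    _ ≤ ∫⁻ t in Ioo y x, prim a t ^ q * w t := by
        refine setLIntegral_mono' measurableSet_Ioo fun t ht => ?_
        gcongr
        · exact H.q_pos.le
        · exact prim_mono a ht.1.le
    _ ≤ _ := lintegral_mono_set (Ioo_subset_Ioo_left hy.le)

/-- Near the origin the product of `sup_{t ≤ τ} u(τ)` and `a` does not vanish. -/
lemma exists_supTail_pos (H : Admissible p q u a v w) :
    ∃ y s, 0 < y ∧ y < s ∧ s < 1 ∧ 0 < supTail u s ∧ 0 < ∫⁻ t in Ioo y s, a t := by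
  have h1 := H.weight_u.pos 1 one_pos
  obtain ⟨s, hs, hus⟩ : ∃ s ∈ Ioo (0 : ℝ) 1, (u s : ℝ≥0∞) ≠ 0 := by
    by_contra! hcon
    rw [setLIntegral_congr_fun measurableSet_Ioo (g := fun _ => 0) hcon] at h1
    simp at h1
  obtain ⟨y, hy, hys, hpos⟩ := H.weight_a.exists_pos hs.1
  exact ⟨y, s, hy, hys, hs.2, (pos_iff_ne_zero.2 hus).trans_le
    (le_supFrom (fun τ => (u τ : ℝ≥0∞)) le_rfl), hpos⟩

lemma mul_setLIntegral_le_kern {x s z : ℝ} (hz : s ≤ z) :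
    supTail u s * ∫⁻ t in Ioo x s, a t ≤ kern u a x z := by
  refine (lintegral_const_mul_le _ _).trans ?_
  refine (setLIntegral_mono' measurableSet_Ioo fun t ht => ?_).trans
    (lintegral_mono_set (Ioo_subset_Ioo_right hz))
  gcongr
  exact supTail_antitone u ht.2.le

lemma kernPow_one_pos (H : Admissible p q u a v w) : 0 < kernPow p u a v 1 := by
  obtain ⟨y, s, hy, hys, hs1, hU, ha⟩ := H.exists_supTail_pos
  have hc : 0 < kern u a y 1 :=
    (ENNReal.mul_pos hU.ne' ha.ne').trans_le (mul_setLIntegral_le_kern hs1.le)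
  have hp' := H.conj_pos
  calc 0 < kern u a y 1 ^ conj p * prim (dualWeight p v) y :=
        ENNReal.mul_pos (ENNReal.rpow_pos_of_nonneg hc hp'.le).ne' (H.dual y hy).1.ne'
    _ ≤ ∫⁻ x in Ioo 0 y, kern u a y 1 ^ conj p * dualWeight p v x := lintegral_const_mul_le _ _
    _ ≤ ∫⁻ x in Ioo 0 y, dualWeight p v x * kern u a x 1 ^ conj p := by
        refine setLIntegral_mono' measurableSet_Ioo fun x hx => ?_
        rw [mul_comm]
        gcongr
        exact kern_antitone_left u a 1 hx.2.le
    _ ≤ _ := lintegral_mono_set (Ioo_subset_Ioo_right (hys.trans hs1).le)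

lemma tail_eq_top (H : Admissible p q u a v w) {t : ℝ} (ht : 0 < t)
    (h : ∫⁻ y in Ioi t, w y = ∞) {s : ℝ} (hs : 0 < s) : ∫⁻ y in Ioi s, w y = ∞ := by
  rcases le_total s t with hst | hst
  · exact top_le_iff.1 (h.symm.trans_le (lintegral_mono_set (Ioi_subset_Ioi hst)))
  · rw [setLIntegral_Ioi_eq_add hst, ENNReal.add_eq_top] at h
    refine h.resolve_left fun h0 => ?_
    exact (H.weight_w.lt_top s hs).ne (top_le_iff.1
      (h0.symm.trans_le (lintegral_mono_set (Ioo_subset_Ioo_left ht.le))))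

lemma condTail_kernPow_eq_top (H : Admissible p q u a v w) {t : ℝ} (ht : 0 < t)
    (h : ∫⁻ y in Ioi t, w y = ∞) : condTail p q (kernPow p u a v) w = ∞ := by
  have hW := fun s (hs : (0 : ℝ) < s) => H.tail_eq_top ht h hs
  have hp := H.p_pos
  have hq := H.q_pos
  have hp' := H.conj_pos
  have hκ := H.kernPow_one_pos
  rw [condTail]
  split_ifs with hpq
  · refine top_le_iff.1 (le_iSup₂_of_le 1 one_pos (le_of_eq ?_))
    rw [hW 1 one_pos, ENNReal.top_rpow_of_pos (by positivity), ENNReal.mul_top]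
    exact (ENNReal.rpow_pos_of_nonneg hκ (by positivity)).ne'
  · have hr := rExp_pos hq (not_le.1 hpq)
    rw [ENNReal.rpow_eq_top_iff_of_pos (by positivity)]
    refine top_le_iff.1 ?_
    calc ∞ = kernPow p u a v 1 ^ (rExp p q / conj p) * ∫⁻ y in Ioi 1, w y := by
          rw [hW 1 one_pos, ENNReal.mul_top]
          exact (ENNReal.rpow_pos_of_nonneg hκ (by positivity)).ne'
      _ ≤ ∫⁻ y in Ioi 1, kernPow p u a v 1 ^ (rExp p q / conj p) * w y :=
          lintegral_const_mul_le _ _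
      _ ≤ ∫⁻ y in Ioi 1, kernPow p u a v y ^ (rExp p q / conj p)
            * (∫⁻ z in Ioi y, w z) ^ (rExp p q / p) * w y := by
          refine setLIntegral_mono' measurableSet_Ioi fun y hy => ?_
          have hy1 : (1 : ℝ) < y := hy
          rw [hW y (one_pos.trans hy1), ENNReal.top_rpow_of_pos (by positivity)]
          gcongr
          refine le_trans (ENNReal.rpow_le_rpow (H.kernPow_mono hy1.le) (by positivity)) ?_
          exact le_mul_of_one_le_right zero_le le_top
      _ ≤ _ := lintegral_mono_set (Ioi_subset_Ioi zero_le_one)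

lemma phiLim_eq_top (H : Admissible p q u a v w) {t : ℝ} (ht : 0 < t)
    (h : phi p u v t = ∞) : phiLim p u v = ∞ :=
  iInf_eq_top.2 fun _ => by_contra fun hs => H.phi_ne_top hs ht h

lemma condSum_eq_top (H : Admissible p q u a v w)
    (h : ¬ ((∀ t, 0 < t → phi p u v t ≠ ∞) ∧ ∀ t, 0 < t → ∫⁻ y in Ioi t, w y ≠ ∞)) :
    condSum p q u a v w = ∞ := by
  have hq := H.q_pos
  have hp' := H.conj_pos
  rw [not_and_or] at h
  push Not at h
  rcases h with ⟨t, ht, h⟩ | ⟨t, ht, h⟩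
  · have : termLim p q u a v w ^ q = ∞ := by
      rw [H.termLim_rpow, H.phiLim_eq_top ht h, ENNReal.top_rpow_of_pos (by positivity),
        ENNReal.mul_top]
      exact ((H.massA_pos one_pos).trans_le (lintegral_mono_set Ioo_subset_Ioi_self)).ne'
    simp [condSum, this]
  · simp [condSum, H.condTail_kernPow_eq_top ht h, ENNReal.top_rpow_of_pos hq]

lemma iSup_indicator_Ioo (h : ℝ → ℝ≥0∞) {x : ℝ} (hx : 0 < x) :
    ⨆ n : ℕ, (Ioo (1 / ((n : ℝ) + 1)) ((n : ℝ) + 1)).indicator h x = h x := by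
  refine le_antisymm (iSup_le fun n => indicator_le_self _ _ x) ?_
  obtain ⟨n₁, h1⟩ := exists_nat_one_div_lt hx
  obtain ⟨n₂, h2⟩ := exists_nat_gt x
  have hmem : x ∈ Ioo (1 / (((max n₁ n₂ : ℕ) : ℝ) + 1)) (((max n₁ n₂ : ℕ) : ℝ) + 1) := by
    refine ⟨?_, ?_⟩
    · refine lt_of_le_of_lt ?_ h1
      have : (n₁ : ℝ) ≤ (max n₁ n₂ : ℕ) := by exact_mod_cast le_max_left _ _
      gcongr
    · have : (n₂ : ℝ) ≤ (max n₁ n₂ : ℕ) := by exact_mod_cast le_max_right _ _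
      linarith
  exact le_iSup_of_le (max n₁ n₂) (le_of_eq (indicator_of_mem hmem h).symm)

lemma monotone_indicator_Ioo (h : ℝ → ℝ≥0∞) :
    Monotone fun n : ℕ => (Ioo (1 / ((n : ℝ) + 1)) ((n : ℝ) + 1)).indicator h := by
  intro m n hmn x
  refine indicator_le_indicator_of_subset (Ioo_subset_Ioo ?_ ?_) (fun _ => zero_le) x
  · gcongr
  · gcongr

/-- Monotone continuity of the operator, along the exhaustion of the half-line by the intervals
`(1/(n+1), n+1)`. -/
lemma iterHardy_eq_iSup (H : Admissible p q u a v w) {h : ℝ → ℝ≥0∞}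
    (hh : AEMeasurable h (volume.restrict (Ioi 0))) (x : ℝ) :
    iterHardy u a h x = ⨆ n : ℕ,
      iterHardy u a ((Ioo (1 / ((n : ℝ) + 1)) ((n : ℝ) + 1)).indicator h) x := by
  set g : ℕ → ℝ → ℝ≥0∞ := fun n => (Ioo (1 / ((n : ℝ) + 1)) ((n : ℝ) + 1)).indicator h with hg
  have hgm : Monotone g := monotone_indicator_Ioo h
  have hprim : ∀ τ, prim h τ = ⨆ n, prim (g n) τ := fun τ => by
    simp only [prim]
    rw [← lintegral_iSup' (fun n => (hh.indicator measurableSet_Ioo).mono_measure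
      (Measure.restrict_mono Ioo_subset_Ioi_self le_rfl)) (ae_of_all _ fun z m n hmn => hgm hmn z)]
    exact setLIntegral_congr_fun measurableSet_Ioo fun z hz => (iSup_indicator_Ioo h hz.1).symm
  have hsup : ∀ t, supHardy u h t = ⨆ n, supHardy u (g n) t := fun t => by
    simp only [supHardy, supFrom, hprim, ENNReal.mul_iSup]
    rw [iSup_comm]
    refine iSup_congr fun τ => ?_
    rw [iSup_comm]
  simp only [iterHardy, prim, hsup, ENNReal.iSup_mul]
  refine lintegral_iSup' (fun n => ?_) (ae_of_all _ fun t m n hmn => ?_)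
  · exact (supHardy_antitone u (g n)).measurable.aemeasurable.mul
      (H.weight_a.aemeasurable.mono_measure (Measure.restrict_mono Ioo_subset_Ioi_self le_rfl))
  · dsimp only
    gcongr
    exact supHardy_mono (fun z _ => hgm hmn z) t

lemma setLIntegral_iterHardy_le (H : Admissible p q u a v w)
    (hφ : ∀ t, 0 < t → phi p u v t ≠ ∞) (hw : ∀ t, 0 < t → ∫⁻ y in Ioi t, w y ≠ ∞)
    {h : ℝ → ℝ≥0∞} (hh : AEMeasurable h (volume.restrict (Ioi 0))) (hE : energy p v h ≠ ∞) :
    ∫⁻ t in Ioi 0, iterHardy u a h t ^ q * w t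
      ≤ upperConst p q * condSum p q u a v w * energy p v h ^ (q / p) := by
  have hp := H.p_pos
  have hq := H.q_pos
  have hp' := H.conj_pos
  set g : ℕ → ℝ → ℝ≥0∞ := fun n => (Ioo (1 / ((n : ℝ) + 1)) ((n : ℝ) + 1)).indicator h with hg
  have hgm : Monotone g := monotone_indicator_Ioo h
  have hgE : ∀ n, energy p v (g n) ≤ energy p v h := fun n => lintegral_mono fun x => by
    gcongr
    exact indicator_le_self _ _ x
  have hgfin : ∀ n, ∫⁻ s in Ioi 0, g n s ≠ ∞ := fun n => by
    have hsub : Ioo (1 / ((n : ℝ) + 1)) ((n : ℝ) + 1) ⊆ Ioi 0 := fun x hx =>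
      lt_trans (by positivity) hx.1
    rw [hg, lintegral_indicator measurableSet_Ioo, Measure.restrict_restrict measurableSet_Ioo,
      inter_eq_left.2 hsub]
    refine ne_top_of_le_ne_top ?_ (H.setLIntegral_le_rpow hsub hh)
    refine ENNReal.mul_ne_top (ENNReal.rpow_ne_top_of_nonneg (by positivity) ?_)
      (ENNReal.rpow_ne_top_of_nonneg (by positivity) ?_)
    · exact ne_top_of_le_ne_top hE (lintegral_mono_set hsub)
    · refine ne_top_of_le_ne_top (H.dual ((n : ℝ) + 1) (by positivity)).2.ne
        (lintegral_mono_set (Ioo_subset_Ioo_left (by positivity)))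
  have hS : ∀ t, iterHardy u a h t ^ q * w t = ⨆ n, iterHardy u a (g n) t ^ q * w t := fun t => by
    rw [H.iterHardy_eq_iSup hh, rpow_iSup hq, ENNReal.iSup_mul]
  simp_rw [hS]
  have hmS : ∀ n, AEMeasurable (fun t => iterHardy u a (g n) t ^ q * w t)
      (volume.restrict (Ioi 0)) := fun n =>
    ((measurable_prim _).pow_const q).aemeasurable.mul H.weight_w.aemeasurable
  rw [lintegral_iSup' hmS (ae_of_all _ fun t m n hmn => by
      dsimp only
      gcongr
      exact iterHardy_mono (fun z _ => hgm hmn z) t)]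
  refine iSup_le fun n => ?_
  refine (H.setLIntegral_iterHardy_le_of_support hφ hw (hh.indicator measurableSet_Ioo) (hgfin n)
    (ε := 1 / ((n : ℝ) + 1)) (n := (n : ℝ) + 1) (by positivity)
    (fun x hx => indicator_of_notMem (fun hx' => absurd hx'.1 (not_lt.2 hx)) h)
    (fun x hx => indicator_of_notMem (fun hx' => absurd hx'.2 (not_lt.2 hx)) h)).trans ?_
  gcongr
  exact hgE n

/-- If `φ` is infinite, or `w` is not integrable at infinity, then `condSum` is infinite. Otherwise
the bound for functions carried by `(1/(n+1), n+1)` extends to all `h` of finite energy by monotone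
convergence; `h` of infinite energy contributes `0` to the norm. -/
lemma opNorm_rpow_le (H : Admissible p q u a v w) :
    opNorm p q u a v w ^ q ≤ upperConst p q * condSum p q u a v w := by
  have hp := H.p_pos
  have hq := H.q_pos
  by_cases hfin : (∀ t, 0 < t → phi p u v t ≠ ∞) ∧ ∀ t, 0 < t → ∫⁻ y in Ioi t, w y ≠ ∞
  swap
  · rw [H.condSum_eq_top hfin, ENNReal.mul_top (upperConst_pos p q).ne']; exact le_top
  rw [← ENNReal.le_rpow_inv_iff hq]
  refine iSup₂_le fun h hh => ?_
  have hN : wNorm p v h = energy p v h ^ (1 / p) := rfl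
  rcases eq_or_ne (energy p v h) ∞ with hE | hE
  · rw [hN, hE, ENNReal.top_rpow_of_pos (by positivity), ENNReal.div_top]; exact zero_le
  refine ENNReal.div_le_of_le_mul ?_
  have h1 := ENNReal.rpow_le_rpow (H.setLIntegral_iterHardy_le hfin.1 hfin.2 hh hE)
    (show 0 ≤ 1 / q by positivity)
  refine h1.trans (le_of_eq ?_)
  rw [ENNReal.mul_rpow_of_nonneg _ _ (by positivity), ← ENNReal.rpow_mul, hN, one_div q]
  congr 2
  field_simp

end Admissible

/-! ### Lower bounds: superposition of test functions -/

lemma setLIntegral_le_two_mul_of_left {f : ℝ → ℝ≥0∞} (hf : ∀ x, 0 < x → prim f x ≠ ∞)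
    {J : Set ℝ} (hJ0 : J ⊆ Ioi 0) {B : ℝ≥0∞}
    (hB : ∀ t ∈ J, ∫⁻ s in J ∩ Iio t, f s ≤ B) : ∫⁻ s in J, f s ≤ 2 * B := by
  have hbd : ∀ n : ℕ, ∫⁻ s in J ∩ Iio (n : ℝ), f s ≤ 2 * B := fun n => by
    rcases eq_or_ne (∫⁻ s in J ∩ Iio (n : ℝ), f s) 0 with h0 | h0
    · rw [h0]; exact zero_le
    have hfin : ∫⁻ s in J ∩ Iio (n : ℝ), f s ≠ ∞ := by
      refine ne_top_of_le_ne_top (hf ((n : ℝ) + 1) (by positivity)) (lintegral_mono_set ?_)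
      exact fun s hs => ⟨hJ0 hs.1, lt_trans hs.2 (lt_add_one _)⟩
    obtain ⟨m, h1, h2⟩ := exists_setLIntegral_median h0 hfin
    obtain ⟨t, ht, htm⟩ : ((J ∩ Iio (n : ℝ)) ∩ Ioi m).Nonempty := by
      rcases ((J ∩ Iio (n : ℝ)) ∩ Ioi m).eq_empty_or_nonempty with he | he
      · rw [he] at h2; simp at h2; exact absurd h2 h0
      · exact he
    refine h1.trans ?_
    gcongr
    refine (lintegral_mono_set ?_).trans (hB t ht.1)
    exact fun s hs => ⟨hs.1.1, mem_Iio.2 (lt_trans (mem_Iio.1 hs.2) htm)⟩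
  have hU : J = ⋃ n : ℕ, J ∩ Iio (n : ℝ) := by
    rw [← inter_iUnion, eq_comm, inter_eq_left]
    exact fun s _ => mem_iUnion.2 (exists_nat_gt s)
  rw [hU, setLIntegral_iUnion_of_directed]
  · exact iSup_le hbd
  · refine Monotone.directed_le fun m n hmn => inter_subset_inter_right _ (Iio_subset_Iio ?_)
    exact_mod_cast hmn

lemma setLIntegral_le_two_mul_of_right {f : ℝ → ℝ≥0∞} {J : Set ℝ} (hf : ∫⁻ s in J, f s ≠ ∞)
    {B : ℝ≥0∞} (hB : ∀ t ∈ J, ∫⁻ s in J ∩ Ioi t, f s ≤ B) : ∫⁻ s in J, f s ≤ 2 * B := by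
  rcases eq_or_ne (∫⁻ s in J, f s) 0 with h0 | h0
  · rw [h0]; exact zero_le
  obtain ⟨m, h1, h2⟩ := exists_setLIntegral_median h0 hf
  obtain ⟨t, ht, htm⟩ : (J ∩ Iio m).Nonempty := by
    rcases (J ∩ Iio m).eq_empty_or_nonempty with he | he
    · rw [he] at h1; simp at h1; exact absurd h1 h0
    · exact he
  refine h2.trans ?_
  gcongr
  refine (lintegral_mono_set ?_).trans (hB t ht)
  exact fun s hs => ⟨hs.1, mem_Ioi.2 (lt_trans htm (mem_Ioi.1 hs.2))⟩

/-- The constant of the lower bounds by superposition. -/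
def lowerConst (p q : ℝ) : ℝ≥0∞ :=
  1 + (2 * 4 ^ (rExp p q / q) * 2 ^ rExp p q) ^ (1 / rExp p q)

lemma one_le_lowerConst (p q : ℝ) : 1 ≤ lowerConst p q := le_self_add

lemma lowerConst_ne_top (p q : ℝ) : lowerConst p q ≠ ∞ := by
  have h2 : (2 : ℝ≥0∞) ^ rExp p q ≠ 0 := (ENNReal.rpow_pos (by norm_num) (by simp)).ne'
  have h2' : (2 : ℝ≥0∞) ^ rExp p q ≠ ∞ := ENNReal.rpow_ne_top_of_ne_zero (by norm_num) (by simp)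
  have h4 : (4 : ℝ≥0∞) ^ (rExp p q / q) ≠ 0 := (ENNReal.rpow_pos (by norm_num) (by simp)).ne'
  have h4' : (4 : ℝ≥0∞) ^ (rExp p q / q) ≠ ∞ :=
    ENNReal.rpow_ne_top_of_ne_zero (by norm_num) (by simp)
  refine ENNReal.add_ne_top.2 ⟨ENNReal.one_ne_top, ENNReal.rpow_ne_top_of_ne_zero ?_ ?_⟩
  · simp [h2, h4]
  · exact ENNReal.mul_ne_top (ENNReal.mul_ne_top (by simp) h4') h2'

/-- Summation over the level sets of `G`, for `q < p`. On the level set of order `k` the function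
`Θ^{1/p'}` is at most `ϑ k`, and `T k` is the value of a test function that realizes `ϑ k / 2` on a
set of mass at least `2^(k-1)`. -/
lemma rpow_setLIntegral_le_of_lev {p q : ℝ} (hp : 1 < p) (hq : 1 < q) (hqp : q < p)
    {G f Θ : ℝ → ℝ≥0∞} (hG : Measurable G) (hGfin : ∀ t, 0 < t → G t ≠ ∞) {ϑ T : ℤ → ℝ≥0∞}
    (hϑ : ∀ k, (lev G k).Nonempty → ϑ k ≠ ∞)
    (hΘ : ∀ k, ∀ t ∈ lev G k, Θ t ^ (1 / conj p) ≤ ϑ k)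
    (hf : ∀ k, (lev G k).Nonempty → ∫⁻ t in lev G k, f t ≤ 2 * 2 ^ (k + 1))
    (hT : ∀ k, (lev G k).Nonempty → (ϑ k / 2) ^ q * 2 ^ (k - 1) ≤ T k) {B : ℝ≥0∞}
    (hB : ∑' k, T k ^ (rExp p q / q) ≤ B ^ rExp p q) :
    (∫⁻ t in Ioi 0, Θ t ^ (rExp p q / conj p) * G t ^ (rExp p q / p) * f t) ^ (1 / rExp p q)
      ≤ lowerConst p q * B := by
  have hq0 : 0 < q := zero_lt_one.trans hq
  have hp0 : 0 < p := zero_lt_one.trans hp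
  have hr := rExp_pos hq0 hqp
  have hrq : 0 < rExp p q / q := div_pos hr hq0
  have hrp : 0 < rExp p q / p := div_pos hr hp0
  have hk : ∀ k : ℤ, ((2 : ℝ≥0∞) ^ (k + 1)) ^ (rExp p q / p) *
      ∫⁻ t in lev G k, Θ t ^ (rExp p q / conj p) * f t ≤
      2 * 4 ^ (rExp p q / q) * 2 ^ rExp p q * T k ^ (rExp p q / q) := by
    intro k
    rcases (lev G k).eq_empty_or_nonempty with hemp | hne
    · simp [hemp]
    have hΘk : ∫⁻ t in lev G k, Θ t ^ (rExp p q / conj p) * f t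
        ≤ ϑ k ^ rExp p q * (2 * 2 ^ (k + 1)) := by
      calc ∫⁻ t in lev G k, Θ t ^ (rExp p q / conj p) * f t
          ≤ ∫⁻ t in lev G k, ϑ k ^ rExp p q * f t := by
            refine setLIntegral_mono' (measurableSet_lev hG k) fun t ht => ?_
            rw [show rExp p q / conj p = 1 / conj p * rExp p q by ring, ENNReal.rpow_mul]
            gcongr
            exact hΘ k t ht
        _ = ϑ k ^ rExp p q * ∫⁻ t in lev G k, f t :=
            lintegral_const_mul' _ _ (ENNReal.rpow_ne_top_of_nonneg hr.le (hϑ k hne))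
        _ ≤ _ := by gcongr; exact hf k hne
    calc ((2 : ℝ≥0∞) ^ (k + 1)) ^ (rExp p q / p) *
          ∫⁻ t in lev G k, Θ t ^ (rExp p q / conj p) * f t
        ≤ ((2 : ℝ≥0∞) ^ (k + 1)) ^ (rExp p q / p) * (ϑ k ^ rExp p q * (2 * 2 ^ (k + 1))) := by
          gcongr
      _ = 2 * ((2 : ℝ≥0∞) ^ (k + 1)) ^ (rExp p q / q) * ϑ k ^ rExp p q := by
          rw [rExp_div_q hq0 hqp, ENNReal.rpow_add_of_nonneg _ _ hrp.le zero_le_one,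
            ENNReal.rpow_one]; ring
      _ = 2 * 4 ^ (rExp p q / q) * 2 ^ rExp p q *
          ((ϑ k / 2) ^ q * 2 ^ (k - 1)) ^ (rExp p q / q) := by
          have e3 : (2 : ℝ≥0∞) ^ (k + 1) = 4 * 2 ^ (k - 1) := by
            rw [two_zpow_add_one, two_zpow_eq_sub_one]; ring
          have e4 : ϑ k = 2 * (ϑ k / 2) := (ENNReal.mul_div_cancel (by norm_num) (by norm_num)).symm
          have e5 : ϑ k ^ rExp p q = 2 ^ rExp p q * (ϑ k / 2) ^ rExp p q := by
            rw [← ENNReal.mul_rpow_of_nonneg _ _ hr.le, ← e4]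
          rw [e3, e5, ENNReal.mul_rpow_of_nonneg _ _ hrq.le, ENNReal.mul_rpow_of_nonneg _ _ hrq.le,
            ← ENNReal.rpow_mul (ϑ k / 2), mul_div_cancel₀ _ hq0.ne']
          ring
      _ ≤ _ := by gcongr; exact hT k hne
  have hsum := (setLIntegral_rpow_mul_le_tsum_lev (g := fun t => Θ t ^ (rExp p q / conj p) * f t)
    hG hGfin hrp volume).trans (ENNReal.tsum_le_tsum hk)
  rw [ENNReal.tsum_mul_left] at hsum
  have hre : ∀ t, Θ t ^ (rExp p q / conj p) * G t ^ (rExp p q / p) * f t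
      = G t ^ (rExp p q / p) * (Θ t ^ (rExp p q / conj p) * f t) := fun t => by ring
  simp_rw [hre]
  refine (ENNReal.rpow_le_rpow (hsum.trans (mul_le_mul_right hB _)) (by positivity)).trans ?_
  rw [ENNReal.mul_rpow_of_nonneg _ _ (by positivity), ← ENNReal.rpow_mul B,
    mul_one_div_cancel hr.ne', ENNReal.rpow_one]
  gcongr
  rw [lowerConst]; exact le_add_self

namespace Admissible

variable {p q : ℝ} {u : ℝ → ℝ≥0} {a v w : ℝ → ℝ≥0∞}

lemma setLIntegral_iterHardy_le_opNorm (H : Admissible p q u a v w) {h : ℝ → ℝ≥0∞}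
    (hh : AEMeasurable h (volume.restrict (Ioi 0))) (hE : energy p v h ≠ ∞) :
    ∫⁻ t in Ioi 0, iterHardy u a h t ^ q * w t
      ≤ opNorm p q u a v w ^ q * energy p v h ^ (q / p) := by
  have hp := H.p_pos
  have hq := H.q_pos
  rcases eq_or_ne (energy p v h) 0 with h0 | h0
  · have hae : ∀ᵐ x ∂(volume.restrict (Ioi 0)), h x = 0 := by
      have h1 := (lintegral_eq_zero_iff' ((hh.pow_const p).mul H.weight_v.aemeasurable)).1 h0
      filter_upwards [h1, H.ae_v] with x hx hvx
      rcases mul_eq_zero.1 hx with h2 | h2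
      · exact (ENNReal.rpow_eq_zero_iff_of_pos hp).1 h2
      · exact absurd h2 hvx.1
    have hprim : ∀ τ, prim h τ = 0 := fun τ => by
      have : prim h τ = ∫⁻ _ in Ioo 0 τ, 0 :=
        lintegral_congr_ae (ae_mono (Measure.restrict_mono Ioo_subset_Ioi_self le_rfl) hae)
      rw [this]; simp
    have hS : ∀ t, iterHardy u a h t = 0 := fun t => by
      have hF : ∀ t, supHardy u h t = 0 := fun t => by simp [supHardy, supFrom, hprim]
      simp [iterHardy, prim, hF]
    simp [hS, ENNReal.zero_rpow_of_pos hq]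
  · have hN : wNorm p v h = energy p v h ^ (1 / p) := rfl
    have h1 : wNorm q w (iterHardy u a h) / wNorm p v h ≤ opNorm p q u a v w :=
      le_iSup₂_of_le h hh le_rfl
    rw [hN, ENNReal.div_le_iff (ENNReal.rpow_pos (pos_iff_ne_zero.2 h0) hE).ne'
      (ENNReal.rpow_ne_top_of_ne_zero h0 hE)] at h1
    have h2 := ENNReal.rpow_le_rpow h1 hq.le
    rw [wNorm, ← ENNReal.rpow_mul, one_div_mul_cancel hq.ne', ENNReal.rpow_one,
      ENNReal.mul_rpow_of_nonneg _ _ hq.le, ← ENNReal.rpow_mul, div_mul_eq_mul_div, one_mul] at h2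
    exact h2

lemma setLIntegral_iterHardy_le_of_energy_le_one (H : Admissible p q u a v w) {h : ℝ → ℝ≥0∞}
    (hh : AEMeasurable h (volume.restrict (Ioi 0))) (hE : energy p v h ≤ 1) {J : Set ℝ}
    (hJ : J ⊆ Ioi 0) :
    ∫⁻ t in J, iterHardy u a h t ^ q * w t ≤ opNorm p q u a v w ^ q := by
  have hp := H.p_pos
  have hq := H.q_pos
  refine (lintegral_mono_set hJ).trans ((H.setLIntegral_iterHardy_le_opNorm hh
    (ne_top_of_le_ne_top ENNReal.one_ne_top hE)).trans ?_)
  exact mul_le_of_le_one_right zero_le (ENNReal.rpow_le_one hE (by positivity))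

lemma exists_normalized (H : Admissible p q u a v w) {h : ℝ → ℝ≥0∞}
    (hh : AEMeasurable h (volume.restrict (Ioi 0))) {E : ℝ≥0∞} (hE : energy p v h ≤ E)
    (h0 : E ≠ 0) (h1 : E ≠ ∞) :
    ∃ g : ℝ → ℝ≥0∞, AEMeasurable g (volume.restrict (Ioi 0)) ∧ energy p v g ≤ 1 ∧
      ∀ x, iterHardy u a g x = E ^ (-(1 / p)) * iterHardy u a h x := by
  have hp := H.p_pos
  have hc : E ^ (-(1 / p)) ≠ ∞ := ENNReal.rpow_ne_top_of_ne_zero h0 h1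
  refine ⟨fun y => E ^ (-(1 / p)) * h y, hh.const_mul _, ?_, iterHardy_const_mul hc⟩
  have : ∀ x, (E ^ (-(1 / p)) * h x) ^ p * v x = E⁻¹ * (h x ^ p * v x) := fun x => by
    rw [ENNReal.mul_rpow_of_nonneg _ _ hp.le, ← ENNReal.rpow_mul,
      show -(1 / p) * p = -1 by field_simp, ENNReal.rpow_neg_one, mul_assoc]
  simp_rw [energy, this]
  rw [lintegral_const_mul' _ _ (ENNReal.inv_ne_top.2 h0)]
  calc E⁻¹ * ∫⁻ x in Ioi 0, h x ^ p * v x ≤ E⁻¹ * E := by gcongr; exact hE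
    _ = 1 := ENNReal.inv_mul_cancel h0 h1

/-- Superposition of normalized test functions that act on disjoint sets. For `q < p` the test
function is `sup_k c_k h_k`, with the coefficients `c_k` for which Hölder's inequality for sequences
is an equality. -/
lemma seqNorm_le_opNorm (H : Admissible p q u a v w) {h : ℤ → ℝ → ℝ≥0∞}
    (hh : ∀ k, AEMeasurable (h k) (volume.restrict (Ioi 0))) (hE : ∀ k, energy p v (h k) ≤ 1)
    {J : ℤ → Set ℝ} (hJ : ∀ k, MeasurableSet (J k)) (hd : Pairwise (Function.onFun Disjoint J))
    (hJ0 : ∀ k, J k ⊆ Ioi 0) :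
    seqNorm p q (fun k => ∫⁻ t in J k, iterHardy u a (h k) t ^ q * w t)
      ≤ opNorm p q u a v w ^ q := by
  classical
  have hp := H.p_pos
  have hq := H.q_pos
  rcases le_or_gt p q with hpq | hpq
  · rw [seqNorm_of_le hpq]
    exact iSup_le fun k => H.setLIntegral_iterHardy_le_of_energy_le_one (hh k) (hE k) (hJ0 k)
  have hr := rExp_pos hq hpq
  rcases eq_or_ne (opNorm p q u a v w) ∞ with hN | hN
  · rw [hN, ENNReal.top_rpow_of_pos hq]; exact le_top
  set e : ℤ → ℝ≥0∞ := fun k => ∫⁻ t in J k, iterHardy u a (h k) t ^ q * w t with he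
  have hefin : ∀ k, e k ≠ ∞ := fun k => ne_top_of_le_ne_top
    (ENNReal.rpow_ne_top_of_nonneg hq.le hN)
    (H.setLIntegral_iterHardy_le_of_energy_le_one (hh k) (hE k) (hJ0 k))
  have hrq : 0 < rExp p q / q := div_pos hr hq
  refine seqNorm_le_of_lt hq hpq ?_
  rw [ENNReal.tsum_eq_iSup_sum]
  refine iSup_le fun s => ?_
  set E := ∑ k ∈ s, e k ^ (rExp p q / q) with hEdef
  have hEfin : E ≠ ∞ := ENNReal.sum_ne_top.2 fun k _ =>
    ENNReal.rpow_ne_top_of_nonneg hrq.le (hefin k)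
  set c : ℤ → ℝ≥0∞ := fun k => if k ∈ s then e k ^ (rExp p q / q / p) else 0 with hc
  have hcfin : ∀ k, c k ≠ ∞ := fun k => by
    simp only [hc]; split_ifs
    · exact ENNReal.rpow_ne_top_of_nonneg (by positivity) (hefin k)
    · exact ENNReal.zero_ne_top
  set g : ℝ → ℝ≥0∞ := fun x => ⨆ k, c k * h k x with hg
  have hgm : AEMeasurable g (volume.restrict (Ioi 0)) :=
    AEMeasurable.iSup fun k => (hh k).const_mul _
  have hsum : ∑' k, c k ^ p = E := by
    rw [tsum_eq_sum (s := s) fun k hk => by simp [hc, hk, ENNReal.zero_rpow_of_pos hp]]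
    refine Finset.sum_congr rfl fun k hk => ?_
    simp only [hc, if_pos hk]
    rw [← ENNReal.rpow_mul, div_mul_cancel₀ _ hp.ne']
  have hgE : energy p v g ≤ E := by
    have h1 : ∀ x, g x ^ p * v x ≤ ∑' k, c k ^ p * (h k x ^ p * v x) := fun x => by
      rw [hg, rpow_iSup hp, ENNReal.iSup_mul]
      refine iSup_le fun k => ?_
      rw [ENNReal.mul_rpow_of_nonneg _ _ hp.le, mul_assoc]
      exact ENNReal.le_tsum (f := fun k => c k ^ p * (h k x ^ p * v x)) k
    refine (lintegral_mono h1).trans ?_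
    have hmeas : ∀ k, AEMeasurable (fun x => c k ^ p * (h k x ^ p * v x))
        (volume.restrict (Ioi 0)) := fun k =>
      (((hh k).pow_const p).mul H.weight_v.aemeasurable).const_mul _
    rw [lintegral_tsum hmeas, ← hsum]
    refine ENNReal.tsum_le_tsum fun k => ?_
    rw [lintegral_const_mul' _ _ (ENNReal.rpow_ne_top_of_nonneg hp.le (hcfin k))]
    exact mul_le_of_le_one_right zero_le (hE k)
  have hlow : E ≤ ∫⁻ t in Ioi 0, iterHardy u a g t ^ q * w t := by
    refine le_trans ?_ (tsum_setLIntegral_le hJ hd (Ioi 0) hJ0 _ volume)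
    refine le_trans ?_ (ENNReal.sum_le_tsum s)
    refine Finset.sum_le_sum fun k hk => ?_
    have h2 : ∀ t, c k ^ q * (iterHardy u a (h k) t ^ q * w t) ≤ iterHardy u a g t ^ q * w t :=
      fun t => by
        rw [← mul_assoc, ← ENNReal.mul_rpow_of_nonneg _ _ hq.le, ← iterHardy_const_mul (hcfin k)]
        gcongr
        exact iterHardy_mono (fun x _ => le_iSup (fun k => c k * h k x) k) t
    refine le_trans (le_of_eq ?_) ((lintegral_const_mul_le _ _).trans (lintegral_mono h2))
    simp only [hc, if_pos hk]
    change _ = _ * e k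
    rw [← ENNReal.rpow_mul, rExp_div_q hq hpq, ENNReal.rpow_add_of_nonneg _ _ (by positivity)
      zero_le_one, ENNReal.rpow_one]
    congr 2
    have := rExp_div_q hq hpq
    rw [← this]; field_simp
  have hfinal := hlow.trans ((H.setLIntegral_iterHardy_le_opNorm hgm
    (ne_top_of_le_ne_top hEfin hgE)).trans (mul_le_mul_right
      (ENNReal.rpow_le_rpow hgE (show 0 ≤ q / p by positivity)) _))
  have h3 := rpow_le_of_le_mul_rpow (div_pos hq hr) (q_div_p_add_q_div_rExp hq) hEfin hfinal
  have h4 := ENNReal.rpow_le_rpow h3 hrq.le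
  rwa [← ENNReal.rpow_mul, div_mul_div_cancel₀ hr.ne', div_self hq.ne', ENNReal.rpow_one] at h4

/-- Test functions exist for every value below `Φ` only; half of `Φ` is such a value unless
`Φ = 0`. -/
lemma exists_half_test {Φ : ℝ≥0∞} (hΦ : Φ ≠ ∞) {P : (ℝ → ℝ≥0∞) → ℝ≥0∞ → Prop}
    (hP0 : ∃ h, P h 0) (hP : ∀ θ, θ < Φ → ∃ h, P h θ) : ∃ h, P h (Φ / 2) := by
  rcases eq_or_ne Φ 0 with rfl | h0
  · simpa using hP0
  · exact hP _ (ENNReal.half_lt_self h0 hΦ)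

/-- The lower bound for `condTail`: test functions with large values on the half-lines `[x,∞)`, at
the points where the tail of `w` is a power of `2`. -/
lemma condTail_le (H : Admissible p q u a v w) (hw : ∀ t, 0 < t → ∫⁻ y in Ioi t, w y ≠ ∞)
    {Θ : ℝ → ℝ≥0∞} (hΘ : MonotoneOn Θ (Ioi 0)) {K : ℝ≥0∞} (hK : K ≠ ∞)
    (htest : ∀ x, 0 < x → ∀ θ, θ < Θ x ^ (1 / conj p) → ∃ h : ℝ → ℝ≥0∞,
      AEMeasurable h (volume.restrict (Ioi 0)) ∧ energy p v h ≤ 1 ∧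
        ∀ y, x ≤ y → θ ≤ K * iterHardy u a h y) :
    condTail p q Θ w ≤ lowerConst p q * (K * opNorm p q u a v w) := by
  have hp := H.p_pos
  have hq := H.q_pos
  have hp' := H.conj_pos
  set N := opNorm p q u a v w with hN
  have hone : ∀ x, 0 < x → ∀ θ, θ < Θ x ^ (1 / conj p) →
      θ * (∫⁻ y in Ioi x, w y) ^ (1 / q) ≤ K * N := by
    intro x hx θ hθ
    obtain ⟨h, h1, h2, h3⟩ := htest x hx θ hθ
    have h4 : θ ^ q * ∫⁻ y in Ioi x, w y ≤ (K * N) ^ q := by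
      calc θ ^ q * ∫⁻ y in Ioi x, w y ≤ ∫⁻ y in Ioi x, θ ^ q * w y := lintegral_const_mul_le _ _
        _ ≤ ∫⁻ y in Ioi x, K ^ q * (iterHardy u a h y ^ q * w y) := by
            refine setLIntegral_mono' measurableSet_Ioi fun y hy => ?_
            rw [← mul_assoc, ← ENNReal.mul_rpow_of_nonneg _ _ hq.le]
            gcongr
            exact h3 y (le_of_lt hy)
        _ = K ^ q * ∫⁻ y in Ioi x, iterHardy u a h y ^ q * w y :=
            lintegral_const_mul' _ _ (ENNReal.rpow_ne_top_of_nonneg hq.le hK)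
        _ ≤ K ^ q * N ^ q := by
            gcongr
            exact H.setLIntegral_iterHardy_le_of_energy_le_one h1 h2 (Ioi_subset_Ioi hx.le)
        _ = _ := (ENNReal.mul_rpow_of_nonneg _ _ hq.le).symm
    have h5 := ENNReal.rpow_le_rpow h4 (show 0 ≤ 1 / q by positivity)
    rwa [ENNReal.mul_rpow_of_nonneg _ _ (by positivity), ← ENNReal.rpow_mul, ← ENNReal.rpow_mul,
      mul_one_div_cancel hq.ne', ENNReal.rpow_one, ENNReal.rpow_one] at h5
  -- the pointwise supremum also shows that `Θ` is finite where it is needed for `q < p`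
  have hsup : ∀ x, 0 < x → Θ x ^ (1 / conj p) * (∫⁻ y in Ioi x, w y) ^ (1 / q) ≤ K * N :=
    fun x hx => ENNReal.mul_le_of_forall_lt fun θ hθ b hb =>
      (mul_le_mul_right hb.le _).trans (hone x hx θ hθ)
  rcases le_or_gt p q with hpq | hpq
  · rw [condTail, if_pos hpq]
    exact (iSup₂_le hsup).trans (le_mul_of_one_le_left zero_le (one_le_lowerConst p q))
  have hr := rExp_pos hq hpq
  rcases eq_or_ne (K * N) ∞ with hNt | hNt
  · rw [hNt, ENNReal.mul_top (one_pos.trans_le (one_le_lowerConst p q)).ne']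
    exact le_top
  set W : ℝ → ℝ≥0∞ := fun t => ∫⁻ y in Ioi t, w y with hW
  have hWa : Antitone W := fun s t hst => lintegral_mono_set (Ioi_subset_Ioi hst)
  have hw0 : ∫⁻ y in Ioi 0, w y ≠ ∞ := by
    rw [setLIntegral_Ioi_eq_add zero_le_one]
    exact ENNReal.add_ne_top.2 ⟨(H.weight_w.lt_top 1 one_pos).ne, hw 1 one_pos⟩
  have hWc : ContinuousOn W (Ioi 0) := by
    intro x hx
    refine (continuousAt_of_le_add (l := 0) (r := x + 1) (g := w) ⟨hx, lt_add_one x⟩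
      (H.weight_w.lt_top _ (lt_trans hx (lt_add_one x))).ne ?_).continuousWithinAt
    intro s t _ hst _
    exact ⟨(setLIntegral_Ioi_eq_add hst).trans_le (add_comm _ _).le,
      (hWa hst).trans le_self_add⟩
  have hWlim : Tendsto W atTop (𝓝 0) := by
    have h2 := tendsto_atTop_iInf hWa
    have h3 : ⨅ t, W t = 0 := by
      have h4 : ∀ n : ℕ, (∫⁻ y in Ioo 0 (n : ℝ), w y) + ⨅ t, W t ≤ ∫⁻ y in Ioi 0, w y := fun n => by
        rw [setLIntegral_Ioi_eq_add (show (0 : ℝ) ≤ n by positivity)]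
        gcongr
        exact iInf_le W _
      have h5 : (∫⁻ y in Ioi 0, w y) + ⨅ t, W t ≤ (∫⁻ y in Ioi 0, w y) + 0 := by
        rw [add_zero]
        nth_rewrite 1 [iSup_setLIntegral_Ioo_nat w]
        rw [ENNReal.iSup_add]
        exact iSup_le h4
      exact le_antisymm ((ENNReal.add_le_add_iff_left hw0).1 h5) zero_le
    rwa [h3] at h2
  obtain ⟨b, hb⟩ := exists_lev_right (hWa.antitoneOn _) hWc hWlim
  have hWm : Measurable W := hWa.measurable
  have hΘfin : ∀ k, (lev W k).Nonempty → Θ (b k) ^ (1 / conj p) ≠ ∞ := fun k hk h => by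
    obtain ⟨b0, b1, -⟩ := hb k hk
    have h1 := hsup (b k) b0
    change _ * W (b k) ^ (1 / q) ≤ _ at h1
    rw [h, b1, ENNReal.top_mul (ENNReal.rpow_pos (two_zpow_pos k) (two_zpow_ne_top k)).ne'] at h1
    exact hNt (top_le_iff.1 h1)
  have hch : ∀ k, ∃ h : ℝ → ℝ≥0∞, AEMeasurable h (volume.restrict (Ioi 0)) ∧ energy p v h ≤ 1 ∧
      ((lev W k).Nonempty → ∀ y, b k ≤ y → Θ (b k) ^ (1 / conj p) / 2 ≤ K * iterHardy u a h y) := by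
    intro k
    have hz : AEMeasurable (fun _ : ℝ => (0 : ℝ≥0∞)) (volume.restrict (Ioi 0)) ∧
        energy p v (fun _ => 0) ≤ 1 :=
      ⟨aemeasurable_const, by simp [energy, ENNReal.zero_rpow_of_pos hp]⟩
    by_cases hk : (lev W k).Nonempty
    · obtain ⟨h, h1, h2, h3⟩ := exists_half_test (hΘfin k hk)
        (P := fun h θ => AEMeasurable h (volume.restrict (Ioi 0)) ∧ energy p v h ≤ 1 ∧
          ∀ y, b k ≤ y → θ ≤ K * iterHardy u a h y)
        ⟨fun _ => 0, hz.1, hz.2, fun _ _ => zero_le⟩ (htest (b k) (hb k hk).1)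
      exact ⟨h, h1, h2, fun _ => h3⟩
    · exact ⟨fun _ => 0, hz.1, hz.2, fun h => absurd h hk⟩
  choose h hh1 hh2 hh3 using hch
  have hseq := H.seqNorm_le_opNorm hh1 hh2 (J := fun k => lev W (k - 1))
    (fun k => measurableSet_lev hWm _)
    (fun i j hij => pairwise_disjoint_lev W (fun he => hij (by omega)))
    (fun k => lev_subset_Ioi W _)
  have hts := tsum_le_of_seqNorm_le hq hpq hseq
  have hrq : 0 < rExp p q / q := div_pos hr hq
  set T : ℤ → ℝ≥0∞ := fun k => ∫⁻ t in lev W (k - 1), iterHardy u a (h k) t ^ q * w t with hT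
  rw [condTail, if_neg (not_le.2 hpq)]
  refine rpow_setLIntegral_le_of_lev (G := W) (T := fun k => K ^ q * T k)
    (ϑ := fun k => Θ (b k) ^ (1 / conj p)) H.one_lt_p H.one_lt_q hpq hWm (fun t ht => hw t ht) hΘfin
    (fun k t ht => ?_) (fun k hne => ?_) (fun k hne => ?_) ?_
  · obtain ⟨b0, b1, b2, -⟩ := hb k ⟨t, ht⟩
    gcongr
    exact hΘ ht.1 b0 (b2 t ht)
  · refine setLIntegral_le_two_mul_of_right
      (ne_top_of_le_ne_top hw0 (lintegral_mono_set (lev_subset_Ioi W k))) fun t ht => ?_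
    exact (lintegral_mono_set inter_subset_right).trans ht.2.2.le
  · obtain ⟨b0, b1, b2, b3, b4, b5, b6⟩ := hb k hne
    have hw1 : (2 : ℝ≥0∞) ^ (k - 1) ≤ ∫⁻ t in lev W (k - 1), w t := by
      have h1 := setLIntegral_Ioi_eq_add (f := w) b4.le
      change W (b k) = _ + W (b (k - 1)) at h1
      rw [b1, b5, two_zpow_eq_sub_one, mul_two] at h1
      rw [(ENNReal.add_left_inj (two_zpow_ne_top _)).1 h1]
      exact lintegral_mono_set (Ioo_subset_Ioc_self.trans b6)
    calc (Θ (b k) ^ (1 / conj p) / 2) ^ q * 2 ^ (k - 1)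
        ≤ (Θ (b k) ^ (1 / conj p) / 2) ^ q * ∫⁻ t in lev W (k - 1), w t := by gcongr
      _ ≤ ∫⁻ t in lev W (k - 1), (Θ (b k) ^ (1 / conj p) / 2) ^ q * w t :=
          lintegral_const_mul_le _ _
      _ ≤ ∫⁻ t in lev W (k - 1), K ^ q * (iterHardy u a (h k) t ^ q * w t) := by
          refine setLIntegral_mono' (measurableSet_lev hWm _) fun y hy => ?_
          rw [← mul_assoc, ← ENNReal.mul_rpow_of_nonneg _ _ hq.le]
          gcongr
          refine hh3 k hne y (le_of_not_gt fun hlt => ?_)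
          have := hWa hlt.le
          rw [b1] at this
          have h2 := hy.2.2
          rw [sub_add_cancel] at h2
          exact absurd this (not_le.2 h2)
      _ = K ^ q * T k := lintegral_const_mul' _ _ (ENNReal.rpow_ne_top_of_nonneg hq.le hK)
  · have hre : ∀ k, (K ^ q * T k) ^ (rExp p q / q) = K ^ rExp p q * T k ^ (rExp p q / q) :=
      fun k => by
        rw [ENNReal.mul_rpow_of_nonneg _ _ hrq.le, ← ENNReal.rpow_mul K, mul_div_cancel₀ _ hq.ne']
    simp_rw [hre]
    rw [ENNReal.tsum_mul_left, ENNReal.mul_rpow_of_nonneg _ _ hr.le]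
    gcongr
    refine hts.trans (le_of_eq ?_)
    rw [← ENNReal.rpow_mul, mul_div_cancel₀ _ hq.ne']

end Admissible

/-! ### Lower bounds for the terms with `φ` -/

namespace Admissible

variable {p q : ℝ} {u : ℝ → ℝ≥0} {a v w : ℝ → ℝ≥0∞}

lemma aemeasurable_indicator_mul (H : Admissible p q u a v w) {E : Set ℝ} (hE : MeasurableSet E)
    {f : ℝ → ℝ≥0∞} (hf : AEMeasurable f (volume.restrict (Ioi 0))) :
    AEMeasurable (fun x => E.indicator (fun x => dualWeight p v x * f x) x)
      (volume.restrict (Ioi 0)) :=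
  (H.aemeasurable_dualWeight.mul hf).indicator hE

lemma energy_indicator_mul (H : Admissible p q u a v w) {E : Set ℝ} (hE : MeasurableSet E)
    (hE0 : E ⊆ Ioi 0) (f : ℝ → ℝ≥0∞) :
    energy p v (fun x => E.indicator (fun x => dualWeight p v x * f x) x)
      = ∫⁻ x in E, dualWeight p v x * f x ^ p := by
  rw [← H.lintegral_dualWeight_mul_rpow hE0, energy]
  have : ∀ x, E.indicator (fun x => dualWeight p v x * f x) x ^ p * v x
      = E.indicator (fun x => (dualWeight p v x * f x) ^ p * v x) x := fun x => by
    by_cases hx : x ∈ E <;> simp [hx, ENNReal.zero_rpow_of_pos H.p_pos]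
  simp_rw [this]
  rw [setLIntegral_indicator hE, inter_eq_left.2 hE0]

lemma phi_rpow (H : Admissible p q u a v w) (t : ℝ) :
    phi p u v t ^ (1 / conj p)
      = supFrom (fun τ => (u τ : ℝ≥0∞) * prim (dualWeight p v) τ ^ (1 / conj p)) t := by
  have hp' := H.conj_pos
  rw [phi, supFrom, supFrom, rpow_biSup (by positivity)]
  refine iSup_congr fun τ => iSup_congr fun _ => ?_
  rw [ENNReal.mul_rpow_of_nonneg _ _ (by positivity), ← ENNReal.rpow_mul,
    mul_one_div_cancel hp'.ne', ENNReal.rpow_one]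

/-- A multiple of `v^{1-p'}` on `(0,τ)`, with `τ ≥ x` for which `u(τ)^{p'} ∫_0^τ v^{1-p'}` is close
to `φ(x)`. -/
lemma exists_phi_test (H : Admissible p q u a v w) {x : ℝ} (hx : 0 < x) {θ : ℝ≥0∞}
    (hθ : θ < phi p u v x ^ (1 / conj p)) : ∃ h : ℝ → ℝ≥0∞,
      AEMeasurable h (volume.restrict (Ioi 0)) ∧ energy p v h ≤ 1 ∧
        ∀ y, y ≤ x → θ * prim a y ≤ iterHardy u a h y := by
  have hp := H.p_pos
  rw [H.phi_rpow, supFrom] at hθ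
  obtain ⟨τ, hτ⟩ := lt_iSup_iff.1 hθ
  obtain ⟨hxτ, hθτ⟩ := lt_iSup_iff.1 hτ
  have hτ0 : 0 < τ := hx.trans_le hxτ
  set V := prim (dualWeight p v) τ with hV
  have hV0 : V ≠ 0 := (H.dual τ hτ0).1.ne'
  have hV1 : V ≠ ∞ := (H.dual τ hτ0).2.ne
  refine ⟨fun x => (Ioo 0 τ).indicator (fun x => dualWeight p v x * V ^ (-(1 / p))) x,
    H.aemeasurable_indicator_mul measurableSet_Ioo aemeasurable_const, ?_, fun y hy => ?_⟩
  · rw [H.energy_indicator_mul measurableSet_Ioo Ioo_subset_Ioi_self, ← ENNReal.rpow_mul,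
      show -(1 / p) * p = -1 by field_simp, ENNReal.rpow_neg_one,
      lintegral_mul_const' _ _ (ENNReal.inv_ne_top.2 hV0)]
    exact (ENNReal.mul_inv_cancel hV0 hV1).le
  · refine (lintegral_const_mul_le _ _).trans (setLIntegral_mono' measurableSet_Ioo fun t ht => ?_)
    gcongr
    refine le_trans ?_ (le_supFrom _ ((ht.2.le.trans hy).trans hxτ))
    refine hθτ.le.trans (le_of_eq ?_)
    congr 1
    rw [prim, setLIntegral_indicator measurableSet_Ioo, inter_self,
      lintegral_mul_const' _ _ (ENNReal.rpow_ne_top_of_ne_zero hV0 hV1)]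
    change _ = V * _
    nth_rewrite 2 [← ENNReal.rpow_one V]
    rw [← ENNReal.rpow_add _ _ hV0 hV1]
    congr 1
    have := (holderConjugate_conj H.one_lt_p).inv_add_inv_eq_one
    rw [one_div, one_div]; linarith

lemma phi_rpow_mul_massA_le (H : Admissible p q u a v w) {x : ℝ} (hx : 0 < x) :
    phi p u v x ^ (1 / conj p) * massA q a w (Ioo 0 x) ^ (1 / q) ≤ opNorm p q u a v w := by
  have hq := H.q_pos
  refine ENNReal.mul_le_of_forall_lt fun θ hθ b hb => (mul_le_mul_right hb.le _).trans ?_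
  obtain ⟨h, h1, h2, h3⟩ := H.exists_phi_test hx hθ
  have h4 : θ ^ q * massA q a w (Ioo 0 x) ≤ opNorm p q u a v w ^ q := by
    calc θ ^ q * massA q a w (Ioo 0 x)
        ≤ ∫⁻ y in Ioo 0 x, θ ^ q * (prim a y ^ q * w y) := lintegral_const_mul_le _ _
      _ ≤ ∫⁻ y in Ioo 0 x, iterHardy u a h y ^ q * w y := by
          refine setLIntegral_mono' measurableSet_Ioo fun y hy => ?_
          rw [← mul_assoc, ← ENNReal.mul_rpow_of_nonneg _ _ hq.le]
          gcongr
          exact h3 y hy.2.le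
      _ ≤ _ := H.setLIntegral_iterHardy_le_of_energy_le_one h1 h2 Ioo_subset_Ioi_self
  have h5 := ENNReal.rpow_le_rpow h4 (show 0 ≤ 1 / q by positivity)
  rwa [ENNReal.mul_rpow_of_nonneg _ _ (by positivity), ← ENNReal.rpow_mul, ← ENNReal.rpow_mul,
    mul_one_div_cancel hq.ne', ENNReal.rpow_one, ENNReal.rpow_one] at h5

lemma phi_ne_top_of_opNorm (H : Admissible p q u a v w) (hN : opNorm p q u a v w ≠ ∞) {x : ℝ}
    (hx : 0 < x) : phi p u v x ≠ ∞ := fun h => by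
  have h1 := H.phi_rpow_mul_massA_le hx
  have hq := H.q_pos
  rw [h, ENNReal.top_rpow_of_pos (one_div_pos.2 H.conj_pos), ENNReal.top_mul
    (ENNReal.rpow_pos_of_nonneg (H.massA_pos hx) (by positivity)).ne'] at h1
  exact hN (top_le_iff.1 h1)

lemma termLim_le (H : Admissible p q u a v w) : termLim p q u a v w ≤ opNorm p q u a v w := by
  have hq := H.q_pos
  have hp' := H.conj_pos
  rw [← ENNReal.rpow_le_rpow_iff hq, H.termLim_rpow, massA, iSup_setLIntegral_Ioo_nat,
    ENNReal.iSup_mul]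
  refine iSup_le fun n => ?_
  rcases Nat.eq_zero_or_pos n with rfl | hn
  · simp
  have hn' : (0 : ℝ) < n := by exact_mod_cast hn
  refine le_trans ?_ (ENNReal.rpow_le_rpow (H.phi_rpow_mul_massA_le hn') hq.le)
  rw [ENNReal.mul_rpow_of_nonneg _ _ hq.le, ← ENNReal.rpow_mul, ← ENNReal.rpow_mul,
    one_div_mul_cancel hq.ne', ENNReal.rpow_one, div_mul_eq_mul_div, one_mul, mul_comm]
  gcongr
  · exact iInf_le _ _
  · exact le_rfl

/-- The lower bound for `condHead`: test functions with large values of `T_u h` on the intervals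
`(0,x]`, at the points where the primitive of `A^q w` is a power of `2`. -/
lemma condHead_le (H : Admissible p q u a v w) :
    condHead p q (phi p u v) (fun y => prim a y ^ q * w y)
      ≤ lowerConst p q * opNorm p q u a v w := by
  have hp := H.p_pos
  have hq := H.q_pos
  have hp' := H.conj_pos
  rcases le_or_gt p q with hpq | hpq
  · rw [condHead, if_pos hpq]
    refine (iSup₂_le fun x hx => ?_).trans
      (le_mul_of_one_le_left zero_le (one_le_lowerConst p q))
    exact H.phi_rpow_mul_massA_le hx
  have hr := rExp_pos hq hpq
  rcases eq_or_ne (opNorm p q u a v w) ∞ with hNt | hNt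
  · rw [hNt, ENNReal.mul_top (one_pos.trans_le (one_le_lowerConst p q)).ne']
    exact le_top
  set f : ℝ → ℝ≥0∞ := fun y => prim a y ^ q * w y with hf
  have hfin : ∀ x, 0 < x → prim f x ≠ ∞ := fun x hx => H.prim_massA_ne_top hx
  set G := prim f with hG
  obtain ⟨b, hb⟩ := exists_lev_left (f := G) ((prim_mono f).monotoneOn _) (continuousOn_prim hfin)
    (tendsto_prim_zero (hfin 1 one_pos))
  have hGm : Measurable G := measurable_prim f
  have hϑ : ∀ k, (lev G k).Nonempty → phi p u v (b k) ^ (1 / conj p) ≠ ∞ := fun k hk =>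
    ENNReal.rpow_ne_top_of_nonneg (by positivity) (H.phi_ne_top_of_opNorm hNt (hb k hk).1)
  have hch : ∀ k, ∃ h : ℝ → ℝ≥0∞, AEMeasurable h (volume.restrict (Ioi 0)) ∧ energy p v h ≤ 1 ∧
      ((lev G k).Nonempty → ∀ y, y ≤ b k →
        phi p u v (b k) ^ (1 / conj p) / 2 * prim a y ≤ iterHardy u a h y) := by
    intro k
    have hz : AEMeasurable (fun _ : ℝ => (0 : ℝ≥0∞)) (volume.restrict (Ioi 0)) ∧
        energy p v (fun _ => 0) ≤ 1 :=
      ⟨aemeasurable_const, by simp [energy, ENNReal.zero_rpow_of_pos hp]⟩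
    by_cases hk : (lev G k).Nonempty
    · obtain ⟨h, h1, h2, h3⟩ := exists_half_test (hϑ k hk)
        (P := fun h θ => AEMeasurable h (volume.restrict (Ioi 0)) ∧ energy p v h ≤ 1 ∧
          ∀ y, y ≤ b k → θ * prim a y ≤ iterHardy u a h y)
        ⟨fun _ => 0, hz.1, hz.2, fun _ _ => by simp⟩
        fun θ hθ => H.exists_phi_test (hb k hk).1 hθ
      exact ⟨h, h1, h2, fun _ => h3⟩
    · exact ⟨fun _ => 0, hz.1, hz.2, fun h => absurd h hk⟩
  choose h hh1 hh2 hh3 using hch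
  have hseq := H.seqNorm_le_opNorm hh1 hh2 (J := fun k => lev G (k - 1))
    (fun k => measurableSet_lev hGm _)
    (fun i j hij => pairwise_disjoint_lev G (fun he => hij (by omega)))
    (fun k => lev_subset_Ioi G _)
  have hts := tsum_le_of_seqNorm_le hq hpq hseq
  rw [condHead, if_neg (not_le.2 hpq)]
  refine rpow_setLIntegral_le_of_lev (G := G) (f := f)
    (T := fun k => ∫⁻ t in lev G (k - 1), iterHardy u a (h k) t ^ q * w t)
    (ϑ := fun k => phi p u v (b k) ^ (1 / conj p)) H.one_lt_p H.one_lt_q hpq hGm hfin hϑ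
    (fun k t ht => ?_) (fun k hne => ?_) (fun k hne => ?_) ?_
  · obtain ⟨b0, b1, b2, -⟩ := hb k ⟨t, ht⟩
    gcongr
    exact phi_antitone (b2 t ht)
  · refine setLIntegral_le_two_mul_of_left hfin (lev_subset_Ioi G k) fun t ht => ?_
    have hsub : lev G k ∩ Iio t ⊆ Ioo 0 t := fun s hs => ⟨hs.1.1, hs.2⟩
    exact (lintegral_mono_set hsub).trans ht.2.2.le
  · obtain ⟨b0, b1, b2, b3, b4, b5, b6⟩ := hb k hne
    have hw1 : (2 : ℝ≥0∞) ^ (k - 1) ≤ ∫⁻ t in lev G (k - 1), f t := by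
      have h1 := prim_eq_add (f := f) b3.le b4.le
      change G (b k) = G (b (k - 1)) + _ at h1
      rw [b1, b5, two_zpow_eq_sub_one, mul_two] at h1
      rw [(ENNReal.add_right_inj (two_zpow_ne_top _)).1 h1]
      exact lintegral_mono_set (Ioo_subset_Ico_self.trans b6)
    calc (phi p u v (b k) ^ (1 / conj p) / 2) ^ q * 2 ^ (k - 1)
        ≤ (phi p u v (b k) ^ (1 / conj p) / 2) ^ q * ∫⁻ t in lev G (k - 1), f t := by gcongr
      _ ≤ ∫⁻ t in lev G (k - 1), (phi p u v (b k) ^ (1 / conj p) / 2) ^ q * f t :=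
          lintegral_const_mul_le _ _
      _ ≤ ∫⁻ t in lev G (k - 1), iterHardy u a (h k) t ^ q * w t := by
          refine setLIntegral_mono' (measurableSet_lev hGm _) fun y hy => ?_
          rw [hf, ← mul_assoc, ← ENNReal.mul_rpow_of_nonneg _ _ hq.le]
          gcongr
          refine hh3 k hne y (le_of_not_gt fun hlt => ?_)
          have := prim_mono f hlt.le
          change G (b k) ≤ G y at this
          rw [b1] at this
          have h2 := hy.2.2
          rw [sub_add_cancel] at h2
          exact absurd this (not_le.2 h2)
  · refine hts.trans (le_of_eq ?_)
    rw [← ENNReal.rpow_mul, mul_div_cancel₀ _ hq.ne']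

lemma condHead_mono (H : Admissible p q u a v w) {Ψ Φ f : ℝ → ℝ≥0∞}
    (h : ∀ x, 0 < x → Ψ x ≤ Φ x) : condHead p q Ψ f ≤ condHead p q Φ f := by
  have hp := H.p_pos
  have hq := H.q_pos
  have hp' := H.conj_pos
  rw [condHead, condHead]
  split_ifs with hpq
  · exact iSup₂_mono fun x hx => by gcongr; exact h x hx
  · have hr := rExp_pos hq (not_le.1 hpq)
    refine ENNReal.rpow_le_rpow (setLIntegral_mono' measurableSet_Ioi fun x hx => ?_)
      (by positivity)
    gcongr
    exact h x hx

/-- For the test function `v^{1-p'}` on `(0,1)` the image is bounded below on `(1,∞)`, so that the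
norm is infinite if `w` is not integrable at infinity. -/
lemma setLIntegral_Ioi_ne_top_of_opNorm (H : Admissible p q u a v w)
    (hN : opNorm p q u a v w ≠ ∞) {t : ℝ} (ht : 0 < t) : ∫⁻ y in Ioi t, w y ≠ ∞ := fun hW => by
  have hq := H.q_pos
  have hp := H.p_pos
  have hW1 := H.tail_eq_top ht hW one_pos
  obtain ⟨y, s, hy, hys, hs1, hU, ha⟩ := H.exists_supTail_pos
  set h : ℝ → ℝ≥0∞ := fun x => (Ioo 0 1).indicator (fun x => dualWeight p v x * 1) x with hh
  have hm : AEMeasurable h (volume.restrict (Ioi 0)) :=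
    H.aemeasurable_indicator_mul measurableSet_Ioo aemeasurable_const
  have hE : energy p v h ≠ ∞ := by
    rw [hh, H.energy_indicator_mul measurableSet_Ioo Ioo_subset_Ioi_self]
    simpa [prim] using (H.dual 1 one_pos).2.ne
  have hhy : prim h y = prim (dualWeight p v) y := by
    refine setLIntegral_congr_fun measurableSet_Ioo fun x hx => ?_
    simp [hh, hx.1, hx.2.trans (hys.trans hs1)]
  have hc : ∀ z, 1 < z → prim (dualWeight p v) y * (supTail u s * ∫⁻ t in Ioo y s, a t)
      ≤ iterHardy u a h z := fun z hz => by
    rw [← mul_assoc]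
    refine (lintegral_const_mul_le _ _).trans ?_
    refine (setLIntegral_mono' measurableSet_Ioo fun t ht => ?_).trans
      (lintegral_mono_set (Ioo_subset_Ioo hy.le (hs1.trans hz).le))
    gcongr
    refine le_trans ?_ (supTail_mul_prim_le u h t)
    rw [← hhy, mul_comm]
    gcongr
    · exact supTail_antitone u ht.2.le
    · exact prim_mono h ht.1.le
  set c := prim (dualWeight p v) y * (supTail u s * ∫⁻ t in Ioo y s, a t) with hcdef
  have hc0 : 0 < c := ENNReal.mul_pos (H.dual y hy).1.ne' (ENNReal.mul_pos hU.ne' ha.ne').ne'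
  have h1 := H.setLIntegral_iterHardy_le_opNorm hm hE
  have h2 : ∞ ≤ ∫⁻ t in Ioi 0, iterHardy u a h t ^ q * w t := by
    calc ∞ = c ^ q * ∫⁻ y in Ioi 1, w y := by
          rw [hW1, ENNReal.mul_top (ENNReal.rpow_pos_of_nonneg hc0 hq.le).ne']
      _ ≤ ∫⁻ y in Ioi 1, c ^ q * w y := lintegral_const_mul_le _ _
      _ ≤ ∫⁻ y in Ioi 1, iterHardy u a h y ^ q * w y :=
          setLIntegral_mono' measurableSet_Ioi fun z hz => by gcongr; exact hc z hz
      _ ≤ _ := lintegral_mono_set (Ioi_subset_Ioi zero_le_one)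
  have h3 := top_le_iff.1 (h2.trans h1)
  exact ENNReal.mul_ne_top (ENNReal.rpow_ne_top_of_nonneg hq.le hN)
    (ENNReal.rpow_ne_top_of_nonneg (by positivity) hE) h3

end Admissible

/-! ### Lower bounds for the terms with the tails of `w` -/

namespace Admissible

variable {p q : ℝ} {u : ℝ → ℝ≥0} {a v w : ℝ → ℝ≥0∞}

/-- The iterated operator dominates the integral operator with kernel `k`. -/
lemma setLIntegral_mul_kern_le (H : Admissible p q u a v w) {h : ℝ → ℝ≥0∞}
    (hh : AEMeasurable h (volume.restrict (Ioi 0))) (y : ℝ) :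
    ∫⁻ s in Ioo 0 y, h s * kern u a s y ≤ iterHardy u a h y := by
  have hμ := Measure.restrict_mono (show Ioo 0 y ⊆ Ioi 0 from Ioo_subset_Ioi_self)
    (le_refl (volume : Measure ℝ))
  have e := setLIntegral_Ioo_swap (x := 0) (y := y) (f := fun t => supTail u t * a t) (h := h)
    (H.aemeasurable_supTail_mul.mono_measure hμ) (hh.mono_measure hμ)
  refine (le_of_eq e.symm).trans (lintegral_mono fun t => ?_)
  refine (le_of_eq ?_).trans (mul_le_mul_left (supTail_mul_prim_le u h t) (a t))
  change _ * _ * prim h t = _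
  ring

/-- Normalization of a test function whose energy and whose image are both comparable to `Q`. -/
lemma exists_test_of_energy_le (H : Admissible p q u a v w) {h : ℝ → ℝ≥0∞}
    (hh : AEMeasurable h (volume.restrict (Ioi 0))) {D Q : ℝ≥0∞} (hD0 : D ≠ 0) (hD1 : D ≠ ∞)
    (hQ0 : Q ≠ 0) (hQ1 : Q ≠ ∞) (hE : energy p v h ≤ D * Q) {x : ℝ}
    (hS : ∀ y, x ≤ y → Q ≤ D * iterHardy u a h y) :
    ∃ g : ℝ → ℝ≥0∞, AEMeasurable g (volume.restrict (Ioi 0)) ∧ energy p v g ≤ 1 ∧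
      ∀ y, x ≤ y → Q ^ (1 / conj p) ≤ D ^ (1 / p) * D * iterHardy u a g y := by
  have hp := H.p_pos
  obtain ⟨g, h1, h2, h3⟩ := H.exists_normalized hh hE (mul_ne_zero hD0 hQ0)
    (ENNReal.mul_ne_top hD1 hQ1)
  refine ⟨g, h1, h2, fun y hy => ?_⟩
  have hexp : 1 / conj p = -(1 / p) + 1 := by
    have := (holderConjugate_conj H.one_lt_p).inv_add_inv_eq_one
    rw [one_div, one_div]; linarith
  have hDD : D ^ (1 / p) * D ^ (-(1 / p)) = 1 := by
    rw [← ENNReal.rpow_add _ _ hD0 hD1, add_neg_cancel, ENNReal.rpow_zero]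
  rw [h3, hexp, ENNReal.rpow_add _ _ hQ0 hQ1, ENNReal.rpow_one,
    ENNReal.mul_rpow_of_ne_zero hD0 hQ0]
  calc Q ^ (-(1 / p)) * Q ≤ Q ^ (-(1 / p)) * (D * iterHardy u a h y) := by
        gcongr; exact hS y hy
    _ = (D ^ (1 / p) * D ^ (-(1 / p))) * (Q ^ (-(1 / p)) * (D * iterHardy u a h y)) := by
        rw [hDD, one_mul]
    _ = _ := by ring

lemma kern_ne_top (H : Admissible p q u a v w) (hφ : ∀ t, 0 < t → phi p u v t ≠ ∞) {x y : ℝ}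
    (hx : 0 < x) (hy : 0 < y) : kern u a x y ≠ ∞ := by
  have hU := H.supTail_ne_top hx (hφ x hx)
  have h1 : kern u a x y ≤ supTail u x * prim a y := by
    rw [prim, ← lintegral_const_mul' _ _ hU]
    refine (setLIntegral_mono' measurableSet_Ioo fun s hs => ?_).trans
      (lintegral_mono_set (Ioo_subset_Ioo_left hx.le))
    gcongr
    exact supTail_antitone u hs.1.le
  exact ne_top_of_le_ne_top (ENNReal.mul_ne_top hU (H.prim_a_ne_top hy)) h1

/-- The extremal function of Hölder's inequality for `∫_0^x k(·,x) h`, truncated near `0`. -/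
lemma exists_kernPow_test (H : Admissible p q u a v w) (hφ : ∀ t, 0 < t → phi p u v t ≠ ∞) {x : ℝ}
    (hx : 0 < x) {θ : ℝ≥0∞} (hθ : θ < kernPow p u a v x ^ (1 / conj p)) :
    ∃ h : ℝ → ℝ≥0∞, AEMeasurable h (volume.restrict (Ioi 0)) ∧ energy p v h ≤ 1 ∧
      ∀ y, x ≤ y → θ ≤ 1 * iterHardy u a h y := by
  have hp' := H.conj_pos
  have hp1 := one_lt_conj H.one_lt_p
  set f : ℝ → ℝ≥0∞ := fun s => dualWeight p v s * kern u a s x ^ conj p with hf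
  have hE : Ioo 0 x = ⋃ n : ℕ, Ioo (1 / ((n : ℝ) + 1)) x := by
    ext s; simp only [mem_Ioo, mem_iUnion]
    refine ⟨fun h => ?_, fun ⟨n, h1, h2⟩ => ⟨lt_trans (by positivity) h1, h2⟩⟩
    obtain ⟨n, hn⟩ := exists_nat_one_div_lt h.1
    exact ⟨n, hn, h.2⟩
  have hsup : kernPow p u a v x = ⨆ n : ℕ, ∫⁻ s in Ioo (1 / ((n : ℝ) + 1)) x, f s := by
    rw [kernPow, hE, setLIntegral_iUnion_of_directed]
    exact Monotone.directed_le fun m n hmn =>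
      Ioo_subset_Ioo_left (one_div_le_one_div_of_le (by positivity) (by gcongr))
  rw [hsup, rpow_iSup (by positivity)] at hθ
  obtain ⟨n, hn⟩ := lt_iSup_iff.1 hθ
  set ε : ℝ := 1 / ((n : ℝ) + 1) with hε
  have hε0 : 0 < ε := by positivity
  set Q := ∫⁻ s in Ioo ε x, f s with hQ
  have hsub : Ioo ε x ⊆ Ioi 0 := fun s hs => hε0.trans hs.1
  have hQ0 : Q ≠ 0 := fun h => by
    rw [h, ENNReal.zero_rpow_of_pos (by positivity)] at hn
    exact not_lt_zero hn
  have hc : kern u a ε x ^ conj p ≠ ∞ :=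
    ENNReal.rpow_ne_top_of_nonneg hp'.le (H.kern_ne_top hφ hε0 hx)
  have hQ1 : Q ≠ ∞ := by
    refine ne_top_of_le_ne_top (ENNReal.mul_ne_top (H.dual x hx).2.ne hc) ?_
    rw [prim, ← lintegral_mul_const' _ _ hc]
    refine (setLIntegral_mono' measurableSet_Ioo fun s hs => ?_).trans
      (lintegral_mono_set (Ioo_subset_Ioo_left hε0.le))
    rw [hf]
    dsimp only
    gcongr
    exact kern_antitone_left u a x hs.1.le
  have hkm : AEMeasurable (fun s => kern u a s x ^ (conj p - 1)) (volume.restrict (Ioi 0)) :=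
    (kern_antitone_left u a x).measurable.aemeasurable.pow_const _
  have hm := H.aemeasurable_indicator_mul (measurableSet_Ioo (a := ε) (b := x)) hkm
  have hE' : energy p v (fun s => (Ioo ε x).indicator
      (fun s => dualWeight p v s * kern u a s x ^ (conj p - 1)) s) ≤ 1 * Q := by
    rw [H.energy_indicator_mul measurableSet_Ioo hsub, one_mul]
    refine le_of_eq (lintegral_congr fun s => ?_)
    rw [← ENNReal.rpow_mul, mul_comm _ p, H.conj_mul_sub_one]
  have hS : ∀ y, x ≤ y → Q ≤ 1 * iterHardy u a (fun s => (Ioo ε x).indicator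
      (fun s => dualWeight p v s * kern u a s x ^ (conj p - 1)) s) y := by
    intro y hy
    rw [one_mul]
    refine le_trans ?_ (H.setLIntegral_mul_kern_le hm y)
    calc Q ≤ ∫⁻ s in Ioo ε x, (dualWeight p v s * kern u a s x ^ (conj p - 1)) * kern u a s y := by
          refine lintegral_mono fun s => ?_
          have : kern u a s x ^ conj p = kern u a s x ^ (conj p - 1) * kern u a s x := by
            nth_rewrite 3 [← ENNReal.rpow_one (kern u a s x)]
            rw [← ENNReal.rpow_add_of_nonneg _ _ (by linarith) zero_le_one, sub_add_cancel]
          rw [hf]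
          dsimp only
          rw [this, ← mul_assoc]
          gcongr
          exact kern_mono_right u a s hy
      _ = ∫⁻ s in Ioo ε x, (Ioo ε x).indicator
            (fun r => dualWeight p v r * kern u a r x ^ (conj p - 1)) s * kern u a s y := by
          refine setLIntegral_congr_fun measurableSet_Ioo fun s hs => ?_
          simp only [indicator_of_mem hs]
      _ ≤ _ := lintegral_mono_set (Ioo_subset_Ioo hε0.le hy)
  obtain ⟨g, g1, g2, g3⟩ := H.exists_test_of_energy_le hm one_ne_zero ENNReal.one_ne_top hQ0 hQ1
    hE' hS
  exact ⟨g, g1, g2, fun y hy => hn.le.trans (by simpa using g3 y hy)⟩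

/-- A multiple `m` of `v^{1-p'}` on `(0,τ)`, `τ ≥ t`, for which `u(τ)^{p'} ∫_0^τ v^{1-p'}` is at
least one half of `φ(t)`. -/
lemma exists_phi_block (H : Admissible p q u a v w) {t : ℝ} (ht : 0 < t)
    (hφ : phi p u v t ≠ ∞) {c : ℝ≥0∞} (hc : c ≠ ∞) :
    ∃ τ m, t ≤ τ ∧ m ≠ ∞ ∧ phi p u v t * c ≤ u τ * (m * prim (dualWeight p v) τ) ∧
      m ^ p * prim (dualWeight p v) τ ≤ 2 ^ (p - 1) * (phi p u v t * c ^ p) := by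
  have hp := H.p_pos
  have hp1 : 0 < p - 1 := by linarith [H.one_lt_p]
  have hp' := H.conj_pos
  rcases eq_or_ne (phi p u v t) 0 with h0 | h0
  · exact ⟨t, 0, le_rfl, ENNReal.zero_ne_top, by simp [h0],
      by simp [h0, ENNReal.zero_rpow_of_pos hp]⟩
  set Φ := phi p u v t with hΦ
  obtain ⟨τ, hτ⟩ := lt_iSup_iff.1 (ENNReal.half_lt_self h0 hφ)
  obtain ⟨htτ, hlt⟩ := lt_iSup_iff.1 hτ
  change Φ / 2 < (u τ : ℝ≥0∞) ^ conj p * prim (dualWeight p v) τ at hlt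
  set V := prim (dualWeight p v) τ with hV
  have hV0 : V ≠ 0 := (H.dual τ (ht.trans_le htτ)).1.ne'
  have hV1 : V ≠ ∞ := (H.dual τ (ht.trans_le htτ)).2.ne
  have hu0 : (u τ : ℝ≥0∞) ≠ 0 := fun h => by
    rw [h, ENNReal.zero_rpow_of_pos hp', zero_mul] at hlt
    exact not_lt_zero hlt
  set U : ℝ≥0∞ := (u τ : ℝ≥0∞) with hU
  have hU1 : U ≠ ∞ := ENNReal.coe_ne_top
  have hUV0 : U * V ≠ 0 := mul_ne_zero hu0 hV0
  have hUV1 : U * V ≠ ∞ := ENNReal.mul_ne_top hU1 hV1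
  refine ⟨τ, Φ * c / (U * V), htτ, ?_, ?_, ?_⟩
  · exact ENNReal.div_ne_top (ENNReal.mul_ne_top hφ hc) hUV0
  · rw [mul_left_comm, ENNReal.div_mul_cancel hUV0 hUV1]
  · have e1 : p / (p - 1) = conj p := by rw [conj, Real.conjExponent]
    have e2 : (U ^ conj p * V) ^ (p - 1) * V = (U * V) ^ p := by
      rw [ENNReal.mul_rpow_of_nonneg _ _ hp1.le, ← ENNReal.rpow_mul, ← e1,
        div_mul_cancel₀ _ hp1.ne', ENNReal.mul_rpow_of_nonneg _ _ hp.le, mul_assoc]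
      congr 1
      nth_rewrite 2 [← ENNReal.rpow_one V]
      rw [← ENNReal.rpow_add_of_nonneg _ _ hp1.le zero_le_one, sub_add_cancel]
    have e3 : Φ ^ p = Φ ^ (p - 1) * Φ := by
      nth_rewrite 3 [← ENNReal.rpow_one Φ]
      rw [← ENNReal.rpow_add_of_nonneg _ _ hp1.le zero_le_one, sub_add_cancel]
    have e4 : Φ ^ (p - 1) ≤ 2 ^ (p - 1) * (U ^ conj p * V) ^ (p - 1) := by
      rw [← ENNReal.mul_rpow_of_nonneg _ _ hp1.le]
      refine ENNReal.rpow_le_rpow ?_ hp1.le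
      rw [mul_comm, ← ENNReal.div_le_iff (by norm_num) (by norm_num)]
      exact hlt.le
    have hP0 : (U * V) ^ p ≠ 0 := (ENNReal.rpow_pos (pos_iff_ne_zero.2 hUV0) hUV1).ne'
    have hP1 : (U * V) ^ p ≠ ∞ := ENNReal.rpow_ne_top_of_nonneg hp.le hUV1
    rw [ENNReal.div_rpow_of_nonneg _ _ hp.le, ENNReal.mul_rpow_of_nonneg _ _ hp.le,
      mul_comm, ← mul_div_assoc]
    refine ENNReal.div_le_of_le_mul ?_
    calc V * (Φ ^ p * c ^ p) = Φ ^ (p - 1) * (V * (Φ * c ^ p)) := by rw [e3]; ring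
      _ ≤ 2 ^ (p - 1) * (U ^ conj p * V) ^ (p - 1) * (V * (Φ * c ^ p)) := by gcongr
      _ = 2 ^ (p - 1) * (Φ * c ^ p) * ((U ^ conj p * V) ^ (p - 1) * V) := by ring
      _ = _ := by rw [e2]

end Admissible

/-- The constant in the lower bound for the term with `∫_{(0,x]} A^{p'} d(-φ)`. -/
def primPowConst (p : ℝ) : ℝ≥0∞ := 2 * (((2 : ℝ≥0∞) ^ p) ^ (1 / p) * 2 ^ p)

lemma primPowConst_ne_top {p : ℝ} (hp : 0 < p) : primPowConst p ≠ ∞ := by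
  have h : (2 : ℝ≥0∞) ^ p ≠ ∞ := ENNReal.rpow_ne_top_of_nonneg hp.le (by norm_num)
  exact ENNReal.mul_ne_top (by norm_num) (ENNReal.mul_ne_top
    (ENNReal.rpow_ne_top_of_nonneg (by positivity) h) h)

namespace Admissible

variable {p q : ℝ} {u : ℝ → ℝ≥0} {a v w : ℝ → ℝ≥0∞}

/-- Let `A` take the values `2^k` at the points `x_k`. Up to constants `∫_{(0,x]} A^{p'} d(-φ)` is
at most `∑ φ(x_k) 2^{k p'}`, and the test function is the supremum over `k` of multiples of
`v^{1-p'}` on `(0,τ_k)`, where `τ_k ≥ x_k` almost attains the supremum that defines `φ(x_k)`. -/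
lemma exists_primPow_test (H : Admissible p q u a v w) (hφ : ∀ t, 0 < t → phi p u v t ≠ ∞) {x : ℝ}
    {θ : ℝ≥0∞} (hθ : θ < primPow p u a v x ^ (1 / conj p)) :
    ∃ h : ℝ → ℝ≥0∞, AEMeasurable h (volume.restrict (Ioi 0)) ∧ energy p v h ≤ 1 ∧
      ∀ y, x ≤ y → θ ≤ primPowConst p * iterHardy u a h y := by
  classical
  have hp := H.p_pos
  have hp' := H.conj_pos
  have hp1 := one_lt_conj H.one_lt_p
  have hAfin : ∀ z, 0 < z → prim a z ≠ ∞ := fun z hz => H.prim_a_ne_top hz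
  set A := prim a with hA
  have hAm : Measurable A := measurable_prim a
  obtain ⟨b, hb⟩ := exists_lev_left (f := A) ((prim_mono a).monotoneOn _) (continuousOn_prim hAfin)
    (tendsto_prim_zero (hAfin 1 one_pos))
  set ν := decrMeasure (phi p u v) with hν
  let I : Set ℤ := {k | (lev A k ∩ Ioc 0 x).Nonempty}
  have hbI : ∀ k ∈ I, (lev A k).Nonempty ∧ 0 < b k ∧ b k ≤ x := fun k ⟨t, ht⟩ => by
    obtain ⟨b0, b1, b2, -⟩ := hb k ⟨t, ht.1⟩
    exact ⟨⟨t, ht.1⟩, b0, (b2 t ht.1).trans ht.2.2⟩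
  set e : ℤ → ℝ≥0∞ := fun k => 2 ^ k with he
  have he1 : ∀ k, e k ≠ ∞ := two_zpow_ne_top
  set Φ : ℤ → ℝ≥0∞ := fun k => if k ∈ I then phi p u v (b k) else 0 with hΦ
  have hΦfin : ∀ k, Φ k ≠ ∞ := fun k => by
    simp only [hΦ]; split_ifs with hk
    · exact hφ _ (hbI k hk).2.1
    · exact ENNReal.zero_ne_top
  have hR : primPow p u a v x ≤ 2 ^ conj p * ∑' k, Φ k * e k ^ conj p := by
    have h1 := setLIntegral_rpow_mul_le_tsum_lev (f := A) (g := fun _ => 1) hAm hAfin hp'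
      (ν.restrict (Ioc 0 x))
    rw [Measure.restrict_restrict measurableSet_Ioi, inter_eq_right.2 Ioc_subset_Ioi_self] at h1
    simp only [mul_one, lintegral_const, one_mul, Measure.restrict_apply MeasurableSet.univ,
      univ_inter] at h1
    refine h1.trans ?_
    rw [← ENNReal.tsum_mul_left]
    refine ENNReal.tsum_le_tsum fun k => ?_
    rw [Measure.restrict_apply (measurableSet_lev hAm k)]
    by_cases hk : k ∈ I
    · obtain ⟨hne, b0, b1⟩ := hbI k hk
      have h2 : ν (lev A k ∩ Ioc 0 x) ≤ phi p u v (b k) := by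
        refine le_trans (measure_mono ?_) (H.decrMeasure_Ici_le hφ b0)
        exact fun t ht => (hb k hne).2.2.1 t ht.1
      simp only [hΦ, if_pos hk, he]
      rw [two_zpow_add_one, ENNReal.mul_rpow_of_nonneg _ _ hp'.le]
      calc ((2 : ℝ≥0∞) ^ k) ^ conj p * 2 ^ conj p * ν (lev A k ∩ Ioc 0 x)
          ≤ ((2 : ℝ≥0∞) ^ k) ^ conj p * 2 ^ conj p * phi p u v (b k) := by gcongr
        _ = _ := by ring
    · have : lev A k ∩ Ioc 0 x = ∅ := not_nonempty_iff_eq_empty.1 hk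
      rw [this]; simp
  have hθ2 : θ / 2 < (∑' k, Φ k * e k ^ conj p) ^ (1 / conj p) := by
    refine ENNReal.div_lt_of_lt_mul ?_
    refine hθ.trans_le ((ENNReal.rpow_le_rpow hR (by positivity)).trans (le_of_eq ?_))
    rw [ENNReal.mul_rpow_of_nonneg _ _ (by positivity), ← ENNReal.rpow_mul,
      mul_one_div_cancel hp'.ne', ENNReal.rpow_one, mul_comm]
  rw [ENNReal.tsum_eq_iSup_sum, rpow_iSup (by positivity)] at hθ2
  obtain ⟨s, hs⟩ := lt_iSup_iff.1 hθ2
  set Q := ∑ k ∈ s, Φ k * e k ^ conj p with hQ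
  have hQ0 : Q ≠ 0 := fun h => by
    rw [h, ENNReal.zero_rpow_of_pos (by positivity)] at hs
    exact not_lt_zero hs
  have hQ1 : Q ≠ ∞ := ENNReal.sum_ne_top.2 fun k _ =>
    ENNReal.mul_ne_top (hΦfin k) (ENNReal.rpow_ne_top_of_nonneg hp'.le (he1 k))
  -- `m k` times `v^{1-p'}` on `(0, τ k)` makes `T_u h` at least `Φ k e_k^{p'-1}` to the left of
  -- `b k`; integration against `a`, of mass about `e_k` there, gives `Φ k e_k^{p'}`
  have hblock : ∀ k, ∃ τ m, m ≠ ∞ ∧ (k ∉ s → m = 0) ∧ (k ∈ s → k ∈ I →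
      b k ≤ τ ∧ Φ k * e k ^ (conj p - 1) ≤ u τ * (m * prim (dualWeight p v) τ)) ∧
      m ^ p * prim (dualWeight p v) τ ≤ 2 ^ (p - 1) * (Φ k * e k ^ conj p) := by
    intro k
    by_cases hk : k ∈ s ∧ k ∈ I
    · obtain ⟨τ, m, h1, h2, h3, h4⟩ := H.exists_phi_block (hbI k hk.2).2.1
        (hφ _ (hbI k hk.2).2.1) (c := e k ^ (conj p - 1))
        (ENNReal.rpow_ne_top_of_nonneg (by linarith) (he1 k))
      rw [← ENNReal.rpow_mul, mul_comm _ p, H.conj_mul_sub_one] at h4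
      have hΦk : Φ k = phi p u v (b k) := if_pos hk.2
      rw [hΦk]
      exact ⟨τ, m, h2, fun h => absurd hk.1 h, fun _ _ => ⟨h1, h3⟩, h4⟩
    · refine ⟨0, 0, ENNReal.zero_ne_top, fun _ => rfl, fun h1 h2 => absurd ⟨h1, h2⟩ hk, ?_⟩
      rw [ENNReal.zero_rpow_of_pos hp, zero_mul]
      exact zero_le
  choose τ m hm1 hm0 hmu hmE using hblock
  set g : ℝ → ℝ≥0∞ := fun y => ⨆ k, (Ioo 0 (τ k)).indicator (fun _ => m k) y with hg
  have hind : ∀ k, Measurable fun y => (Ioo 0 (τ k)).indicator (fun _ => m k) y := fun k =>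
    measurable_const.indicator measurableSet_Ioo
  have hgm : AEMeasurable g (volume.restrict (Ioi 0)) := (Measurable.iSup hind).aemeasurable
  set h : ℝ → ℝ≥0∞ := fun y => dualWeight p v y * g y with hh
  have hhm : AEMeasurable h (volume.restrict (Ioi 0)) := H.aemeasurable_dualWeight.mul hgm
  have hD : (2 : ℝ≥0∞) ^ (p - 1) ≤ 2 ^ p := ENNReal.rpow_le_rpow_of_exponent_le (by norm_num)
    (by linarith)
  have hE : energy p v h ≤ 2 ^ p * Q := by
    rw [energy, H.lintegral_dualWeight_mul_rpow le_rfl]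
    have h1 : ∀ y, dualWeight p v y * g y ^ p ≤
        ∑' k, (Ioo 0 (τ k)).indicator (fun y => m k ^ p * dualWeight p v y) y := fun y => by
      rw [hg, rpow_iSup hp, ENNReal.mul_iSup]
      refine iSup_le fun k => le_trans ?_ (ENNReal.le_tsum k)
      by_cases hy : y ∈ Ioo 0 (τ k)
      · simp only [indicator_of_mem hy]; rw [mul_comm]
      · simp only [indicator_of_notMem hy, ENNReal.zero_rpow_of_pos hp, mul_zero, le_refl]
    refine (lintegral_mono h1).trans ?_
    have hmeas : ∀ k, AEMeasurable
        (fun y => (Ioo 0 (τ k)).indicator (fun y => m k ^ p * dualWeight p v y) y)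
        (volume.restrict (Ioi 0)) := fun k =>
      (H.aemeasurable_dualWeight.const_mul _).indicator measurableSet_Ioo
    rw [lintegral_tsum hmeas, tsum_eq_sum (s := s), hQ, Finset.mul_sum]
    · refine Finset.sum_le_sum fun k _ => ?_
      rw [setLIntegral_indicator measurableSet_Ioo, inter_eq_left.2 Ioo_subset_Ioi_self,
        lintegral_const_mul' _ _ (ENNReal.rpow_ne_top_of_nonneg hp.le (hm1 k))]
      exact (hmE k).trans (by gcongr)
    · intro k hk
      simp [hm0 k hk, ENNReal.zero_rpow_of_pos hp]
  have hS : ∀ y, x ≤ y → Q ≤ 2 ^ p * iterHardy u a h y := by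
    intro y hy
    set J : ℤ → Set ℝ := fun k => lev A (k - 1) ∩ (Ioo 0 x ∩ Iio (b k)) with hJ
    have hJm : ∀ k, MeasurableSet (J k) := fun k =>
      (measurableSet_lev hAm _).inter (measurableSet_Ioo.inter measurableSet_Iio)
    have hJd : Pairwise (Function.onFun Disjoint J) := fun i j hij =>
      (pairwise_disjoint_lev A (show i - 1 ≠ j - 1 by omega)).mono inter_subset_left
        inter_subset_left
    have h1 := tsum_setLIntegral_le hJm hJd (Ioo 0 y)
      (fun k t ht => ⟨ht.2.1.1, ht.2.1.2.trans_le hy⟩) (fun t => supHardy u h t * a t) volume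
    have h2 : Q ≤ 2 * ∑' k, ∫⁻ t in J k, supHardy u h t * a t := by
      rw [hQ, ← ENNReal.tsum_mul_left]
      refine le_trans (Finset.sum_le_sum fun k hk => ?_) (ENNReal.sum_le_tsum s)
      by_cases hkI : k ∈ I
      swap
      · simp [hΦ, hkI]
      obtain ⟨hne, b0, bx⟩ := hbI k hkI
      obtain ⟨-, b1, b2, b3, b4, b5, b6⟩ := hb k hne
      obtain ⟨hbτ, hu⟩ := hmu k hk hkI
      have hprim : m k * prim (dualWeight p v) (τ k) ≤ prim h (τ k) := by
        refine (lintegral_const_mul_le _ _).trans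
          (setLIntegral_mono' measurableSet_Ioo fun z hz => ?_)
        rw [mul_comm]
        refine mul_le_mul_right ((le_of_eq ?_).trans
          (le_iSup (fun k => (Ioo 0 (τ k)).indicator (fun _ => m k) z) k)) _
        rw [indicator_of_mem hz]
      have hF : ∀ t ∈ J k, Φ k * e k ^ (conj p - 1) ≤ supHardy u h t := fun t ht =>
        hu.trans ((mul_le_mul_right hprim _).trans
          (le_supFrom (fun τ => u τ * prim h τ) ((le_of_lt ht.2.2).trans hbτ)))
      have hmass : e k ≤ 2 * ∫⁻ t in J k, a t := by
        have h3 := prim_eq_add (f := a) b3.le b4.le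
        change A (b k) = A (b (k - 1)) + _ at h3
        rw [b1, b5, two_zpow_eq_sub_one, mul_two] at h3
        simp only [he]
        rw [two_zpow_eq_sub_one, (ENNReal.add_right_inj (two_zpow_ne_top _)).1 h3, mul_comm]
        gcongr
        exact fun t ht => ⟨b6 ⟨ht.1.le, ht.2⟩, ⟨b3.trans ht.1, ht.2.trans_le bx⟩, ht.2⟩
      have hpow : e k ^ conj p = e k ^ (conj p - 1) * e k := by
        nth_rewrite 3 [← ENNReal.rpow_one (e k)]
        rw [← ENNReal.rpow_add_of_nonneg _ _ (by linarith) zero_le_one, sub_add_cancel]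
      calc Φ k * e k ^ conj p = Φ k * e k ^ (conj p - 1) * e k := by rw [hpow, mul_assoc]
        _ ≤ Φ k * e k ^ (conj p - 1) * (2 * ∫⁻ t in J k, a t) := by gcongr
        _ = 2 * (Φ k * e k ^ (conj p - 1) * ∫⁻ t in J k, a t) := by ring
        _ ≤ 2 * ∫⁻ t in J k, Φ k * e k ^ (conj p - 1) * a t := by
            gcongr; exact lintegral_const_mul_le _ _
        _ ≤ 2 * ∫⁻ t in J k, supHardy u h t * a t := by
            gcongr 2 * ?_
            exact setLIntegral_mono' (hJm k) fun t ht => by gcongr; exact hF t ht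
    have h3 : (2 : ℝ≥0∞) ≤ 2 ^ p := by
      conv_lhs => rw [← ENNReal.rpow_one 2]
      exact ENNReal.rpow_le_rpow_of_exponent_le (by norm_num) H.one_lt_p.le
    exact h2.trans (mul_le_mul' h3 h1)
  have h2p0 : (2 : ℝ≥0∞) ^ p ≠ 0 := (ENNReal.rpow_pos (by norm_num) (by norm_num)).ne'
  have h2p1 : (2 : ℝ≥0∞) ^ p ≠ ∞ := ENNReal.rpow_ne_top_of_nonneg hp.le (by norm_num)
  obtain ⟨f, f1, f2, f3⟩ := H.exists_test_of_energy_le hhm h2p0 h2p1 hQ0 hQ1 hE hS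
  refine ⟨f, f1, f2, fun y hy => ?_⟩
  calc θ = 2 * (θ / 2) := (ENNReal.mul_div_cancel (by norm_num) (by norm_num)).symm
    _ ≤ 2 * (((2 : ℝ≥0∞) ^ p) ^ (1 / p) * 2 ^ p * iterHardy u a f y) :=
        mul_le_mul_right (hs.le.trans (f3 y hy)) _
    _ = _ := by rw [primPowConst, ← mul_assoc]

lemma condTail_kernPow_le (H : Admissible p q u a v w) (hN : opNorm p q u a v w ≠ ∞) :
    condTail p q (kernPow p u a v) w ≤ lowerConst p q * opNorm p q u a v w := by
  have hφ : ∀ t, 0 < t → phi p u v t ≠ ∞ := fun t ht => H.phi_ne_top_of_opNorm hN ht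
  simpa using H.condTail_le (fun t ht => H.setLIntegral_Ioi_ne_top_of_opNorm hN ht)
    (H.kernPow_mono.monotoneOn _) ENNReal.one_ne_top
    fun x hx θ hθ => H.exists_kernPow_test hφ hx hθ

lemma condTail_primPow_le (H : Admissible p q u a v w) (hN : opNorm p q u a v w ≠ ∞) :
    condTail p q (primPow p u a v) w
      ≤ lowerConst p q * (primPowConst p * opNorm p q u a v w) := by
  have hφ : ∀ t, 0 < t → phi p u v t ≠ ∞ := fun t ht => H.phi_ne_top_of_opNorm hN ht
  exact H.condTail_le (fun t ht => H.setLIntegral_Ioi_ne_top_of_opNorm hN ht)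
    (primPow_mono.monotoneOn _) (primPowConst_ne_top H.p_pos)
    fun x hx θ hθ => H.exists_primPow_test hφ hθ

end Admissible

/-! ### Lower bounds for the terms with the tails of the kernel -/

lemma measurable_setLIntegral_Ioo {f : ℝ → ℝ≥0∞} (hf : Measurable f) :
    Measurable fun z : ℝ × ℝ => ∫⁻ s in Ioo z.1 z.2, f s := by
  have hm : Measurable fun x : (ℝ × ℝ) × ℝ =>
      {x : (ℝ × ℝ) × ℝ | x.1.1 < x.2 ∧ x.2 < x.1.2}.indicator (fun x => f x.2) x :=
    (hf.comp measurable_snd).indicator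
      ((measurableSet_lt (measurable_fst.comp measurable_fst) measurable_snd).inter
        (measurableSet_lt measurable_snd (measurable_snd.comp measurable_fst)))
  have e : (fun z : ℝ × ℝ => ∫⁻ s in Ioo z.1 z.2, f s) = fun z : ℝ × ℝ => ∫⁻ s : ℝ,
      {x : (ℝ × ℝ) × ℝ | x.1.1 < x.2 ∧ x.2 < x.1.2}.indicator (fun x => f x.2) (z, s) := by
    ext z
    rw [← lintegral_indicator measurableSet_Ioo]
    rfl
  rw [e]
  exact hm.lintegral_prod_right'

/-- The constant in the lower bound for `condKern`. -/
def kernConst (p q : ℝ) : ℝ≥0∞ :=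
  1 + ((2 ^ (rExp p q / (p * conj q) + 1)) ^ (q - 1)) ^ (1 / q)

lemma kernConst_ne_top {p q : ℝ} (hq : 1 < q) : kernConst p q ≠ ∞ := by
  have hq1 : 0 ≤ q - 1 := by linarith
  refine ENNReal.add_ne_top.2 ⟨ENNReal.one_ne_top, ENNReal.rpow_ne_top_of_nonneg (by positivity)
    (ENNReal.rpow_ne_top_of_nonneg hq1 (ENNReal.rpow_ne_top_of_ne_zero (by norm_num) ?_))⟩
  norm_num

namespace Admissible

variable {p q : ℝ} {u : ℝ → ℝ≥0} {a v w : ℝ → ℝ≥0∞}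

lemma aemeasurable_kern (H : Admissible p q u a v w) :
    AEMeasurable (fun z : ℝ × ℝ => kern u a z.1 z.2)
      ((volume.restrict (Ioi 0)).prod (volume.restrict (Ioi 0))) := by
  have hf := H.aemeasurable_supTail_mul
  refine ⟨fun z => ∫⁻ s in Ioo z.1 z.2, hf.mk _ s,
    measurable_setLIntegral_Ioo hf.measurable_mk, ?_⟩
  rw [Measure.prod_restrict]
  filter_upwards [ae_restrict_mem (measurableSet_Ioi.prod measurableSet_Ioi)] with z hz
  refine lintegral_congr_ae (ae_mono (Measure.restrict_mono ?_ le_rfl) hf.ae_eq_mk)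
  exact fun s hs => lt_trans hz.1 hs.1

/-- With `S = iterHardy u a h`, one has `∫_0^y h(s) k(s,y) ds ≤ S(y)` and, since `k` is
non-increasing in its first variable, `k(s,y) ∫_0^s h ≤ S(y)`. Hence `∫_0^y h(s) (∫_0^s h)^{q-1}
k(s,y)^q ds ≤ S(y)^q`, and the claim follows by Tonelli's theorem. -/
lemma setLIntegral_prim_rpow_mul_kernTail_le (H : Admissible p q u a v w) {h : ℝ → ℝ≥0∞}
    (hh : AEMeasurable h (volume.restrict (Ioi 0))) :
    ∫⁻ s in Ioi 0, h s * prim h s ^ (q - 1) * kernTail q u a w s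
      ≤ ∫⁻ y in Ioi 0, iterHardy u a h y ^ q * w y := by
  have hq := H.q_pos
  have hq1 : 0 < q - 1 := by linarith [H.one_lt_q]
  set μ := volume.restrict (Ioi (0 : ℝ)) with hμ
  let F : ℝ → ℝ → ℝ≥0∞ := fun s y => {z : ℝ × ℝ | z.1 < z.2}.indicator
    (fun z => h z.1 * prim h z.1 ^ (q - 1) * (kern u a z.1 z.2 ^ q * w z.2)) (s, y)
  have hF : AEMeasurable (Function.uncurry F) (μ.prod μ) := by
    refine AEMeasurable.indicator ?_ (measurableSet_lt measurable_fst measurable_snd)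
    exact ((hh.comp_fst).mul (((measurable_prim h).comp measurable_fst).pow_const _).aemeasurable).mul
      ((H.aemeasurable_kern.pow_const _).mul H.weight_w.aemeasurable.comp_snd)
  have e1 : ∀ s ∈ Ioi (0 : ℝ), h s * prim h s ^ (q - 1) * kernTail q u a w s ≤ ∫⁻ y, F s y ∂μ := by
    intro s hs
    have : ∀ y, F s y = (Ioi s).indicator
        (fun y => h s * prim h s ^ (q - 1) * (kern u a s y ^ q * w y)) y := fun y => rfl
    simp_rw [this]
    rw [hμ, setLIntegral_indicator measurableSet_Ioi,
      inter_eq_left.2 (Ioi_subset_Ioi (le_of_lt hs))]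
    exact lintegral_const_mul_le _ _
  refine (setLIntegral_mono' measurableSet_Ioi e1).trans ?_
  rw [lintegral_lintegral_swap hF]
  refine setLIntegral_mono' measurableSet_Ioi fun y hy => ?_
  have e2 : ∀ s, F s y = (Iio y).indicator
      (fun s => h s * prim h s ^ (q - 1) * (kern u a s y ^ q * w y)) s := fun s => rfl
  simp_rw [e2]
  rw [hμ, setLIntegral_indicator measurableSet_Iio, inter_comm, Ioi_inter_Iio]
  set S := iterHardy u a h y with hS
  have hSk := H.setLIntegral_mul_kern_le hh y
  have hkH : ∀ s ∈ Ioo 0 y, prim h s * kern u a s y ≤ S := fun s hs => by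
    refine le_trans ?_ ((lintegral_mono_set (Ioo_subset_Ioo_right hs.2.le)).trans hSk)
    rw [mul_comm]
    refine (lintegral_const_mul_le _ _).trans (setLIntegral_mono' measurableSet_Ioo fun r hr => ?_)
    rw [mul_comm]
    gcongr
    exact kern_antitone_left u a y hr.2.le
  have hm : AEMeasurable (fun s => h s * kern u a s y) (volume.restrict (Ioo 0 y)) :=
    (hh.mul (kern_antitone_left u a y).measurable.aemeasurable).mono_measure
      (Measure.restrict_mono Ioo_subset_Ioi_self le_rfl)
  have hpow : ∀ c : ℝ≥0∞, c ^ q = c ^ (q - 1) * c := fun c => by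
    nth_rewrite 3 [← ENNReal.rpow_one c]
    rw [← ENNReal.rpow_add_of_nonneg _ _ hq1.le zero_le_one, sub_add_cancel]
  calc ∫⁻ s in Ioo 0 y, h s * prim h s ^ (q - 1) * (kern u a s y ^ q * w y)
      ≤ ∫⁻ s in Ioo 0 y, S ^ (q - 1) * w y * (h s * kern u a s y) := by
        refine setLIntegral_mono' measurableSet_Ioo fun s hs => ?_
        calc h s * prim h s ^ (q - 1) * (kern u a s y ^ q * w y)
            = (prim h s * kern u a s y) ^ (q - 1) * w y * (h s * kern u a s y) := by
              rw [hpow, ENNReal.mul_rpow_of_nonneg _ _ hq1.le]; ring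
          _ ≤ _ := by gcongr; exact hkH s hs
    _ = S ^ (q - 1) * w y * ∫⁻ s in Ioo 0 y, h s * kern u a s y := lintegral_const_mul'' _ hm
    _ ≤ S ^ (q - 1) * w y * S := by gcongr
    _ = S ^ q * w y := by rw [hpow]; ring

/-- The lower bound given by the test function `v^{1-p'}` on `(0,t)`. -/
lemma prim_rpow_mul_kernTail_le (H : Admissible p q u a v w) {t : ℝ} (ht : 0 < t) :
    prim (dualWeight p v) t ^ (1 / conj p) * kernTail q u a w t ^ (1 / q)
      ≤ opNorm p q u a v w := by
  have hq := H.q_pos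
  have hp := H.p_pos
  have hp' := H.conj_pos
  set V := prim (dualWeight p v) t with hV
  have hV0 : V ≠ 0 := (H.dual t ht).1.ne'
  have hV1 : V ≠ ∞ := (H.dual t ht).2.ne
  have hm := H.aemeasurable_indicator_mul (measurableSet_Ioo (a := 0) (b := t))
    (f := fun _ => 1) aemeasurable_const
  set h : ℝ → ℝ≥0∞ := fun x => (Ioo 0 t).indicator (fun x => dualWeight p v x * 1) x with hh
  have hE : energy p v h = V := by
    rw [hh, H.energy_indicator_mul measurableSet_Ioo Ioo_subset_Ioi_self]
    simp [hV, prim]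
  have hS : ∀ y ∈ Ioi t, V * kern u a t y ≤ iterHardy u a h y := fun y hy => by
    refine le_trans ?_ ((lintegral_mono_set (Ioo_subset_Ioo_right (le_of_lt hy))).trans
      (H.setLIntegral_mul_kern_le hm y))
    rw [mul_comm]
    refine (lintegral_const_mul_le _ _).trans (setLIntegral_mono' measurableSet_Ioo fun s hs => ?_)
    rw [hh]
    simp only [indicator_of_mem hs, mul_one]
    rw [mul_comm]
    gcongr
    exact kern_antitone_left u a y hs.2.le
  have h1 := H.setLIntegral_iterHardy_le_opNorm hm (hE.trans_ne hV1)
  rw [hE] at h1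
  have h2 : V ^ q * kernTail q u a w t ≤ opNorm p q u a v w ^ q * V ^ (q / p) := by
    refine le_trans ?_ h1
    calc V ^ q * kernTail q u a w t ≤ ∫⁻ y in Ioi t, V ^ q * (kern u a t y ^ q * w y) :=
          lintegral_const_mul_le _ _
      _ ≤ ∫⁻ y in Ioi t, iterHardy u a h y ^ q * w y := by
          refine setLIntegral_mono' measurableSet_Ioi fun y hy => ?_
          rw [← mul_assoc, ← ENNReal.mul_rpow_of_nonneg _ _ hq.le]
          gcongr
          exact hS y hy
      _ ≤ _ := lintegral_mono_set (Ioi_subset_Ioi ht.le)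
  have hexp : q = q / conj p + q / p := by
    have := (holderConjugate_conj H.one_lt_p).inv_add_inv_eq_one
    rw [div_eq_mul_inv, div_eq_mul_inv, ← mul_add, add_comm, this, mul_one]
  have h3 : V ^ (q / conj p) * kernTail q u a w t ≤ opNorm p q u a v w ^ q := by
    rw [hexp, ENNReal.rpow_add _ _ hV0 hV1, ← hexp] at h2
    have hVp0 : V ^ (q / p) ≠ 0 := (ENNReal.rpow_pos (pos_iff_ne_zero.2 hV0) hV1).ne'
    have hVp1 : V ^ (q / p) ≠ ∞ := ENNReal.rpow_ne_top_of_ne_zero hV0 hV1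
    rw [mul_right_comm] at h2
    exact (ENNReal.mul_le_mul_iff_left hVp0 hVp1).1 h2
  have h4 := ENNReal.rpow_le_rpow h3 (show 0 ≤ 1 / q by positivity)
  rwa [ENNReal.mul_rpow_of_nonneg _ _ (by positivity), ← ENNReal.rpow_mul, ← ENNReal.rpow_mul,
    mul_one_div_cancel hq.ne', ENNReal.rpow_one,
    show q / conj p * (1 / q) = 1 / conj p by field_simp] at h4

/-- For `q < p` the test function is `v^{1-p'} V^{r/(pq')} N^{r/(pq)}`, with `V` the primitive of
`v^{1-p'}` and `N` the function `kernTail`, made bounded near `0` and cut off at infinity. -/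
lemma condKern_le (H : Admissible p q u a v w) (hN : opNorm p q u a v w ≠ ∞) :
    condKern p q u a v w ≤ kernConst p q * opNorm p q u a v w := by
  have hp := H.p_pos
  have hq := H.q_pos
  have hp' := H.conj_pos
  have hK : (1 : ℝ≥0∞) ≤ kernConst p q := le_self_add
  rw [condKern]
  split_ifs with hpq
  · refine (iSup₂_le fun t ht => ?_).trans (le_mul_of_one_le_left zero_le hK)
    exact H.prim_rpow_mul_kernTail_le ht
  rw [not_le] at hpq
  have hr := rExp_pos hq hpq
  have hq' : 0 < conj q := SupHardy.conj_pos H.one_lt_q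
  have hq1 : 0 < q - 1 := by linarith [H.one_lt_q]
  set r := rExp p q with hrdef
  set α : ℝ := r / (p * conj q) with hα
  set β : ℝ := r / (p * q) with hβ
  have hα0 : 0 ≤ α := by positivity
  have hβ0 : 0 ≤ β := by positivity
  have hαp : α * p = r / conj q := by rw [hα]; field_simp
  have hβp : β * p = r / q := by rw [hβ]; field_simp
  -- the exponents of the lower bound agree with those of the energy
  have hqq : (conj q)⁻¹ = 1 - q⁻¹ := by
    have := (holderConjugate_conj H.one_lt_q).inv_add_inv_eq_one
    linarith
  have hrq := rExp_div_q hq hpq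
  rw [← hrdef] at hrq
  have hβq : (q - 1) * β + β + 1 = r / q := by
    rw [hrq, hβ]; field_simp; ring
  have hαq : (α + 1) * (q - 1) + α = r / conj q := by
    have h1 : r * q⁻¹ = r * p⁻¹ + 1 := by simpa [div_eq_mul_inv] using hrq
    have h2 : α = r * p⁻¹ * (1 - q⁻¹) := by rw [hα, ← hqq]; field_simp
    have h3 : r / conj q = r * (1 - q⁻¹) := by rw [← hqq, div_eq_mul_inv]
    have h4 : q * q⁻¹ = 1 := mul_inv_cancel₀ hq.ne'
    rw [h3, h2]
    linear_combination (-q + 1) * h1 + (r * p⁻¹ * (-1) + 0) * h4 + r * h4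
  set V := prim (dualWeight p v) with hV
  set Nt := kernTail q u a w with hNt
  have hNanti : AntitoneOn Nt (Ioi 0) := fun s hs t ht hst => by
    refine (lintegral_mono_set (Ioi_subset_Ioi hst)).trans (lintegral_mono fun y => ?_)
    gcongr
    exact kern_antitone_left u a y hst
  have hNfin : ∀ t, 0 < t → Nt t ≠ ∞ := fun t ht h => by
    have h1 := H.prim_rpow_mul_kernTail_le ht
    rw [← hNt, h, ENNReal.top_rpow_of_pos (by positivity), ENNReal.mul_top
      (ENNReal.rpow_pos_of_nonneg (H.dual t ht).1 (by positivity)).ne'] at h1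
    exact hN (top_le_iff.1 h1)
  set D : ℝ≥0∞ := 2 ^ (α + 1) with hD
  have hDfin : D ^ (q - 1) ≠ ∞ := ENNReal.rpow_ne_top_of_nonneg hq1.le
    (ENNReal.rpow_ne_top_of_nonneg (by positivity) (by norm_num))
  have hcut : ∀ ε n : ℝ, 0 < ε → ε < n →
      ∫⁻ t in Ioo ε n, V t ^ (r / conj q) * dualWeight p v t * Nt t ^ (r / q)
        ≤ (D ^ (q - 1) * opNorm p q u a v w ^ q) ^ (r / q) := by
    intro ε n hε hεn
    have hn : 0 < n := hε.trans hεn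
    set M : ℝ → ℝ≥0∞ := fun t => Nt (max t ε) with hM
    have hmax : ∀ t, 0 < max t ε := fun t => hε.trans_le (le_max_right t ε)
    have hManti : Antitone M := fun s t hst => hNanti (hmax s) (hmax t) (max_le_max_right ε hst)
    have hMN : ∀ t, 0 < t → M t ≤ Nt t := fun t ht => hNanti ht (hmax t) (le_max_left t ε)
    set g : ℝ → ℝ≥0∞ := fun t => V t ^ α * M t ^ β with hg
    have hgm : AEMeasurable g (volume.restrict (Ioi 0)) :=
      (((measurable_prim _).pow_const _).mul (hManti.measurable.pow_const _)).aemeasurable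
    have hm := H.aemeasurable_indicator_mul (measurableSet_Ioo (a := 0) (b := n)) hgm
    set h : ℝ → ℝ≥0∞ := fun x => (Ioo 0 n).indicator (fun x => dualWeight p v x * g x) x with hh
    set E := ∫⁻ t in Ioo 0 n, dualWeight p v t * (V t ^ (r / conj q) * M t ^ (r / q)) with hE
    have hEh : energy p v h = E := by
      rw [hh, H.energy_indicator_mul measurableSet_Ioo Ioo_subset_Ioi_self]
      refine lintegral_congr fun t => ?_
      rw [hg]
      dsimp only
      rw [ENNReal.mul_rpow_of_nonneg _ _ hp.le, ← ENNReal.rpow_mul, ← ENNReal.rpow_mul, hαp, hβp]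
    -- the cut-offs at `ε` and `n` serve to make the energy finite
    have hEfin : E ≠ ∞ := by
      have hc : V n ^ (r / conj q) * Nt ε ^ (r / q) ≠ ∞ := ENNReal.mul_ne_top
        (ENNReal.rpow_ne_top_of_nonneg (by positivity) (H.dual n hn).2.ne)
        (ENNReal.rpow_ne_top_of_nonneg (by positivity) (hNfin ε hε))
      refine ne_top_of_le_ne_top (ENNReal.mul_ne_top (H.dual n hn).2.ne hc) ?_
      rw [prim, ← lintegral_mul_const' _ _ hc]
      refine setLIntegral_mono' measurableSet_Ioo fun t ht => ?_
      gcongr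
      · exact prim_mono _ ht.2.le
      · exact hNanti hε (hmax t) (le_max_right t ε)
    -- `M` is non-increasing, so the power rule for `V` bounds the primitive of `h` from below
    have hprim : ∀ t ∈ Ioo 0 n, M t ^ β * V t ^ (α + 1) ≤ D * prim h t := by
      intro t ht
      have h1 := rpow_setLIntegral_le_of_left (f := dualWeight p v) (G := V) (J := Ioo 0 t) hα0
        measurableSet_Ioo (H.dual t ht.1).2.ne
        fun x _ => lintegral_mono_set fun s hs => ⟨hs.1.1, hs.2⟩
      change V t ^ (α + 1) ≤ D * _ at h1
      calc M t ^ β * V t ^ (α + 1)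
          ≤ M t ^ β * (D * ∫⁻ x in Ioo 0 t, V x ^ α * dualWeight p v x) := by gcongr
        _ = D * (M t ^ β * ∫⁻ x in Ioo 0 t, V x ^ α * dualWeight p v x) := by ring
        _ ≤ D * ∫⁻ x in Ioo 0 t, M t ^ β * (V x ^ α * dualWeight p v x) := by
            gcongr; exact lintegral_const_mul_le _ _
        _ ≤ D * prim h t := by
            gcongr D * ?_
            refine setLIntegral_mono' measurableSet_Ioo fun x hx => ?_
            rw [hh]
            simp only [indicator_of_mem (show x ∈ Ioo 0 n from ⟨hx.1, hx.2.trans ht.2⟩), hg]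
            calc M t ^ β * (V x ^ α * dualWeight p v x)
                ≤ M x ^ β * (V x ^ α * dualWeight p v x) := by
                  gcongr; exact hManti hx.2.le
              _ = _ := by ring
    have hlow : E ≤ D ^ (q - 1) * ∫⁻ s in Ioi 0, h s * prim h s ^ (q - 1) * Nt s := by
      calc E ≤ ∫⁻ s in Ioo 0 n, D ^ (q - 1) * (h s * prim h s ^ (q - 1) * Nt s) := by
            refine setLIntegral_mono' measurableSet_Ioo fun t ht => ?_
            have e1 : V t ^ (r / conj q) = (V t ^ (α + 1)) ^ (q - 1) * V t ^ α := by
              rw [← hαq, ENNReal.rpow_add_of_nonneg _ _ (by positivity) hα0, ENNReal.rpow_mul]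
            have e2 : M t ^ (r / q) = (M t ^ β) ^ (q - 1) * M t ^ β * M t := by
              rw [← hβq, ENNReal.rpow_add_of_nonneg _ _ (by positivity) zero_le_one,
                ENNReal.rpow_one, ENNReal.rpow_add_of_nonneg _ _ (by positivity) hβ0,
                mul_comm (q - 1), ENNReal.rpow_mul]
            have e3 : h t = dualWeight p v t * (V t ^ α * M t ^ β) := by
              rw [hh]; simp only [indicator_of_mem ht, hg]
            calc dualWeight p v t * (V t ^ (r / conj q) * M t ^ (r / q))
                = h t * (M t ^ β * V t ^ (α + 1)) ^ (q - 1) * M t := by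
                  rw [e1, e2, e3, ENNReal.mul_rpow_of_nonneg _ _ hq1.le]; ring
              _ ≤ h t * (D * prim h t) ^ (q - 1) * Nt t := by
                  exact mul_le_mul' (mul_le_mul_right
                    (ENNReal.rpow_le_rpow (hprim t ht) hq1.le) _) (hMN t ht.1)
              _ = _ := by rw [ENNReal.mul_rpow_of_nonneg _ _ hq1.le]; ring
        _ ≤ ∫⁻ s in Ioi 0, D ^ (q - 1) * (h s * prim h s ^ (q - 1) * Nt s) :=
            lintegral_mono_set Ioo_subset_Ioi_self
        _ = _ := lintegral_const_mul' _ _ hDfin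
    have hfinal : E ≤ D ^ (q - 1) * opNorm p q u a v w ^ q * E ^ (q / p) := by
      refine hlow.trans ?_
      rw [mul_assoc]
      gcongr
      refine (H.setLIntegral_prim_rpow_mul_kernTail_le hm).trans ?_
      have := H.setLIntegral_iterHardy_le_opNorm hm (hEh.trans_ne hEfin)
      rwa [hEh] at this
    have h3 := rpow_le_of_le_mul_rpow (div_pos hq hr) (q_div_p_add_q_div_rExp hq) hEfin hfinal
    have h4 := ENNReal.rpow_le_rpow h3 (show 0 ≤ r / q by positivity)
    rw [← ENNReal.rpow_mul, div_mul_div_cancel₀ hr.ne', div_self hq.ne', ENNReal.rpow_one] at h4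
    refine le_trans ?_ h4
    refine (setLIntegral_mono' measurableSet_Ioo fun t ht => ?_).trans
      (lintegral_mono_set (Ioo_subset_Ioo_left hε.le))
    have : M t = Nt t := by rw [hM]; simp only [max_eq_left ht.1.le]
    rw [this]
    exact le_of_eq (by ring)
  have hall : ∫⁻ t in Ioi 0, V t ^ (r / conj q) * dualWeight p v t * Nt t ^ (r / q)
        ≤ (D ^ (q - 1) * opNorm p q u a v w ^ q) ^ (r / q) := by
    have hU : Ioi (0 : ℝ) = ⋃ n : ℕ, Ioo (1 / ((n : ℝ) + 2)) ((n : ℝ) + 2) := by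
      ext t; simp only [mem_Ioi, mem_iUnion, mem_Ioo]
      refine ⟨fun ht => ?_, fun ⟨n, h1, _⟩ => lt_trans (by positivity) h1⟩
      obtain ⟨n, hn⟩ := exists_nat_gt (max t (1 / t))
      have h1 := (le_max_left _ _).trans_lt hn
      have h2 := (le_max_right _ _).trans_lt hn
      refine ⟨n, ?_, by linarith⟩
      rw [div_lt_iff₀ (by positivity)]
      rw [div_lt_iff₀ ht] at h2
      nlinarith
    rw [hU, setLIntegral_iUnion_of_directed]
    · refine iSup_le fun n => hcut _ _ (by positivity) ?_
      rw [div_lt_iff₀ (by positivity)]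
      nlinarith [show (0 : ℝ) ≤ n by positivity]
    · exact Monotone.directed_le fun m n hmn => Ioo_subset_Ioo
        (one_div_le_one_div_of_le (by positivity) (by gcongr)) (by gcongr)
  rw [termB1, ← hrdef]
  refine (ENNReal.rpow_le_rpow hall (by positivity)).trans ?_
  rw [← ENNReal.rpow_mul, show r / q * (1 / r) = 1 / q by field_simp,
    ENNReal.mul_rpow_of_nonneg _ _ (by positivity), ← ENNReal.rpow_mul _ q,
    mul_one_div_cancel hq.ne', ENNReal.rpow_one]
  gcongr
  rw [kernConst]
  exact le_add_self

end Admissible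

/-! ### Equivalence -/

/-- The sum of the five functionals that characterize the inequality. -/
def condTotal (p q : ℝ) (u : ℝ → ℝ≥0) (a v w : ℝ → ℝ≥0∞) : ℝ≥0∞ :=
  condTail p q (kernPow p u a v) w + condKern p q u a v w
    + condHead p q (fun x => decrMeasure (phi p u v) (Ici x)) (fun y => prim a y ^ q * w y)
    + condTail p q (primPow p u a v) w + termLim p q u a v w

lemma condTotal_of_le {p q : ℝ} (hpq : p ≤ q) (u : ℝ → ℝ≥0) (a v w : ℝ → ℝ≥0∞) :
    condTotal p q u a v w = termA1 p q u a v w + termA2 p q u a v w + termA3 p q u a v w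
      + termA4 p q u a v w + termLim p q u a v w := by
  simp only [condTotal, condTail, condKern, condHead, if_pos hpq, termA1, termA3, termA4,
    kernPow, primPow, setLIntegral_one]

lemma condTotal_of_lt {p q : ℝ} (hqp : q < p) (u : ℝ → ℝ≥0) (a v w : ℝ → ℝ≥0∞) :
    condTotal p q u a v w = termB1 p q u a v w + termB2 p q u a v w + termB3 p q u a v w
      + termB4 p q u a v w + termLim p q u a v w := by
  simp only [condTotal, condTail, condKern, condHead, if_neg (not_le.2 hqp), termB2, termB3,
    termB4, kernPow, primPow, setLIntegral_one]
  rw [add_comm _ (termB1 p q u a v w)]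

namespace Admissible

variable {p q : ℝ} {u : ℝ → ℝ≥0} {a v w : ℝ → ℝ≥0∞}

lemma opNorm_le_condTotal (H : Admissible p q u a v w) :
    opNorm p q u a v w ≤ (5 * upperConst p q) ^ (1 / q) * condTotal p q u a v w := by
  have hq := H.q_pos
  set T := condTotal p q u a v w with hT
  have h1 : condTail p q (kernPow p u a v) w ≤ T :=
    le_add_right (le_add_right (le_add_right le_self_add))
  have h2 : condKern p q u a v w ≤ T := le_add_right (le_add_right (le_add_right le_add_self))
  have h3 : condHead p q (fun x => decrMeasure (phi p u v) (Ici x)) (fun y => prim a y ^ q * w y)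
    ≤ T := le_add_right (le_add_right le_add_self)
  have h4 : condTail p q (primPow p u a v) w ≤ T := le_add_right le_add_self
  have h5 : termLim p q u a v w ≤ T := le_add_self
  have hsum : condSum p q u a v w ≤ 5 * T ^ q := by
    calc condSum p q u a v w ≤ T ^ q + T ^ q + T ^ q + (T ^ q + T ^ q) := by
          rw [condSum]; gcongr
      _ = 5 * T ^ q := by ring
  have h6 := ENNReal.rpow_le_rpow (H.opNorm_rpow_le.trans (mul_le_mul_right hsum _))
    (show 0 ≤ 1 / q by positivity)
  rwa [← mul_assoc, mul_comm _ 5, ENNReal.mul_rpow_of_nonneg _ _ (by positivity),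
    ← ENNReal.rpow_mul, ← ENNReal.rpow_mul, mul_one_div_cancel hq.ne', ENNReal.rpow_one,
    ENNReal.rpow_one] at h6

lemma condTotal_le_opNorm (H : Admissible p q u a v w) :
    condTotal p q u a v w ≤ (lowerConst p q + kernConst p q + lowerConst p q
      + lowerConst p q * primPowConst p + 1) * opNorm p q u a v w := by
  rcases eq_or_ne (opNorm p q u a v w) ∞ with hN | hN
  · rw [hN, ENNReal.mul_top (one_pos.trans_le le_add_self).ne']
    exact le_top
  have hφ : ∀ t, 0 < t → phi p u v t ≠ ∞ := fun t ht => H.phi_ne_top_of_opNorm hN ht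
  simp only [add_mul, one_mul, mul_assoc]
  exact add_le_add (add_le_add (add_le_add (add_le_add (H.condTail_kernPow_le hN)
    (H.condKern_le hN)) ((H.condHead_mono fun x hx => H.decrMeasure_Ici_le hφ hx).trans
      H.condHead_le)) (H.condTail_primPow_le hN)) H.termLim_le

end Admissible

/-- The equivalence, with a constant that depends only on the exponents. -/
theorem exists_const_opNorm_condTotal {p q : ℝ} (hp : 1 < p) (hq : 1 < q) :
    ∃ C : ℝ≥0, 0 < C ∧ ∀ (u : ℝ → ℝ≥0) (a v w : ℝ → ℝ≥0∞), Admissible p q u a v w →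
      opNorm p q u a v w ≤ C * condTotal p q u a v w ∧
        condTotal p q u a v w ≤ C * opNorm p q u a v w := by
  have hp0 : 0 < p := zero_lt_one.trans hp
  have hq0 : 0 < q := zero_lt_one.trans hq
  set C₁ := (5 * upperConst p q) ^ (1 / q) with hC₁
  set C₂ := lowerConst p q + kernConst p q + lowerConst p q + lowerConst p q * primPowConst p + 1
    with hC₂
  have h1 : C₁ ≠ ∞ := ENNReal.rpow_ne_top_of_nonneg (by positivity)
    (ENNReal.mul_ne_top (by norm_num) (upperConst_ne_top p q))
  have hl := lowerConst_ne_top p q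
  have h2 : C₂ ≠ ∞ := by
    simp only [hC₂, ENNReal.add_ne_top]
    exact ⟨⟨⟨⟨hl, kernConst_ne_top hq⟩, hl⟩,
      ENNReal.mul_ne_top hl (primPowConst_ne_top hp0)⟩, ENNReal.one_ne_top⟩
  have hC : ((C₁ + C₂).toNNReal : ℝ≥0∞) = C₁ + C₂ :=
    ENNReal.coe_toNNReal (ENNReal.add_ne_top.2 ⟨h1, h2⟩)
  refine ⟨(C₁ + C₂).toNNReal, ?_, fun u a v w H => ⟨?_, ?_⟩⟩
  · rw [← ENNReal.coe_pos, hC]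
    exact one_pos.trans_le (le_add_left le_add_self)
  · rw [hC]
    exact H.opNorm_le_condTotal.trans (mul_le_mul_left le_self_add _)
  · rw [hC]
    exact H.condTotal_le_opNorm.trans (mul_le_mul_left (le_add_self (a := C₂)) _)

end SupHardy

end

theorem mainTheorem1 (p q : ℝ) (hp : 1 < p) (hq : 1 < q) :
    ∃ C : ℝ≥0, 0 < C ∧
      ∀ (u : ℝ → ℝ≥0) (a v w : ℝ → ℝ≥0∞),
        ContinuousOn u (Ioi 0) →
        SupHardy.IsWeight (fun t => (u t : ℝ≥0∞)) →
        SupHardy.IsWeight a → SupHardy.IsWeight v → SupHardy.IsWeight w →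
        (∀ x : ℝ, 0 < x →
          0 < ∫⁻ t in Ioo 0 x, v t ^ (1 - SupHardy.conj p) ∧
          ∫⁻ t in Ioo 0 x, v t ^ (1 - SupHardy.conj p) < ∞) →
        (p ≤ q →
          SupHardy.opNorm p q u a v w ≤
              C * (SupHardy.termA1 p q u a v w + SupHardy.termA2 p q u a v w
                + SupHardy.termA3 p q u a v w + SupHardy.termA4 p q u a v w
                + SupHardy.termLim p q u a v w) ∧
          SupHardy.termA1 p q u a v w + SupHardy.termA2 p q u a v w
                + SupHardy.termA3 p q u a v w + SupHardy.termA4 p q u a v w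
                + SupHardy.termLim p q u a v w ≤
              C * SupHardy.opNorm p q u a v w) ∧
        (q < p →
          SupHardy.opNorm p q u a v w ≤
              C * (SupHardy.termB1 p q u a v w + SupHardy.termB2 p q u a v w
                + SupHardy.termB3 p q u a v w + SupHardy.termB4 p q u a v w
                + SupHardy.termLim p q u a v w) ∧
          SupHardy.termB1 p q u a v w + SupHardy.termB2 p q u a v w
                + SupHardy.termB3 p q u a v w + SupHardy.termB4 p q u a v w
                + SupHardy.termLim p q u a v w ≤
              C * SupHardy.opNorm p q u a v w) := by
  obtain ⟨C, hC, key⟩ := SupHardy.exists_const_opNorm_condTotal hp hq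
  refine ⟨C, hC, fun u a v w hu hwu hwa hwv hww hdual => ⟨fun hpq => ?_, fun hqp => ?_⟩⟩
  · rw [← SupHardy.condTotal_of_le hpq]
    exact key u a v w ⟨hp, hq, hu, hwu, hwa, hwv, hww, hdual⟩
  · rw [← SupHardy.condTotal_of_lt hqp]
    exact key u a v w ⟨hp, hq, hu, hwu, hwa, hwv, hww, hdual⟩
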